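/- **Setting.** Let $1\le d\le 3$, let $\Omega\subset\mathbb R^d$ be a bounded connected open set with smooth boundary, and let $T>0$. Put $H=L^2(\Omega)$, $V=H^1(\Omega)$, $V_0=H^1_0(\Omega)$ and $Q=\Omega\times(0,T)$. *Structure.* Let $\tau>0$, and let - $\widehat\beta:\mathbb R\to[0,+\infty]$ be convex, proper and l.s.c. with $\widehat\beta(0)=0$; set $\beta:=\partial\widehat\beta$, with effective domain $D(\beta)$; - $\widehat S:H\to\mathbb R$ be convex and l.s.c.; set $S:=\partial\widehat S\subset H\times H$, and assume that for some constant $C_S$ one has $\|v\|_H\le C_S(\|u\|_H+1)$ for all $u\in H$ and $v\in S(u)$; - $\Pi:\mathbb R\to\mathbb R$ be of class $C^1$ with Lipschitz continuous derivative $\pi:=\Pi'$. *Data.* Let $g\in L^2(0,T;H)$, $\varphi_0\in V$ with $\widehat\beta(\varphi_0)\in L^1(\Omega)$, and $\varphi^*\in L^2(0,T;H)$. Assume one of the following: - (Neumann) $\mathcal V=V$, and the mean value of $\varphi_0$ over $\Omega$ belongs to the interior of $D(\beta)$; or - (Dirichlet) $\mathcal V=V_0$. *Problem.* A solution is a quadruplet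 $(\varphi,\mu,\xi,\zeta)$ with $$\varphi\in H^1(0,T;H)\cap L^2(0,T;V),\quad \mu\in L^2(0,T;\mathcal V),\quad \xi,\zeta\in L^2(0,T;H),$$ $$\xi\in\beta(\varphi)\ \text{a.e. in }Q,\qquad \zeta(t)\in S(\varphi(t)-\varphi^*(t))\ \text{for a.a. }t\in(0,T),$$ such that $\varphi(0)=\varphi_0$ and, for a.a. $t\in(0,T)$, $$\int_\Omega\partial_t\varphi(t)\,v+\int_\Omega\nabla\mu(t)\cdot\nabla v=0\quad\text{for every }v\in\mathcal V,$$ $$\tau\int_\Omega\partial_t\varphi(t)\,v+\int_\Omega\nabla\varphi(t)\cdot\nabla v+\int_\Omega\bigl(\xi(t)+\pi(\varphi(t))+\zeta(t)\bigr)v=\int_\Omega\bigl(\mu(t)+g(t)\bigr)v\quad\text{for every }v\in V.$$ **Theorem.** In both cases the following hold. 1. (Existence) There exists a solution $(\varphi,\mu,\xi,\zeta)$. 2. (Uniqueness) Any two solutions for the same data have the same component $\varphi$; if $\mathcal V=V_0$, they also have the same component $\mu$. 3. (Continuous dependence) For every $M$ there is a constant $C_{cd}$, depending only on $M$, $\Omega$,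 $T$, $\mathcal V$ and the structure $(\tau,\widehat\beta,\widehat S,\Pi)$, such that the following is true. Let $(g_i,\varphi_{0,i},\varphi^*_i)$, $i=1,2$, be two choices of data satisfying the assumptions above, with $\varphi_{0,1}$ and $\varphi_{0,2}$ having the same mean value if $\mathcal V=V$, and let $(\varphi_i,\mu_i,\xi_i,\zeta_i)$ be any corresponding solutions such that $\|\varphi_i\|_{L^2(0,T;H)}\le M$ and $\|\varphi^*_i\|_{L^2(0,T;H)}\le M$. Then $$\|\varphi_1-\varphi_2\|_{L^\infty(0,T;H)}+\|\varphi_1-\varphi_2\|_{L^2(0,T;V)}\le C_{cd}\Bigl(\|g_1-g_2\|_{L^2(0,T;H)}+\|\varphi_{0,1}-\varphi_{0,2}\|_H+\|\varphi^*_1-\varphi^*_2\|_{L^2(0,T;H)}^{1/2}\Bigr).$$ -/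

import Mathlib

open MeasureTheory Set Filter Topology
open scoped ContDiff NNReal ENNReal

noncomputable section

namespace CahnHilliard

/-! ### The domain -/

/-- `Ω` has a smooth boundary: near each of its boundary points, `Ω` is the sublevel set `{ρ < 0}` of
a smooth function `ρ` whose differential does not vanish at that point. -/
def HasSmoothBoundary {d : ℕ} (Ω : Set (EuclideanSpace ℝ (Fin d))) : Prop :=
  ∀ x₀ ∈ frontier Ω, ∃ U : Set (EuclideanSpace ℝ (Fin d)), IsOpen U ∧ x₀ ∈ U ∧
    ∃ ρ : EuclideanSpace ℝ (Fin d) → ℝ, ContDiffOn ℝ ∞ ρ U ∧ fderiv ℝ ρ x₀ ≠ 0 ∧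
      Ω ∩ U = {x ∈ U | ρ x < 0}

/-- Bounded, connected (in particular nonempty) open sets with a smooth boundary. -/
structure IsSmoothBoundedDomain {d : ℕ} (Ω : Set (EuclideanSpace ℝ (Fin d))) : Prop where
  isOpen : IsOpen Ω
  isBounded : Bornology.IsBounded Ω
  isConnected : IsConnected Ω
  smooth : HasSmoothBoundary Ω

/-! ### The spaces `H = L²(Ω)`, `V = H¹(Ω)`, `V₀ = H¹₀(Ω)` -/

/-- `L²(Ω)`. -/
abbrev L2 {d : ℕ} (Ω : Set (EuclideanSpace ℝ (Fin d))) : Type :=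
  Lp ℝ 2 (volume.restrict Ω)

/-- `L²(Ω; ℝᵈ)`. -/
abbrev L2Vec {d : ℕ} (Ω : Set (EuclideanSpace ℝ (Fin d))) : Type :=
  Lp (EuclideanSpace ℝ (Fin d)) 2 (volume.restrict Ω)

/-- Test functions on an open set `Ω`: smooth functions with compact support contained in `Ω`. -/
structure IsTestFunction {E : Type*} [NormedAddCommGroup E] [NormedSpace ℝ E]
    (Ω : Set E) (ψ : E → ℝ) : Prop where
  contDiff : ContDiff ℝ ∞ ψ
  hasCompactSupport : HasCompactSupport ψ
  tsupport_subset : tsupport ψ ⊆ Ω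

/-- `G` is the weak gradient of `u` in `Ω`. -/
def HasWeakGradient {d : ℕ} (Ω : Set (EuclideanSpace ℝ (Fin d))) (u : L2 Ω) (G : L2Vec Ω) : Prop :=
  ∀ ψ : EuclideanSpace ℝ (Fin d) → ℝ, IsTestFunction Ω ψ → ∀ i : Fin d,
    ∫ x in Ω, u x * fderiv ℝ ψ x (EuclideanSpace.single i 1) = -∫ x in Ω, G x i * ψ x

theorem IsTestFunction.memLp {d : ℕ} {Ω : Set (EuclideanSpace ℝ (Fin d))}
    {ψ : EuclideanSpace ℝ (Fin d) → ℝ} (hψ : IsTestFunction Ω ψ) :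
    MemLp ψ 2 (volume.restrict Ω) :=
  (hψ.contDiff.continuous.memLp_of_hasCompactSupport hψ.hasCompactSupport).restrict Ω

theorem IsTestFunction.memLp_fderiv {d : ℕ} {Ω : Set (EuclideanSpace ℝ (Fin d))}
    {ψ : EuclideanSpace ℝ (Fin d) → ℝ} (hψ : IsTestFunction Ω ψ) (e : EuclideanSpace ℝ (Fin d)) :
    MemLp (fun x => fderiv ℝ ψ x e) 2 (volume.restrict Ω) := by
  refine (Continuous.memLp_of_hasCompactSupport ?_ ?_).restrict Ω
  · exact (hψ.contDiff.continuous_fderiv (by simp)).clm_apply continuous_const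
  · exact hψ.hasCompactSupport.fderiv_apply ℝ e

theorem integrable_mul_fderiv {d : ℕ} {Ω : Set (EuclideanSpace ℝ (Fin d))}
    {ψ : EuclideanSpace ℝ (Fin d) → ℝ} (hψ : IsTestFunction Ω ψ) (u : L2 Ω)
    (e : EuclideanSpace ℝ (Fin d)) :
    Integrable (fun x => u x * fderiv ℝ ψ x e) (volume.restrict Ω) :=
  (Lp.memLp u).integrable_mul (hψ.memLp_fderiv e)

theorem integrable_coord_mul {d : ℕ} {Ω : Set (EuclideanSpace ℝ (Fin d))}
    {ψ : EuclideanSpace ℝ (Fin d) → ℝ} (hψ : IsTestFunction Ω ψ) (G : L2Vec Ω) (i : Fin d) :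
    Integrable (fun x => G x i * ψ x) (volume.restrict Ω) := by
  have h : MemLp (fun x => G x i) 2 (volume.restrict Ω) :=
    (EuclideanSpace.proj (𝕜 := ℝ) i).comp_memLp' (Lp.memLp G)
  exact h.integrable_mul hψ.memLp

/-- `H¹(Ω)`, as the graph of the weak gradient in `L²(Ω) × L²(Ω; ℝᵈ)` with the Hilbert product norm
`(‖u‖² + ‖∇u‖²)^{1/2}`. -/
def sobolevGraph {d : ℕ} (Ω : Set (EuclideanSpace ℝ (Fin d))) :
    Submodule ℝ (WithLp 2 (L2 Ω × L2Vec Ω)) where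
  carrier := {p | HasWeakGradient Ω p.fst p.snd}
  zero_mem' := by
    intro ψ hψ i
    have h1 : (fun x => (0 : L2 Ω) x * fderiv ℝ ψ x (EuclideanSpace.single i 1))
        =ᵐ[volume.restrict Ω] 0 := by
      filter_upwards [Lp.coeFn_zero ℝ 2 (volume.restrict Ω)] with x hx
      rw [hx]
      simp
    have h2 : (fun x => (0 : L2Vec Ω) x i * ψ x) =ᵐ[volume.restrict Ω] 0 := by
      filter_upwards [Lp.coeFn_zero (EuclideanSpace ℝ (Fin d)) 2 (volume.restrict Ω)] with x hx
      rw [hx]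
      simp
    simp only [WithLp.zero_fst, WithLp.zero_snd]
    rw [integral_congr_ae h1, integral_congr_ae h2]
    simp
  add_mem' := by
    intro p q hp hq ψ hψ i
    have h1 : (fun x => (p.fst + q.fst : L2 Ω) x * fderiv ℝ ψ x (EuclideanSpace.single i 1))
        =ᵐ[volume.restrict Ω] fun x => p.fst x * fderiv ℝ ψ x (EuclideanSpace.single i 1)
          + q.fst x * fderiv ℝ ψ x (EuclideanSpace.single i 1) := by
      filter_upwards [Lp.coeFn_add p.fst q.fst] with x hx
      rw [hx, Pi.add_apply, add_mul]
    have h2 : (fun x => (p.snd + q.snd : L2Vec Ω) x i * ψ x)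
        =ᵐ[volume.restrict Ω] fun x => p.snd x i * ψ x + q.snd x i * ψ x := by
      filter_upwards [Lp.coeFn_add p.snd q.snd] with x hx
      rw [hx, Pi.add_apply, PiLp.add_apply, add_mul]
    simp only [WithLp.add_fst, WithLp.add_snd]
    rw [integral_congr_ae h1, integral_congr_ae h2,
      integral_add (integrable_mul_fderiv hψ _ _) (integrable_mul_fderiv hψ _ _),
      integral_add (integrable_coord_mul hψ _ _) (integrable_coord_mul hψ _ _),
      hp ψ hψ i, hq ψ hψ i]
    ring
  smul_mem' := by
    intro c p hp ψ hψ i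
    have h1 : (fun x => (c • p.fst : L2 Ω) x * fderiv ℝ ψ x (EuclideanSpace.single i 1))
        =ᵐ[volume.restrict Ω]
          fun x => c * (p.fst x * fderiv ℝ ψ x (EuclideanSpace.single i 1)) := by
      filter_upwards [Lp.coeFn_smul c p.fst] with x hx
      rw [hx, Pi.smul_apply, smul_eq_mul, mul_assoc]
    have h2 : (fun x => (c • p.snd : L2Vec Ω) x i * ψ x)
        =ᵐ[volume.restrict Ω] fun x => c * (p.snd x i * ψ x) := by
      filter_upwards [Lp.coeFn_smul c p.snd] with x hx
      rw [hx, Pi.smul_apply, PiLp.smul_apply, smul_eq_mul, mul_assoc]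
    simp only [WithLp.smul_fst, WithLp.smul_snd]
    rw [integral_congr_ae h1, integral_congr_ae h2, integral_const_mul, integral_const_mul,
      hp ψ hψ i]
    ring

/-- The Hilbert space `V = H¹(Ω)`. -/
abbrev H1 {d : ℕ} (Ω : Set (EuclideanSpace ℝ (Fin d))) : Type := sobolevGraph Ω

/-- The embedding `V ⊂ H`. -/
def H1.toL2 {d : ℕ} (Ω : Set (EuclideanSpace ℝ (Fin d))) : H1 Ω →L[ℝ] L2 Ω :=
  (WithLp.fstL 2 ℝ (L2 Ω) (L2Vec Ω)).comp (sobolevGraph Ω).subtypeL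

/-- The weak gradient `V → L²(Ω; ℝᵈ)`. -/
def H1.grad {d : ℕ} (Ω : Set (EuclideanSpace ℝ (Fin d))) : H1 Ω →L[ℝ] L2Vec Ω :=
  (WithLp.sndL 2 ℝ (L2 Ω) (L2Vec Ω)).comp (sobolevGraph Ω).subtypeL

/-- `V₀ = H¹₀(Ω)`, the closure of the test functions in `H¹(Ω)`. -/
def H10 {d : ℕ} (Ω : Set (EuclideanSpace ℝ (Fin d))) : Submodule ℝ (H1 Ω) :=
  (Submodule.span ℝ {v : H1 Ω | ∃ ψ : EuclideanSpace ℝ (Fin d) → ℝ, IsTestFunction Ω ψ ∧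
    H1.toL2 Ω v =ᵐ[volume.restrict Ω] ψ}).topologicalClosure

/-- The two kinds of (homogeneous) boundary conditions for the chemical potential. -/
inductive BoundaryCondition : Type
  | neumann
  | dirichlet

/-- The space `𝒱` in which the chemical potential and its test functions are taken: `V` for the Neumann
condition, `V₀` for the Dirichlet condition. -/
def BoundaryCondition.space {d : ℕ} (Ω : Set (EuclideanSpace ℝ (Fin d))) :
    BoundaryCondition → Submodule ℝ (H1 Ω)
  | .neumann => ⊤
  | .dirichlet => H10 Ω

/-! ### Functions of time with values in a Hilbert space -/

/-- Lebesgue measure on `(0, T)`. -/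
abbrev timeMeasure (T : ℝ) : Measure ℝ := volume.restrict (Ioo 0 T)

/-- `L²(0, T; X)`. -/
abbrev L2Time (T : ℝ) (X : Type) [NormedAddCommGroup X] : Type := Lp X 2 (timeMeasure T)

/-- `u' ∈ L²(0, T; X)` is the weak derivative of `u ∈ L²(0, T; X)`; thus `u ∈ H¹(0, T; X)`. -/
def HasWeakTimeDeriv {T : ℝ} {X : Type} [NormedAddCommGroup X] [NormedSpace ℝ X]
    (u u' : L2Time T X) : Prop :=
  ∀ ψ : ℝ → ℝ, IsTestFunction (Ioo 0 T) ψ →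
    ∫ t in Ioo 0 T, deriv ψ t • u t = -∫ t in Ioo 0 T, ψ t • u' t

/-- `u(0) = u₀`, for the representative of `u` in `C⁰([0, T]; X)`. -/
def HasInitialValue {T : ℝ} {X : Type} [NormedAddCommGroup X] (u : L2Time T X) (u₀ : X) : Prop :=
  ∃ w : ℝ → X, ContinuousOn w (Icc 0 T) ∧ u =ᵐ[timeMeasure T] w ∧ w 0 = u₀

/-! ### Subdifferentials -/

/-- The subdifferential at `u` of a proper function `f : X → (-∞, +∞]` on a Hilbert space. Since `f` is
proper, it is empty where `f = +∞`. -/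
def subdifferential {X : Type} [NormedAddCommGroup X] [InnerProductSpace ℝ X]
    (f : X → EReal) (u : X) : Set X :=
  {v | ∀ w : X, f u + ((inner ℝ v (w - u) : ℝ) : EReal) ≤ f w}

/-- The graph `β = ∂β̂` in `ℝ × ℝ`. -/
def betaGraph (betaHat : ℝ → ℝ≥0∞) : ℝ → Set ℝ :=
  subdifferential fun r => (betaHat r : EReal)

/-- The effective domain `D(β)`. -/
def betaDomain (betaHat : ℝ → ℝ≥0∞) : Set ℝ := {r | (betaGraph betaHat r).Nonempty}

/-- The graph `S = ∂Ŝ` in `L²(Ω) × L²(Ω)`. -/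
def sGraph {d : ℕ} {Ω : Set (EuclideanSpace ℝ (Fin d))} (SHat : L2 Ω → ℝ) : L2 Ω → Set (L2 Ω) :=
  subdifferential fun u => (SHat u : EReal)

/-! ### The problem -/

/-- The structure `τ`, `β̂`, `Ŝ`, `Π` of the system. -/
structure SystemStructure {d : ℕ} (Ω : Set (EuclideanSpace ℝ (Fin d))) where
  tau : ℝ
  betaHat : ℝ → ℝ≥0∞
  SHat : L2 Ω → ℝ
  PiHat : ℝ → ℝ

/-- The assumptions on the structure. Properness of `β̂` is contained in `β̂(0) = 0`, the one of `Ŝ` in the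
fact that `Ŝ` is real valued. -/
structure SystemStructure.Admissible {d : ℕ} {Ω : Set (EuclideanSpace ℝ (Fin d))}
    (P : SystemStructure Ω) : Prop where
  tau_pos : 0 < P.tau
  betaHat_convex : ConvexOn ℝ≥0 univ P.betaHat
  betaHat_lsc : LowerSemicontinuous P.betaHat
  betaHat_zero : P.betaHat 0 = 0
  SHat_convex : ConvexOn ℝ univ P.SHat
  SHat_lsc : LowerSemicontinuous P.SHat
  S_growth : ∃ CS : ℝ, ∀ u v : L2 Ω, v ∈ sGraph P.SHat u → ‖v‖ ≤ CS * (‖u‖ + 1)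
  PiHat_contDiff : ContDiff ℝ 1 P.PiHat
  PiHat_deriv_lipschitz : ∃ K : ℝ≥0, LipschitzWith K (deriv P.PiHat)

/-- The data `g ∈ L²(0, T; H)`, `φ₀ ∈ V`, `φ* ∈ L²(0, T; H)`. -/
structure ProblemData {d : ℕ} (Ω : Set (EuclideanSpace ℝ (Fin d))) (T : ℝ) where
  g : L2Time T (L2 Ω)
  phi0 : H1 Ω
  phiStar : L2Time T (L2 Ω)

/-- The mean value over `Ω`. -/
def mean {d : ℕ} {Ω : Set (EuclideanSpace ℝ (Fin d))} (u : L2 Ω) : ℝ := ⨍ x in Ω, u x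

/-- The remaining assumptions on the data: `β̂(φ₀) ∈ L¹(Ω)` and, for the Neumann condition, the mean value
of `φ₀` belongs to the interior of `D(β)`. -/
structure ProblemData.Admissible {d : ℕ} {Ω : Set (EuclideanSpace ℝ (Fin d))} {T : ℝ}
    (D : ProblemData Ω T) (P : SystemStructure Ω) (bc : BoundaryCondition) : Prop where
  betaHat_phi0 : ∫⁻ x in Ω, P.betaHat (H1.toL2 Ω D.phi0 x) < ⊤
  mean_phi0 : bc = .neumann → mean (H1.toL2 Ω D.phi0) ∈ interior (betaDomain P.betaHat)

/-- `(φ, μ, ξ, ζ)` solves the problem: `φ ∈ H¹(0, T; H) ∩ L²(0, T; V)`, `μ ∈ L²(0, T; 𝒱)`,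
`ξ, ζ ∈ L²(0, T; H)`, `ξ ∈ β(φ)` almost everywhere, `ζ ∈ S(φ - φ*)` for almost every time, the two
variational equations hold for almost every time, and `φ(0) = φ₀`. -/
def IsSolution {d : ℕ} {Ω : Set (EuclideanSpace ℝ (Fin d))} {T : ℝ}
    (P : SystemStructure Ω) (bc : BoundaryCondition) (D : ProblemData Ω T)
    (phi mu : L2Time T (H1 Ω)) (xi zeta : L2Time T (L2 Ω)) : Prop :=
  (∀ᵐ t ∂timeMeasure T, mu t ∈ bc.space Ω) ∧
  (∀ᵐ t ∂timeMeasure T, ∀ᵐ x ∂volume.restrict Ω,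
    xi t x ∈ betaGraph P.betaHat (H1.toL2 Ω (phi t) x)) ∧
  (∀ᵐ t ∂timeMeasure T, zeta t ∈ sGraph P.SHat (H1.toL2 Ω (phi t) - D.phiStar t)) ∧
  (∃ dphi : L2Time T (L2 Ω),
    HasWeakTimeDeriv ((H1.toL2 Ω).compLp phi) dphi ∧
    (∀ᵐ t ∂timeMeasure T, ∀ v ∈ bc.space Ω,
      (∫ x in Ω, dphi t x * H1.toL2 Ω v x)
        + ∫ x in Ω, inner ℝ (H1.grad Ω (mu t) x) (H1.grad Ω v x) = 0) ∧
    (∀ᵐ t ∂timeMeasure T, ∀ v : H1 Ω,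
      P.tau * (∫ x in Ω, dphi t x * H1.toL2 Ω v x)
        + (∫ x in Ω, inner ℝ (H1.grad Ω (phi t) x) (H1.grad Ω v x))
        + (∫ x in Ω, (xi t x + deriv P.PiHat (H1.toL2 Ω (phi t) x) + zeta t x) * H1.toL2 Ω v x)
        = ∫ x in Ω, (H1.toL2 Ω (mu t) x + D.g t x) * H1.toL2 Ω v x)) ∧
  HasInitialValue ((H1.toL2 Ω).compLp phi) (H1.toL2 Ω D.phi0)

end CahnHilliard

end

open CahnHilliard

namespace ViscousCahnHilliard

/-! ### Ordinary differential equations and a Gronwall inequality -/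

/-! The potential is eliminated first. Let `A` be `-Δ` with natural boundary condition, realised in
`H` through the form of the gradients (`formGraph`), let `B` be the superposition of `β`
(`lpGraph`), and let `N` solve `-Δ μ = P f` in `𝒱`. Here `P` is the identity for the Dirichlet
condition and the removal of the mean value for the Neumann condition. Applying `P` to the second
equation and inserting `P μ = -N φ'` from the first one gives a single evolution inclusion in `H`,
`(τ + N) φ' + P (A φ + B φ + π(φ) + S(φ - φ*) - g) ∋ 0`. Conversely, if `F` denotes the argument of
`P`, then `μ = Q F - N φ'` recovers the system, where `Q F` lifts the part `F - P F` to an element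
with zero gradient.

Because `τ > 0` and `N ≥ 0`, the operator `τ + N` is boundedly invertible. Replacing `A`, `B`, `S`
by Yosida approximations with parameter `l` therefore gives an ordinary differential equation in `H`
with Lipschitz right-hand side (`exists_regularSolution`). Testing with `φ'` bounds `φ` in
`L^∞(0,T;H)` and `φ'` in `L²(0,T;H)` uniformly in `l` (`exists_energy_bound`). The equation then
bounds `P (A φ + B φ)`. Its complement, a mean value, is controlled by monotonicity of `β` tested at
two constants on either side of the conserved mean; this is where the mean of `φ₀` has to be
interior to the domain of `β` (`exists_kernel_bound`). Finally the scalar product of the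
approximations of `A φ` and `B φ` is nonnegative, so the bound on the sum bounds each of them
(`exists_bounds`).

With these bounds, monotonicity alone makes the approximations a Cauchy sequence in `C([0,T];H)` as
the parameters tend to zero (`exists_stability`), so no compact embedding enters. The nonlinear
terms converge weakly along an ultrafilter, and Minty's argument identifies their limits
(`mem_of_tendsto_weak`).

The domain enters through the Poincaré inequalities, needed to define `N`, and through the sign of
the cross term. The cross term needs that contractions do not increase the norm of the gradient
(`exists_gradient_of_contraction`). That fact and the Poincaré–Wirtinger inequality both come from
one estimate for translations of Sobolev functions (`eLpNorm_translate_sub_le`).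

For continuous dependence, the first equation for the difference of two solutions is tested with `N`
of the difference of the `φ`, and the second with that difference itself. The potentials cancel and
a Gronwall inequality for the quadratic form of `τ + N` remains (`difference_le`,
`IsPotentialSolver.exists_stability`). The monotonicity of `S` acts on `φ - φ*`, leaving the error
`‖ζ₁ - ζ₂‖ ‖φ*₁ - φ*₂‖` in the squared estimate; as the `ζ` are only bounded, this produces the
exponent `1/2`. Uniqueness of `φ` is the case of equal data, and in the Dirichlet case Poincaré's
inequality then determines `μ`. -/

/-- Global solvability of an initial value problem with a globally Lipschitz right-hand side. -/
theorem exists_global_ode_solution {H : Type*} [NormedAddCommGroup H] [NormedSpace ℝ H]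
    [CompleteSpace H] {F : ℝ → H → H} (hF : Continuous (Function.uncurry F)) {K : ℝ}
    (hK : 0 ≤ K) (hL : ∀ t u v, ‖F t u - F t v‖ ≤ K * ‖u - v‖) {T : ℝ} (hT : 0 < T) (u₀ : H) :
    ∃ u u' : ℝ → H, Continuous u' ∧ (∀ t, HasDerivAt u (u' t) t) ∧ u 0 = u₀ ∧
      ∀ t ∈ Icc 0 T, u' t = F t (u t) := by
  -- The fixed point is sought for `v t = exp (-k t) • u t`. This exponential weight gives the
  -- contraction constant `K / k ≤ 1 / 2` whatever the length of the interval; the summand `1` keeps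
  -- `k` positive when `K = 0`.
  set k : ℝ := 2 * K + 1 with hk
  have hk0 : 0 < k := by positivity
  -- Freezing `v` outside `[0, T]` makes the integrand continuous on the whole line, so that `u` is
  -- differentiable everywhere although the equation is only claimed on `[0, T]`.
  let p : ℝ → Icc (0 : ℝ) T := projIcc 0 T hT.le
  have hp : Continuous p := continuous_projIcc
  let f : C(Icc (0 : ℝ) T, H) → ℝ → H := fun v s => F s (Real.exp (k * s) • v (p s))
  have hf : ∀ v, Continuous (f v) := fun v => by
    have : Continuous fun s : ℝ => (s, Real.exp (k * s) • v (p s)) := by fun_prop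
    exact hF.comp this
  have hint : ∀ v, Continuous fun t => ∫ s in (0 : ℝ)..t, f v s := fun v =>
    intervalIntegral.continuous_primitive (fun a b => (hf v).intervalIntegrable a b) 0
  let Ψ : C(Icc (0 : ℝ) T, H) → C(Icc (0 : ℝ) T, H) := fun v =>
    ⟨fun t => Real.exp (-(k * t)) • (u₀ + ∫ s in (0 : ℝ)..t, f v s), by
      have := hint v
      fun_prop⟩
  have hΨ : ContractingWith (1 / 2) Ψ := by
    refine ⟨by norm_num, LipschitzWith.of_dist_le_mul fun v w => ?_⟩
    rw [ContinuousMap.dist_le (by positivity)]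
    rintro ⟨t, ht⟩
    have h1 : ‖∫ s in (0 : ℝ)..t, (f v s - f w s)‖
        ≤ ∫ s in (0 : ℝ)..t, K * (Real.exp (k * s) * dist v w) := by
      refine intervalIntegral.norm_integral_le_of_norm_le ht.1 (Eventually.of_forall fun s _ => ?_)
        (Continuous.intervalIntegrable (by fun_prop) _ _)
      refine (hL _ _ _).trans ?_
      gcongr
      rw [← smul_sub, norm_smul, Real.norm_eq_abs, abs_of_pos (Real.exp_pos _), ← dist_eq_norm]
      gcongr
      exact ContinuousMap.dist_apply_le_dist _
    have h2 : ∫ s in (0 : ℝ)..t, K * (Real.exp (k * s) * dist v w)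
        = K * dist v w * ((Real.exp (k * t) - 1) / k) := by
      have : ∀ s ∈ uIcc 0 t,
          HasDerivAt (fun s => K * dist v w * (Real.exp (k * s) / k))
            (K * (Real.exp (k * s) * dist v w)) s := by
        intro s _
        have := (((hasDerivAt_id s).const_mul k).exp.div_const k).const_mul (K * dist v w)
        refine this.congr_deriv ?_
        simp only [id]
        field_simp
      rw [intervalIntegral.integral_eq_sub_of_hasDerivAt this
        (Continuous.intervalIntegrable (by fun_prop) _ _)]
      simp
      ring
    have h3 : dist (Ψ v ⟨t, ht⟩) (Ψ w ⟨t, ht⟩)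
        = Real.exp (-(k * t)) * ‖∫ s in (0 : ℝ)..t, (f v s - f w s)‖ := by
      rw [intervalIntegral.integral_sub ((hf v).intervalIntegrable _ _)
        ((hf w).intervalIntegrable _ _), dist_eq_norm]
      simp only [Ψ, ContinuousMap.coe_mk]
      rw [← smul_sub, norm_smul, Real.norm_eq_abs, abs_of_pos (Real.exp_pos _)]
      congr 2
      abel
    rw [h3]
    calc _ ≤ Real.exp (-(k * t)) * (K * dist v w * ((Real.exp (k * t) - 1) / k)) := by
          rw [← h2]; gcongr
      _ = (K / k * (1 - Real.exp (-(k * t)))) * dist v w := by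
          rw [Real.exp_neg]
          field_simp [Real.exp_ne_zero]
      _ ≤ 1 / 2 * dist v w := by
          gcongr
          have e1 := (Real.exp_pos (-(k * t))).le
          have e2 : K / k ≤ 1 / 2 := by rw [div_le_div_iff₀ hk0 two_pos]; linarith
          have e3 : 0 ≤ K / k := by positivity
          nlinarith
      _ = _ := by norm_num
  let v := hΨ.fixedPoint Ψ
  have hv : Ψ v = v := hΨ.fixedPoint_isFixedPt
  refine ⟨fun t => u₀ + ∫ s in (0 : ℝ)..t, f v s, f v, hf v, fun t => ?_, by simp, ?_⟩
  · exact ((hf v).integral_hasStrictDerivAt 0 t).hasDerivAt.const_add _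
  · intro t ht
    have h1 : v ⟨t, ht⟩ = Real.exp (-(k * t)) • (u₀ + ∫ s in (0 : ℝ)..t, f v s) := by
      conv_lhs => rw [← hv]
      rfl
    have h2 : p t = ⟨t, ht⟩ := projIcc_of_mem hT.le ht
    simp only [f]
    rw [h2, h1, smul_smul, ← Real.exp_add]
    simp [f]

/-- A Gronwall inequality with a dissipation term. -/
theorem gronwall_dissipation {y y' p k : ℝ → ℝ} {C T : ℝ} (hC : 0 ≤ C)
    (hy : ∀ t, HasDerivAt y (y' t) t) (hy0 : ∀ t ∈ Icc 0 T, 0 ≤ y t)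
    (hp : Continuous p) (hk : Continuous k)
    (hp0 : ∀ t ∈ Icc 0 T, 0 ≤ p t) (hk0 : ∀ t ∈ Icc 0 T, 0 ≤ k t)
    (h : ∀ t ∈ Icc 0 T, y' t + p t ≤ C * y t + k t) {t : ℝ} (ht : t ∈ Icc 0 T) :
    Real.exp (-(C * T)) * (y t) + Real.exp (-(C * T)) * ∫ s in (0 : ℝ)..t, p s
      ≤ y 0 + ∫ s in (0 : ℝ)..t, k s := by
  -- This function is nondecreasing: multiply the hypothesis by `exp (-C s)`, then use `exp (-C T) ≤
  -- exp (-C s)` on the dissipation and `exp (-C s) ≤ 1` on the forcing.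
  let z : ℝ → ℝ := fun s => (∫ r in (0 : ℝ)..s, k r) - Real.exp (-(C * s)) * y s
    - Real.exp (-(C * T)) * ∫ r in (0 : ℝ)..s, p r
  have hz : ∀ s, HasDerivAt z (k s - (Real.exp (-(C * s)) * (-C) * y s
      + Real.exp (-(C * s)) * y' s) - Real.exp (-(C * T)) * p s) s := by
    intro s
    have e1 : HasDerivAt (fun s => Real.exp (-(C * s))) (Real.exp (-(C * s)) * (-C)) s := by
      have := ((hasDerivAt_id s).const_mul C).neg.exp
      simpa using this
    exact (((hk.integral_hasStrictDerivAt 0 s).hasDerivAt).sub (e1.mul (hy s))).sub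
      ((hp.integral_hasStrictDerivAt 0 s).hasDerivAt.const_mul _)
  have hmono : MonotoneOn z (Icc 0 T) := by
    refine monotoneOn_of_deriv_nonneg (convex_Icc 0 T)
      (fun s _ => (hz s).continuousAt.continuousWithinAt)
      (fun s _ => (hz s).differentiableAt.differentiableWithinAt) fun s hs => ?_
    rw [interior_Icc] at hs
    have hs' := Ioo_subset_Icc_self hs
    rw [(hz s).deriv]
    have e2 : Real.exp (-(C * T)) ≤ Real.exp (-(C * s)) :=
      Real.exp_le_exp.2 (by nlinarith [hs.2])
    have e3 : Real.exp (-(C * s)) ≤ 1 := Real.exp_le_one_iff.2 (by nlinarith [hs.1])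
    have e4 := mul_le_mul_of_nonneg_left (h s hs') (Real.exp_pos (-(C * s))).le
    have e5 := mul_le_mul_of_nonneg_right e2 (hp0 s hs')
    have e6 := mul_le_mul_of_nonneg_right e3 (hk0 s hs')
    nlinarith
  have h0 : (0 : ℝ) ∈ Icc 0 T := ⟨le_rfl, ht.1.trans ht.2⟩
  have := hmono h0 ht ht.1
  simp only [z, intervalIntegral.integral_same, mul_zero, neg_zero, Real.exp_zero, one_mul,
    sub_zero, zero_sub] at this
  have e8 : Real.exp (-(C * T)) ≤ Real.exp (-(C * t)) := Real.exp_le_exp.2 (by nlinarith [ht.2])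
  have := mul_le_mul_of_nonneg_right e8 (hy0 t ht)
  linarith

/-! ### Weak limits along an ultrafilter -/

section WeakLimit
variable {X : Type*} [NormedAddCommGroup X] [InnerProductSpace ℝ X]

/-- Bounded sequences of a Hilbert space converge weakly along every ultrafilter. -/
theorem exists_weak_limit [CompleteSpace X] (U : Ultrafilter ℕ) {x : ℕ → X} {C : ℝ}
    (hx : ∀ n, ‖x n‖ ≤ C) :
    ∃ y : X, ‖y‖ ≤ C ∧ ∀ z, Tendsto (fun n => inner ℝ (x n) z) U (𝓝 (inner ℝ y z)) := by
  have hb : ∀ z n, |inner ℝ (x n) z| ≤ C * ‖z‖ := fun z n =>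
    (abs_real_inner_le_norm _ _).trans (by gcongr; exact hx n)
  -- Each scalar sequence lies in a compact interval, where an ultrafilter converges. The limits are
  -- linear in `z` and bounded, so the Riesz theorem represents them; separability and subsequences
  -- play no role.
  have hlim : ∀ z, ∃ l : ℝ, Tendsto (fun n => inner ℝ (x n) z) U (𝓝 l) := fun z => by
    obtain ⟨l, _, hl⟩ := (isCompact_Icc (a := -(C * ‖z‖)) (b := C * ‖z‖)).ultrafilter_le_nhds
      (U.map fun n => inner ℝ (x n) z) (by
        simp only [le_principal_iff, Ultrafilter.mem_coe, Ultrafilter.mem_map]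
        exact univ_mem' fun n => abs_le.1 (hb z n))
    exact ⟨l, hl⟩
  choose l hl using hlim
  let L : X →ₗ[ℝ] ℝ :=
    { toFun := l
      map_add' := fun a b => tendsto_nhds_unique (hl (a + b)) (by
        simpa only [inner_add_right] using (hl a).add (hl b))
      map_smul' := fun c a => tendsto_nhds_unique (hl (c • a)) (by
        simpa only [real_inner_smul_right, RingHom.id_apply, smul_eq_mul] using
          (hl a).const_mul c) }
  have hL : ∀ z, ‖L z‖ ≤ C * ‖z‖ := fun z =>
    le_of_tendsto (hl z).norm (Eventually.of_forall fun n => hb z n)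
  have hC : 0 ≤ C := (norm_nonneg _).trans (hx 0)
  refine ⟨(InnerProductSpace.toDual ℝ X).symm (L.mkContinuous C hL), ?_, fun z => ?_⟩
  · rw [LinearIsometryEquiv.norm_map]
    exact L.mkContinuous_norm_le hC hL
  · rw [InnerProductSpace.toDual_symm_apply]
    exact hl z

theorem tendsto_inner_of_weak_of_strong {ι : Type*} {U : Filter ι} {x : ι → X} {y : X} {C : ℝ}
    (hC : ∀ n, ‖x n‖ ≤ C) (hx : ∀ z, Tendsto (fun n => inner ℝ (x n) z) U (𝓝 (inner ℝ y z)))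
    {z : ι → X} {w : X} (hz : Tendsto z U (𝓝 w)) :
    Tendsto (fun n => inner ℝ (x n) (z n)) U (𝓝 (inner ℝ y w)) := by
  have h1 : Tendsto (fun n => inner ℝ (x n) (z n - w)) U (𝓝 0) := by
    have h2 : Tendsto (fun n => C * ‖z n - w‖) U (𝓝 0) := by
      have := (tendsto_iff_norm_sub_tendsto_zero.1 hz).const_mul C
      simpa using this
    refine squeeze_zero_norm (fun n => ?_) h2
    exact (norm_inner_le_norm _ _).trans (by gcongr; exact hC n)
  have := h1.add (hx w)
  simpa [inner_sub_right] using this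

end WeakLimit

/-! ### Maximal monotone graphs, resolvents and Yosida approximations -/

section MaximalMonotone
variable {X : Type*} [NormedAddCommGroup X] [InnerProductSpace ℝ X]

/-- Monotone graphs all of whose resolvents are everywhere defined. -/
structure IsMaximalMonotone (G : X → Set X) : Prop where
  monotone : ∀ {u v ξ η : X}, ξ ∈ G u → η ∈ G v → 0 ≤ inner ℝ (ξ - η) (u - v)
  surjective : ∀ {l : ℝ}, 0 < l → ∀ f : X, ∃ u, ∃ ξ ∈ G u, u + l • ξ = f

open Classical in
/-- The resolvent `(1 + l G)⁻¹`. -/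
noncomputable def resolvent (G : X → Set X) (l : ℝ) (f : X) : X :=
  Classical.epsilon fun u => ∃ ξ ∈ G u, u + l • ξ = f

/-- The Yosida approximation of a graph. -/
noncomputable def yosida (G : X → Set X) (l : ℝ) (f : X) : X := l⁻¹ • (f - resolvent G l f)

namespace IsMaximalMonotone
variable {G : X → Set X} (hG : IsMaximalMonotone G) {l m : ℝ}
include hG

theorem resolvent_spec (hl : 0 < l) (f : X) :
    ∃ ξ ∈ G (resolvent G l f), resolvent G l f + l • ξ = f :=
  Classical.epsilon_spec (p := fun u => ∃ ξ ∈ G u, u + l • ξ = f) (hG.surjective hl f)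

omit hG in
theorem resolvent_add_yosida (hl : 0 < l) (f : X) : resolvent G l f + l • yosida G l f = f := by
  rw [yosida, smul_smul, mul_inv_cancel₀ hl.ne', one_smul, add_sub_cancel]

theorem yosida_mem (hl : 0 < l) (f : X) : yosida G l f ∈ G (resolvent G l f) := by
  obtain ⟨ξ, hξ, h⟩ := hG.resolvent_spec hl f
  have : yosida G l f = ξ := by
    rw [yosida, inv_smul_eq_iff₀ hl.ne', sub_eq_iff_eq_add', h]
  rwa [this]

/-- Split `f - g` into the differences of the resolvents and `l` times that of the Yosida values:
monotonicity of the graph makes the first pairing nonnegative, and the second is exactly the left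
side. Monotonicity and the Lipschitz constant `l⁻¹` both follow from it. -/
theorem sq_norm_yosida_sub_le (hl : 0 < l) (f g : X) :
    l * ‖yosida G l f - yosida G l g‖ ^ 2 ≤ inner ℝ (yosida G l f - yosida G l g) (f - g) := by
  have h := hG.monotone (hG.yosida_mem hl f) (hG.yosida_mem hl g)
  have e : f - g = (resolvent G l f - resolvent G l g)
      + l • (yosida G l f - yosida G l g) := by
    nth_rw 1 [← resolvent_add_yosida (G := G) hl f, ← resolvent_add_yosida (G := G) hl g]
    module
  rw [e, inner_add_right, real_inner_smul_right, real_inner_self_eq_norm_sq]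
  linarith

theorem inner_yosida_sub_nonneg (hl : 0 < l) (f g : X) :
    0 ≤ inner ℝ (yosida G l f - yosida G l g) (f - g) :=
  le_trans (by positivity) (hG.sq_norm_yosida_sub_le hl f g)

theorem norm_yosida_sub_le (hl : 0 < l) (f g : X) :
    ‖yosida G l f - yosida G l g‖ ≤ l⁻¹ * ‖f - g‖ := by
  have h := (hG.sq_norm_yosida_sub_le hl f g).trans (real_inner_le_norm _ _)
  rw [inv_mul_eq_div, le_div_iff₀ hl]
  by_cases h0 : ‖yosida G l f - yosida G l g‖ = 0
  · rw [h0]; simp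
  · have : 0 < ‖yosida G l f - yosida G l g‖ := lt_of_le_of_ne (norm_nonneg _) (Ne.symm h0)
    nlinarith

theorem norm_resolvent_sub_le (hl : 0 < l) (f g : X) :
    ‖resolvent G l f - resolvent G l g‖ ≤ ‖f - g‖ := by
  have h := hG.monotone (hG.yosida_mem hl f) (hG.yosida_mem hl g)
  have e : f - g = (resolvent G l f - resolvent G l g)
      + l • (yosida G l f - yosida G l g) := by
    nth_rw 1 [← resolvent_add_yosida (G := G) hl f, ← resolvent_add_yosida (G := G) hl g]
    module
  refine le_of_sq_le_sq ?_ (norm_nonneg _)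
  rw [e, norm_add_sq_real, real_inner_smul_right, real_inner_comm]
  have := mul_nonneg hl.le h
  nlinarith [sq_nonneg ‖l • (yosida G l f - yosida G l g)‖]

theorem lipschitzWith_resolvent (hl : 0 < l) : LipschitzWith 1 (resolvent G l) :=
  LipschitzWith.of_dist_le_mul fun f g => by
    simpa [dist_eq_norm] using hG.norm_resolvent_sub_le hl f g

theorem lipschitzWith_yosida (hl : 0 < l) : LipschitzWith (l⁻¹).toNNReal (yosida G l) :=
  LipschitzWith.of_dist_le_mul fun f g => by
    rw [Real.coe_toNNReal _ (inv_pos.2 hl).le]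
    simpa [dist_eq_norm] using hG.norm_yosida_sub_le hl f g

/-- Uniqueness in the resolvent equation: the difference of the graph values is a negative multiple
of the difference of the points, so monotonicity forces both to vanish. -/
theorem resolvent_eq (hl : 0 < l) {u ξ : X} (h : ξ ∈ G u) : resolvent G l (u + l • ξ) = u := by
  have h1 := hG.monotone (hG.yosida_mem hl (u + l • ξ)) h
  have e := resolvent_add_yosida (G := G) hl (u + l • ξ)
  set w := resolvent G l (u + l • ξ)
  set y := yosida G l (u + l • ξ)
  have e2 : l • (y - ξ) = -(w - u) := by
    rw [smul_sub, ← sub_eq_zero] at *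
    rw [← e]; abel
  have h2 : 0 ≤ inner ℝ (l • (y - ξ)) (w - u) := by
    rw [real_inner_smul_left]; positivity
  rw [e2, inner_neg_left, real_inner_self_eq_norm_sq] at h2
  have : ‖w - u‖ ^ 2 = 0 := le_antisymm (by linarith) (by positivity)
  rwa [sq_eq_zero_iff, norm_sub_eq_zero_iff] at this

/-- Membership becomes a fixed point equation for a Lipschitz map; Minty's argument below concludes
through it. -/
theorem mem_iff {u ξ : X} : ξ ∈ G u ↔ resolvent G 1 (u + ξ) = u := by
  refine ⟨fun h => by simpa using hG.resolvent_eq one_pos h, fun h => ?_⟩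
  have := hG.yosida_mem one_pos (u + ξ)
  rw [h, yosida, h] at this
  simpa using this

/-- The resolvent parts pair nonnegatively by monotonicity; what is left is a quadratic form in the
two Yosida values of size at most `l + m`. When those values stay bounded, this defect vanishes with
the parameters, which is the source of the Cauchy property. -/
theorem inner_yosida_sub_ge (hl : 0 < l) (hm : 0 < m) (f g : X) :
    -((l + m) * (‖yosida G l f‖ ^ 2 + ‖yosida G m g‖ ^ 2))
      ≤ inner ℝ (yosida G l f - yosida G m g) (f - g) := by
  have h := hG.monotone (hG.yosida_mem hl f) (hG.yosida_mem hm g)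
  have e : f - g = (resolvent G l f - resolvent G m g)
      + (l • yosida G l f - m • yosida G m g) := by
    nth_rw 1 [← resolvent_add_yosida (G := G) hl f, ← resolvent_add_yosida (G := G) hm g]
    module
  set a := yosida G l f
  set b := yosida G m g
  have h3 : inner ℝ (a - b) (l • a - m • b)
      = l * ‖a‖ ^ 2 + m * ‖b‖ ^ 2 - (l + m) * inner ℝ a b := by
    simp only [inner_sub_left, inner_sub_right, real_inner_smul_right, real_inner_self_eq_norm_sq]
    rw [real_inner_comm a b]
    ring
  have h4 : inner ℝ a b ≤ ‖a‖ ^ 2 + ‖b‖ ^ 2 := by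
    have := real_inner_le_norm a b
    nlinarith [sq_nonneg (‖a‖ - ‖b‖), sq_nonneg ‖a‖, sq_nonneg ‖b‖]
  rw [e, inner_add_right, h3]
  nlinarith [mul_le_mul_of_nonneg_left h4 (add_pos hl hm).le, mul_nonneg hl.le (sq_nonneg ‖a‖),
    mul_nonneg hm.le (sq_nonneg ‖b‖)]

/-- The point `u + l • ξ` has resolvent `u` for every `l`, so nonexpansiveness gives a bound uniform
in `l ≤ 1`. -/
theorem norm_resolvent_le (hl : 0 < l) (hl1 : l ≤ 1) {u ξ : X} (h : ξ ∈ G u) (f : X) :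
    ‖resolvent G l f‖ ≤ ‖f‖ + (2 * ‖u‖ + ‖ξ‖) := by
  have h1 := hG.norm_resolvent_sub_le hl f (u + l • ξ)
  rw [hG.resolvent_eq hl h] at h1
  have h2 : ‖resolvent G l f‖ ≤ ‖resolvent G l f - u‖ + ‖u‖ := norm_le_norm_sub_add _ _
  have h3 : ‖f - (u + l • ξ)‖ ≤ ‖f‖ + (‖u‖ + ‖l • ξ‖) :=
    (norm_sub_le _ _).trans (by gcongr; exact norm_add_le _ _)
  have h4 : ‖l • ξ‖ ≤ ‖ξ‖ := by
    rw [norm_smul, Real.norm_eq_abs, abs_of_pos hl]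
    exact mul_le_of_le_one_left (norm_nonneg _) hl1
  linarith

/-- Graphs of linear growth have Yosida approximations of uniformly linear growth. -/
theorem exists_yosida_growth {C : ℝ} (hgr : ∀ u ξ, ξ ∈ G u → ‖ξ‖ ≤ C * (‖u‖ + 1)) :
    ∃ C', 0 ≤ C' ∧ ∀ l, 0 < l → l ≤ 1 → ∀ f, ‖yosida G l f‖ ≤ C' * (1 + ‖f‖) := by
  obtain ⟨u, ξ, h, _⟩ := hG.surjective one_pos 0
  refine ⟨|C| * (1 + (2 * ‖u‖ + ‖ξ‖)), by positivity, fun l hl hl1 f => ?_⟩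
  have h1 := hgr _ _ (hG.yosida_mem hl f)
  have h2 := hG.norm_resolvent_le hl hl1 h f
  have h3 : 0 ≤ 2 * ‖u‖ + ‖ξ‖ := by positivity
  set c := 2 * ‖u‖ + ‖ξ‖
  calc _ ≤ |C| * (‖resolvent G l f‖ + 1) := h1.trans (by gcongr; exact le_abs_self C)
    _ ≤ |C| * (‖f‖ + c + 1) := by gcongr
    _ ≤ |C| * ((1 + c) * (1 + ‖f‖)) := by
        gcongr
        nlinarith [mul_nonneg h3 (norm_nonneg f)]
    _ = _ := by ring

end IsMaximalMonotone

/-- Existence of resolvents of subdifferentials, for the functional given by its epigraph `E`. -/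
theorem exists_epigraph_minimizer [CompleteSpace X] {E : Set (X × ℝ)} (hcl : IsClosed E)
    (hcv : Convex ℝ E) (hne : E.Nonempty) {a b : ℝ} (ha : 0 ≤ a)
    (hlow : ∀ p ∈ E, -a * ‖p.1‖ - b ≤ p.2) {l : ℝ} (hl : 0 < l) (f : X) :
    ∃ p ∈ E, ∀ q ∈ E, p.2 + inner ℝ (l⁻¹ • (f - p.1)) (q.1 - p.1) ≤ q.2 := by
  -- Proximal functional on pairs in the epigraph. Working there treats a real valued `Ŝ` and an
  -- extended valued `β̂` at once, closedness playing the role of lower semicontinuity.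
  let Q : X × ℝ → ℝ := fun p => l * p.2 + ‖p.1 - f‖ ^ 2 / 2
  have hQ : ∀ p ∈ E, -(l * a) ^ 2 / 2 - l * a * ‖f‖ - l * b ≤ Q p := by
    intro p hp
    have h1 : ‖p.1‖ ≤ ‖p.1 - f‖ + ‖f‖ := norm_le_norm_sub_add _ _
    have h2 := mul_le_mul_of_nonneg_left (hlow p hp) hl.le
    have h3 := mul_le_mul_of_nonneg_left h1 (mul_nonneg hl.le ha)
    simp only [Q]
    nlinarith [sq_nonneg (‖p.1 - f‖ - l * a)]
  have hbdd : BddBelow (Q '' E) := ⟨_, by rintro _ ⟨p, hp, rfl⟩; exact hQ p hp⟩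
  set I := sInf (Q '' E)
  have hI : ∀ p ∈ E, I ≤ Q p := fun p hp => csInf_le hbdd ⟨p, hp, rfl⟩
  have hseq : ∀ n : ℕ, ∃ p ∈ E, Q p < I + 1 / ((n : ℝ) + 1) := fun n => by
    obtain ⟨_, ⟨p, hp, rfl⟩, h⟩ := exists_lt_of_csInf_lt (hne.image Q)
      (show sInf (Q '' E) < I + 1 / ((n : ℝ) + 1) from lt_add_of_pos_right _ (by positivity))
    exact ⟨p, hp, h⟩
  choose p hpE hpQ using hseq
  -- The midpoint lies in `E` and costs at least the infimum; with the parallelogram law this makes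
  -- the first components of a minimising sequence Cauchy.
  have hpar : ∀ p ∈ E, ∀ q ∈ E, ‖p.1 - q.1‖ ^ 2 ≤ 4 * (Q p - I + (Q q - I)) := by
    intro p hp q hq
    have hmid : ((1 / 2 : ℝ) • p + (1 / 2 : ℝ) • q) ∈ E :=
      hcv hp hq (by norm_num) (by norm_num) (by norm_num)
    have h1 := hI _ hmid
    have h2 := parallelogram_law_with_norm ℝ (p.1 - f) (q.1 - f)
    have h3 : ((1 / 2 : ℝ) • p + (1 / 2 : ℝ) • q).1 - f
        = (1 / 2 : ℝ) • ((p.1 - f) + (q.1 - f)) := by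
      simp only [Prod.fst_add, Prod.smul_fst]
      module
    simp only [Q] at h1 ⊢
    rw [h3, norm_smul] at h1
    rw [sub_sub_sub_cancel_right] at h2
    simp only [Prod.snd_add, Prod.smul_snd, smul_eq_mul, Real.norm_eq_abs] at h1
    rw [abs_of_pos (by norm_num : (0 : ℝ) < 1 / 2)] at h1
    nlinarith
  have hQlim : Tendsto (fun n => Q (p n)) atTop (𝓝 I) := by
    refine tendsto_of_tendsto_of_tendsto_of_le_of_le tendsto_const_nhds ?_
      (fun n => hI _ (hpE n)) (fun n => (hpQ n).le)
    simpa using tendsto_const_nhds.add (tendsto_one_div_add_atTop_nhds_zero_nat (𝕜 := ℝ))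
  have hcau : CauchySeq fun n => (p n).1 := by
    rw [Metric.cauchySeq_iff]
    intro ε hε
    have hev : ∀ᶠ n in atTop, Q (p n) < I + ε ^ 2 / 16 :=
      hQlim.eventually_lt_const (lt_add_of_pos_right _ (by positivity))
    obtain ⟨n₀, hn₀⟩ := eventually_atTop.1 hev
    refine ⟨n₀, fun m hm n hn => ?_⟩
    have := hpar _ (hpE m) _ (hpE n)
    rw [dist_eq_norm]
    refine lt_of_pow_lt_pow_left₀ 2 hε.le (this.trans_lt ?_)
    linarith [hn₀ m hm, hn₀ n hn, sq_nonneg ε, sq_pos_of_pos hε]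
  obtain ⟨u, hu⟩ := cauchySeq_tendsto_of_complete hcau
  -- The second component is a function of `Q` and of the first component, both of which converge.
  have hs : Tendsto (fun n => (p n).2) atTop (𝓝 (l⁻¹ * (I - ‖u - f‖ ^ 2 / 2))) := by
    have h1 : (fun n => (p n).2) = fun n => l⁻¹ * (Q (p n) - ‖(p n).1 - f‖ ^ 2 / 2) := by
      funext n
      simp only [Q]
      field_simp
      ring
    rw [h1]
    exact (hQlim.sub ((((hu.sub_const f).norm).pow 2).div_const 2)).const_mul _
  have hmem := hcl.mem_of_tendsto (hu.prodMk_nhds hs) (Eventually.of_forall fun n => hpE n)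
  set s := l⁻¹ * (I - ‖u - f‖ ^ 2 / 2) with hs_def
  have hQus : l * s + ‖u - f‖ ^ 2 / 2 = I := by
    rw [hs_def]; field_simp; ring
  refine ⟨(u, s), hmem, fun q hq => ?_⟩
  -- First variation: compare the minimiser with its convex combination with `q`, divide by `θ`, and
  -- later let `θ` tend to zero.
  have key : ∀ θ : ℝ, 0 < θ → θ ≤ 1 →
      0 ≤ l * (q.2 - s) + inner ℝ (u - f) (q.1 - u) + θ / 2 * ‖q.1 - u‖ ^ 2 := by
    intro θ h0 h1
    have h2 := hI _ (hcv hmem hq (sub_nonneg.2 h1) h0.le (sub_add_cancel 1 θ))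
    have h3 : ((1 - θ) • (u, s) + θ • q).1 - f = (u - f) + θ • (q.1 - u) := by
      simp only [Prod.fst_add, Prod.smul_fst]
      module
    simp only [Q] at h2
    rw [h3, norm_add_sq_real, real_inner_smul_right, norm_smul, Real.norm_eq_abs, abs_of_pos h0]
      at h2
    simp only [Prod.snd_add, Prod.smul_snd, smul_eq_mul] at h2
    have : 0 ≤ θ * (l * (q.2 - s) + inner ℝ (u - f) (q.1 - u) + θ / 2 * ‖q.1 - u‖ ^ 2) := by
      nlinarith
    exact nonneg_of_mul_nonneg_right this h0
  have hlim : Tendsto (fun θ : ℝ => l * (q.2 - s) + inner ℝ (u - f) (q.1 - u)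
      + θ / 2 * ‖q.1 - u‖ ^ 2) (𝓝[>] 0)
      (𝓝 (l * (q.2 - s) + inner ℝ (u - f) (q.1 - u) + 0 / 2 * ‖q.1 - u‖ ^ 2)) := by
    refine Tendsto.mono_left (Continuous.tendsto ?_ 0) nhdsWithin_le_nhds
    fun_prop
  have h0 := ge_of_tendsto hlim (by
    filter_upwards [Ioc_mem_nhdsGT (zero_lt_one' ℝ)] with θ hθ
    exact key θ hθ.1 hθ.2)
  simp only [zero_div, zero_mul, add_zero] at h0
  rw [real_inner_smul_left]
  have h4 : inner ℝ (f - u) (q.1 - u) = - inner ℝ (u - f) (q.1 - u) := by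
    rw [← inner_neg_left, neg_sub]
  have h5 : l⁻¹ * (l * (q.2 - s) + inner ℝ (u - f) (q.1 - u))
      = q.2 - s - l⁻¹ * inner ℝ (f - u) (q.1 - u) := by
    rw [h4]
    field_simp
    ring
  have h6 := mul_nonneg (inv_pos.2 hl).le h0
  rw [h5] at h6
  simp only
  linarith

end MaximalMonotone

/-! ### Superposition operators on `Lᵖ` spaces of finite measures -/

section Superposition
variable {α E F : Type*} [MeasurableSpace α] {μ : Measure α} [IsFiniteMeasure μ]
  [NormedAddCommGroup E] [NormedAddCommGroup F] {p : ℝ≥0∞} {K : ℝ≥0} {g : E → F}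

/-- After subtracting `g 0` the function vanishes at the origin, and the constant itself is in `Lᵖ`
because the measure is finite. -/
theorem memLp_lipschitz_comp (hg : LipschitzWith K g) {f : α → E} (hf : MemLp f p μ) :
    MemLp (fun x => g (f x)) p μ := by
  have h1 : LipschitzWith K fun e => g e - g 0 := LipschitzWith.of_dist_le_mul fun a b => by
    simpa [dist_eq_norm] using hg.dist_le_mul a b
  have h2 := (h1.comp_memLp (by simp) hf).add (memLp_const (μ := μ) (p := p) (g 0))
  convert h2 using 1
  ext x
  simp

/-- The superposition operator of a Lipschitz function. -/
noncomputable def lipComp (hg : LipschitzWith K g) (f : Lp E p μ) : Lp F p μ :=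
  (memLp_lipschitz_comp hg (Lp.memLp f)).toLp _

theorem coeFn_lipComp (hg : LipschitzWith K g) (f : Lp E p μ) :
    lipComp hg f =ᵐ[μ] fun x => g (f x) := MemLp.coeFn_toLp _

theorem norm_lipComp_sub_le (hg : LipschitzWith K g) (f₁ f₂ : Lp E p μ) :
    ‖lipComp hg f₁ - lipComp hg f₂‖ ≤ K * ‖f₁ - f₂‖ := by
  refine Lp.norm_le_mul_norm_of_ae_le_mul ?_
  filter_upwards [Lp.coeFn_sub f₁ f₂, Lp.coeFn_sub (lipComp hg f₁) (lipComp hg f₂),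
    coeFn_lipComp hg f₁, coeFn_lipComp hg f₂] with x h1 h2 h3 h4
  rw [h1, h2, Pi.sub_apply, Pi.sub_apply, h3, h4, ← dist_eq_norm, ← dist_eq_norm]
  exact hg.dist_le_mul _ _

theorem lipschitzWith_lipComp [Fact (1 ≤ p)] (hg : LipschitzWith K g) :
    LipschitzWith K (lipComp (p := p) (μ := μ) hg) := LipschitzWith.of_dist_le_mul fun f₁ f₂ => by
  simpa [dist_eq_norm] using norm_lipComp_sub_le hg f₁ f₂

end Superposition

/-! ### Functions of time -/

section Time
variable {T : ℝ} {X : Type} [NormedAddCommGroup X]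

theorem memLp_time {f : ℝ → X} (hf : Continuous f) : MemLp f 2 (timeMeasure T) := by
  obtain ⟨C, hC⟩ := (isCompact_Icc (a := (0 : ℝ)) (b := T)).exists_bound_of_continuousOn
    hf.continuousOn
  refine MemLp.of_bound hf.aestronglyMeasurable C ?_
  filter_upwards [ae_restrict_mem measurableSet_Ioo] with t ht
  exact hC t (Ioo_subset_Icc_self ht)

variable (T) in
/-- A continuous function, as an element of `L²(0, T; X)`. -/
noncomputable def ofCont {f : ℝ → X} (hf : Continuous f) : L2Time T X := (memLp_time hf).toLp f

theorem coeFn_ofCont {f : ℝ → X} (hf : Continuous f) : ofCont T hf =ᵐ[timeMeasure T] f :=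
  MemLp.coeFn_toLp _

theorem integral_time (hT : 0 ≤ T) (f : ℝ → ℝ) : ∫ t in Ioo 0 T, f t = ∫ t in (0 : ℝ)..T, f t := by
  rw [intervalIntegral.integral_of_le hT, integral_Ioc_eq_integral_Ioo]

theorem sq_norm_lp [NormedSpace ℝ X] {α : Type*} [MeasurableSpace α] {μ : Measure α}
    (u : Lp X 2 μ) : ‖u‖ ^ 2 = ∫ t, ‖u t‖ ^ 2 ∂μ := by
  have h1 : ‖u‖ = ‖(Lp.memLp u).norm.toLp _‖ := by
    rw [Lp.norm_toLp, eLpNorm_norm, ← Lp.norm_def]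
  rw [h1, ← real_inner_self_eq_norm_sq, L2.inner_def]
  refine integral_congr_ae ?_
  filter_upwards [MemLp.coeFn_toLp (Lp.memLp u).norm] with t ht
  rw [ht]
  simp

theorem sq_norm_ofCont [NormedSpace ℝ X] (hT : 0 ≤ T) {f : ℝ → X} (hf : Continuous f) :
    ‖ofCont T hf‖ ^ 2 = ∫ t in (0 : ℝ)..T, ‖f t‖ ^ 2 := by
  rw [sq_norm_lp, ← integral_time hT]
  refine integral_congr_ae ?_
  filter_upwards [coeFn_ofCont (T := T) hf] with t ht
  rw [ht]

theorem ofCont_sub {f g : ℝ → X} (hf : Continuous f) (hg : Continuous g) :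
    ofCont T hf - ofCont T hg = ofCont T (f := fun t => f t - g t) (hf.sub hg) :=
  (MemLp.toLp_sub _ _).symm

/-- Density of bounded continuous functions. Continuous forcing terms make the regularised problems
classical differential equations. -/
theorem exists_ofCont_tendsto [NormedSpace ℝ X] (g : L2Time T X) :
    ∃ G : ℕ → ℝ → X, ∃ hG : ∀ n, Continuous (G n),
      Tendsto (fun n => ofCont T (hG n)) atTop (𝓝 g) := by
  have h : ∀ n : ℕ, ∃ f : BoundedContinuousFunction ℝ X,
      eLpNorm (fun x => g x - f x) 2 (timeMeasure T) ≤ ENNReal.ofReal (1 / ((n : ℝ) + 1)) := by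
    intro n
    obtain ⟨f, hf, _⟩ := (Lp.memLp g).exists_boundedContinuous_eLpNorm_sub_le (by simp)
      (ε := ENNReal.ofReal (1 / ((n : ℝ) + 1))) (by
        simp only [ne_eq, ENNReal.ofReal_eq_zero, not_le]; positivity)
    exact ⟨f, hf⟩
  choose f hf using h
  refine ⟨fun n => f n, fun n => (f n).continuous, ?_⟩
  rw [tendsto_iff_norm_sub_tendsto_zero]
  refine squeeze_zero (fun _ => norm_nonneg _) (fun n => ?_)
    (tendsto_one_div_add_atTop_nhds_zero_nat (𝕜 := ℝ))
  rw [norm_sub_rev, Lp.norm_def]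
  refine ENNReal.toReal_le_of_le_ofReal (by positivity) (le_trans (le_of_eq ?_) (hf n))
  refine eLpNorm_congr_ae ?_
  filter_upwards [Lp.coeFn_sub g (ofCont T (f n).continuous), coeFn_ofCont (T := T) (f n).continuous]
    with t h1 h2
  rw [h1, Pi.sub_apply, h2]

end Time

section TimeHilbert
variable {T : ℝ} {X : Type} [NormedAddCommGroup X] [InnerProductSpace ℝ X]

/-- Maximal monotone graphs are closed for the strong-weak convergence in `L²(0, T; X)`. -/
theorem IsMaximalMonotone.mem_of_tendsto_weak {G : X → Set X} (hG : IsMaximalMonotone G)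
    {U : Ultrafilter ℕ} {u v : ℕ → L2Time T X} {u' v' : L2Time T X} {C : ℝ}
    (h : ∀ n, ∀ᵐ t ∂timeMeasure T, v n t ∈ G (u n t)) (hC : ∀ n, ‖v n‖ ≤ C)
    (hu : Tendsto u U (𝓝 u'))
    (hv : ∀ z, Tendsto (fun n => inner ℝ (v n) z) U (𝓝 (inner ℝ v' z))) :
    ∀ᵐ t ∂timeMeasure T, v' t ∈ G (u' t) := by
  -- Minty's argument: `u' + v' - w` belongs to `G w` almost everywhere. Pairing with `(u n, v n)`
  -- and passing to the limit gives `-‖u' - w‖ ^ 2 ≥ 0`, so `w = u'` and hence `v' ∈ G u'`.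
  let w : L2Time T X := lipComp (hG.lipschitzWith_resolvent one_pos) (u' + v')
  have hpos : ∀ n, 0 ≤ inner ℝ (v n - (u' + v' - w)) (u n - w) := fun n => by
    rw [L2.inner_def]
    refine integral_nonneg_of_ae ?_
    filter_upwards [h n, Lp.coeFn_sub (v n) (u' + v' - w), Lp.coeFn_sub (u' + v') w,
      Lp.coeFn_sub (u n) w, coeFn_lipComp (hG.lipschitzWith_resolvent one_pos) (u' + v')]
      with t h1 h2 h3 h4 h5
    rw [h2, Pi.sub_apply, h3, Pi.sub_apply, h4, Pi.sub_apply]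
    refine hG.monotone h1 ?_
    have := hG.yosida_mem one_pos ((u' + v' : L2Time T X) t)
    rw [yosida, inv_one, one_smul] at this
    rwa [← h5] at this
  have hC' : ∀ n, ‖v n - (u' + v' - w)‖ ≤ C + ‖u' + v' - w‖ := fun n =>
    (norm_sub_le _ _).trans (by gcongr; exact hC n)
  have hlim := tendsto_inner_of_weak_of_strong (y := v' - (u' + v' - w)) hC' (fun z => by
    simpa only [inner_sub_left] using (hv z).sub_const _) (hu.sub_const w)
  have h0 := ge_of_tendsto hlim (Eventually.of_forall hpos)
  have e : v' - (u' + v' - w) = -(u' - w) := by abel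
  rw [e, inner_neg_left, real_inner_self_eq_norm_sq] at h0
  have h1 : ‖u' - w‖ ^ 2 = 0 := le_antisymm (by linarith) (by positivity)
  rw [sq_eq_zero_iff, norm_sub_eq_zero_iff] at h1
  filter_upwards [coeFn_lipComp (hG.lipschitzWith_resolvent one_pos) (u' + v'),
    Lp.coeFn_add u' v'] with t h2 h3
  rw [hG.mem_iff, ← Pi.add_apply, ← h3, ← h2]
  change w t = u' t
  rw [← h1]

theorem continuous_smul_vec {η : ℝ → ℝ} (hη : Continuous η) (x : X) :
    Continuous fun t => η t • x := hη.smul continuous_const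

theorem _root_.CahnHilliard.IsTestFunction.continuous_deriv {ψ : ℝ → ℝ} {s : Set ℝ} (hψ : IsTestFunction s ψ) :
    Continuous (deriv ψ) := hψ.contDiff.continuous_deriv (by simp)

/-- The weak time derivative, tested with functions of the form `ψ ⊗ h`. -/
theorem hasWeakTimeDeriv_of_inner [CompleteSpace X] {u u' : L2Time T X}
    (h : ∀ ψ : ℝ → ℝ, ∀ hψ : IsTestFunction (Ioo 0 T) ψ, ∀ x : X,
      inner ℝ u (ofCont T (continuous_smul_vec hψ.continuous_deriv x))
        = -inner ℝ u' (ofCont T (continuous_smul_vec hψ.contDiff.continuous x))) :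
    HasWeakTimeDeriv u u' := by
  intro ψ hψ
  refine ext_inner_right ℝ fun x => ?_
  have hi : ∀ (f : ℝ → ℝ) (hf : Continuous f) (w : L2Time T X),
      inner ℝ (∫ t in Ioo 0 T, f t • w t) x
        = inner ℝ w (ofCont T (continuous_smul_vec hf x)) := by
    intro f hf w
    have hint : Integrable (fun t => f t • w t) (timeMeasure T) :=
      memLp_one_iff_integrable.1 ((Lp.memLp w).smul (memLp_time hf))
    rw [real_inner_comm, ← integral_inner hint, L2.inner_def]
    refine integral_congr_ae ?_
    filter_upwards [coeFn_ofCont (T := T) (continuous_smul_vec hf x)] with t ht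
    rw [ht, real_inner_smul_right, real_inner_smul_right, real_inner_comm]
  rw [hi _ hψ.continuous_deriv, h ψ hψ x, ← hi _ hψ.contDiff.continuous, inner_neg_left]

theorem inner_ofCont_deriv (hT : 0 < T) {f f' : ℝ → X} (hf' : Continuous f')
    (hd : ∀ t, HasDerivAt f (f' t) t) (hf : Continuous f) {ψ : ℝ → ℝ}
    (hψ : IsTestFunction (Ioo 0 T) ψ) (x : X) :
    inner ℝ (ofCont T hf) (ofCont T (continuous_smul_vec hψ.continuous_deriv x))
      = -inner ℝ (ofCont T hf') (ofCont T (continuous_smul_vec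
        hψ.contDiff.continuous x)) := by
  have hi : ∀ (g : ℝ → X) (hg : Continuous g) (η : ℝ → ℝ) (hη : Continuous η),
      inner ℝ (ofCont T hg) (ofCont T (continuous_smul_vec hη x))
        = ∫ t in (0 : ℝ)..T, inner ℝ (g t) x * η t := by
    intro g hg η hη
    rw [L2.inner_def, ← integral_time hT.le]
    refine integral_congr_ae ?_
    filter_upwards [coeFn_ofCont (T := T) hg,
      coeFn_ofCont (T := T) (continuous_smul_vec hη x)] with t h1 h2
    rw [h1, h2, real_inner_smul_right, mul_comm]
  rw [hi _ _ _ hψ.continuous_deriv, hi _ _ _ hψ.contDiff.continuous]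
  have h0 : ∀ t, t ∉ Ioo 0 T → ψ t = 0 := fun t ht =>
    image_eq_zero_of_notMem_tsupport fun h => ht (hψ.tsupport_subset h)
  rw [intervalIntegral.integral_mul_deriv_eq_deriv_mul
    (u := fun t => inner ℝ (f t) x) (u' := fun t => inner ℝ (f' t) x) (v := ψ) (v' := deriv ψ)
    (fun t _ => by
      simpa using (hd t).inner ℝ (hasDerivAt_const t x))
    (fun t _ => (hψ.contDiff.differentiable (by simp) t).hasDerivAt)
    (Continuous.intervalIntegrable (by fun_prop) _ _)
    (hψ.continuous_deriv.intervalIntegrable _ _), h0 T (by simp), h0 0 (by simp)]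
  simp

end TimeHilbert

/-! ### The abstract evolution problem -/

section Evolution
variable {H : Type} [NormedAddCommGroup H] [InnerProductSpace ℝ H]

/-- The assumptions on `(τ + N) φ' + P (A φ + B φ + p φ + S (φ - φ*) - g) ∋ 0`, `φ(0) = φ₀`. -/
structure IsEvolutionSystem (tau : ℝ) (A B S : H → Set H) (N P : H →L[ℝ] H) (p : H → H)
    (φ₀ : H) : Prop where
  tau_pos : 0 < tau
  maxA : IsMaximalMonotone A
  maxB : IsMaximalMonotone B
  maxS : IsMaximalMonotone S
  growthS : ∃ C : ℝ, ∀ u ξ, ξ ∈ S u → ‖ξ‖ ≤ C * (‖u‖ + 1)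
  N_symm : ∀ u v, inner ℝ (N u) v = inner ℝ u (N v)
  N_nonneg : ∀ u, 0 ≤ inner ℝ (N u) u
  P_symm : ∀ u v, inner ℝ (P u) v = inner ℝ u (P v)
  P_N : ∀ u, P (N u) = N u
  P_P : ∀ u, P (P u) = P u
  lipschitz : ∃ L : ℝ≥0, LipschitzWith L p
  -- Here `e` stands for the regularised energy; its value at the initial datum has to be bounded
  -- independently of `l`.
  energy : ∃ C : ℝ, ∀ l, 0 < l → ∃ e : H → ℝ, (∀ u, 0 ≤ e u) ∧ e φ₀ ≤ C ∧
    ∀ u v, e u + inner ℝ (yosida A l u + yosida B l u) (v - u) ≤ e v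
  cross : ∀ l, 0 < l → ∀ u, 0 ≤ inner ℝ (yosida A l u) (yosida B l u)
  -- The evolution equation only sees the image under `P`. The condition `P (u - φ₀) = u - φ₀` is
  -- what the evolution preserves, in the Neumann case the mean value.
  kernel_bound : ∃ K : ℝ, 0 ≤ K ∧ ∀ l, 0 < l → l ≤ 1 → ∀ u, P (u - φ₀) = u - φ₀ →
    ‖yosida A l u + yosida B l u - P (yosida A l u + yosida B l u)‖
      ≤ K * (1 + ‖u‖) * (1 + ‖P (yosida A l u + yosida B l u)‖)

/-- Solutions `u` (with derivative `u'`) of the regularised problem on `[0, T]`, for continuous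
forcing terms `g` and `f`. -/
structure IsRegularSolution (tau : ℝ) (A B S : H → Set H) (N P : H →L[ℝ] H) (p : H → H) (φ₀ : H)
    (T l : ℝ) (g f u u' : ℝ → H) : Prop where
  cont : Continuous u'
  deriv : ∀ t, HasDerivAt u (u' t) t
  init : u 0 = φ₀
  eqn : ∀ t ∈ Icc 0 T, tau • u' t + N (u' t) + P (yosida A l (u t) + yosida B l (u t) + (p (u t)
    + yosida S l (u t - f t) - g t)) = 0

theorem IsRegularSolution.continuous {tau : ℝ} {A B S : H → Set H} {N P : H →L[ℝ] H} {p : H → H}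
    {φ₀ : H} {T l : ℝ} {g f u u' : ℝ → H}
    (h : IsRegularSolution tau A B S N P p φ₀ T l g f u u') : Continuous u :=
  continuous_iff_continuousAt.2 fun t => (h.deriv t).continuousAt

/-- Convex functions with a Lipschitz selection of their subdifferential are differentiable. -/
theorem hasFDerivAt_of_subgradient {e : H → ℝ} {Y : H → H} {K : ℝ≥0} (hY : LipschitzWith K Y)
    (h : ∀ u v, e u + inner ℝ (Y u) (v - u) ≤ e v) (u : H) :
    HasFDerivAt e (innerSL ℝ (Y u)) u := by
  rw [hasFDerivAt_iff_isLittleO]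
  -- The remainder is nonnegative by the subgradient inequality at `u`, and at most `⟪Y v - Y u, v -
  -- u⟫` by the one at `v`.
  have h1 : (fun v => e v - e u - innerSL ℝ (Y u) (v - u)) =O[𝓝 u] fun v => ‖v - u‖ ^ 2 := by
    refine Asymptotics.IsBigO.of_bound K (Eventually.of_forall fun v => ?_)
    have e1 := h u v
    have e2 := h v u
    have e3 : inner ℝ (Y v) (u - v) = -inner ℝ (Y v) (v - u) := by
      rw [← inner_neg_right, neg_sub]
    have e4 : inner ℝ (Y v - Y u) (v - u) ≤ K * ‖v - u‖ ^ 2 := by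
      refine (real_inner_le_norm _ _).trans ?_
      have := hY.dist_le_mul v u
      rw [dist_eq_norm, dist_eq_norm] at this
      nlinarith [norm_nonneg (v - u)]
    rw [inner_sub_left] at e4
    simp only [innerSL_apply_apply, Real.norm_eq_abs]
    rw [abs_of_nonneg (by linarith), abs_of_nonneg (by positivity)]
    linarith
  refine h1.trans_isLittleO ?_
  have h2 : (fun v => ‖v - u‖ ^ 2) =o[𝓝 u] fun v => ‖v - u‖ := by
    have h3 : Tendsto (fun v => ‖v - u‖) (𝓝 u) (𝓝 0) := by
      have : Continuous fun v => ‖v - u‖ := by fun_prop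
      simpa using this.tendsto u
    exact (Asymptotics.isLittleO_pow_id one_lt_two).comp_tendsto h3
  exact h2.of_norm_right

variable {tau : ℝ} {A B S : H → Set H} {N P : H →L[ℝ] H} {p : H → H} {φ₀ : H} {T : ℝ}

namespace IsEvolutionSystem
variable (h : IsEvolutionSystem tau A B S N P p φ₀)
include h

theorem inner_P_of_fixed {v : H} (hv : P v = v) (u : H) : inner ℝ (P u) v = inner ℝ u v := by
  rw [h.P_symm, hv]

/-- Since `τ ≠ 0`, `v` is a combination of `N v` and `P w`, both of which are fixed by `P`. -/
theorem fixed_of_eqn {v w : H} (hv : tau • v + N v + P w = 0) : P v = v := by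
  have h1 : v = tau⁻¹ • (-(N v) - P w) := by
    rw [eq_inv_smul_iff₀ h.tau_pos.ne', ← sub_eq_zero, ← hv]
    abel
  rw [h1, map_smul, map_sub, map_neg, h.P_N, h.P_P]

/-- Lax–Milgram for `τ + N`, coercive with constant `τ` because `N` is nonnegative. The viscosity is
what turns the regularised inclusion into an ordinary differential equation. -/
theorem exists_inverse [CompleteSpace H] :
    ∃ R : H →L[ℝ] H, ∀ u, tau • R u + N (R u) = u := by
  let M : H →L[ℝ] H := tau • ContinuousLinearMap.id ℝ H + N
  let b : H →L[ℝ] H →L[ℝ] ℝ := LinearMap.mkContinuous₂ ((innerₗ H).comp (M : H →ₗ[ℝ] H)) ‖M‖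
    fun u v => by
      simp only [LinearMap.coe_comp, Function.comp_apply, innerₗ_apply_apply]
      exact (norm_inner_le_norm _ _).trans (by gcongr; exact M.le_opNorm u)
  have hb : ∀ u v, b u v = inner ℝ (M u) v := fun u v => rfl
  have hc : IsCoercive b := by
    refine ⟨tau, h.tau_pos, fun u => ?_⟩
    rw [hb]
    simp only [M, add_apply, smul_apply,
      ContinuousLinearMap.id_apply, inner_add_left, real_inner_smul_left,
      real_inner_self_eq_norm_mul_norm]
    linarith [h.N_nonneg u]
  let E := hc.continuousLinearEquivOfBilin
  have hE : ∀ v, E v = M v := fun v =>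
    (hc.unique_continuousLinearEquivOfBilin fun w => (hb v w).symm).symm
  refine ⟨E.symm, fun u => ?_⟩
  have := hE (E.symm u)
  rw [E.apply_symm_apply] at this
  exact this.symm

theorem exists_regularSolution [CompleteSpace H] (hT : 0 < T) {l : ℝ} (hl : 0 < l)
    {g f : ℝ → H} (hg : Continuous g) (hf : Continuous f) :
    ∃ u u' : ℝ → H, IsRegularSolution tau A B S N P p φ₀ T l g f u u' := by
  obtain ⟨R, hR⟩ := h.exists_inverse
  obtain ⟨L, hL⟩ := h.lipschitz
  have cA := (h.maxA.lipschitzWith_yosida hl).continuous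
  have cB := (h.maxB.lipschitzWith_yosida hl).continuous
  have cS := (h.maxS.lipschitzWith_yosida hl).continuous
  have cp := hL.continuous
  let F : ℝ → H → H := fun t u =>
    -R (P (yosida A l u + yosida B l u + (p u + yosida S l (u - f t) - g t)))
  have hF : Continuous (Function.uncurry F) := by
    simp only [F, Function.uncurry_def]
    fun_prop
  obtain ⟨u, u', h1, h2, h3, h4⟩ := exists_global_ode_solution hF
    (K := ‖R‖ * (‖P‖ * (l⁻¹ + l⁻¹ + (L + l⁻¹)))) (by positivity) (fun t u v => by
      simp only [F]
      rw [neg_sub_neg, ← map_sub, ← map_sub, norm_sub_rev u v]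
      refine (R.le_opNorm _).trans ?_
      rw [mul_assoc, mul_assoc]
      gcongr
      refine (P.le_opNorm _).trans ?_
      gcongr
      have e : yosida A l v + yosida B l v + (p v + yosida S l (v - f t) - g t)
          - (yosida A l u + yosida B l u + (p u + yosida S l (u - f t) - g t))
          = (yosida A l v - yosida A l u) + (yosida B l v - yosida B l u)
            + ((p v - p u) + (yosida S l (v - f t) - yosida S l (u - f t))) := by abel
      rw [e]
      have e1 := h.maxA.norm_yosida_sub_le hl v u
      have e2 := h.maxB.norm_yosida_sub_le hl v u
      have e3 := h.maxS.norm_yosida_sub_le hl (v - f t) (u - f t)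
      rw [sub_sub_sub_cancel_right] at e3
      have e4 : ‖p v - p u‖ ≤ L * ‖v - u‖ := by
        simpa [dist_eq_norm] using hL.dist_le_mul v u
      refine (norm_add_le _ _).trans ?_
      have := norm_add_le (yosida A l v - yosida A l u) (yosida B l v - yosida B l u)
      have := norm_add_le (p v - p u) (yosida S l (v - f t) - yosida S l (u - f t))
      linarith) hT φ₀
  refine ⟨u, u', h1, h2, h3, fun t ht => ?_⟩
  have h5 := hR (u' t)
  have h6 : tau • u' t + N (u' t) = -(P (yosida A l (u t) + yosida B l (u t) + (p (u t)
      + yosida S l (u t - f t) - g t))) := by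
    rw [h4 t ht]
    simp only [F, smul_neg, map_neg]
    rw [← neg_add, hR]
  rw [h6, neg_add_cancel]

omit [InnerProductSpace ℝ H] h in
theorem integral_const_mul_le {g f u : ℝ → H} (hg : Continuous g) (hf : Continuous f)
    (hu : Continuous u) {c a b d T : ℝ} (hc : 0 ≤ c)
    (ha : (∫ t in (0 : ℝ)..T, ‖u t‖ ^ 2) ≤ a) (hb : (∫ t in (0 : ℝ)..T, ‖f t‖ ^ 2) ≤ b)
    (hd : (∫ t in (0 : ℝ)..T, ‖g t‖ ^ 2) ≤ d) :
    (∫ t in (0 : ℝ)..T, c * (1 + ‖u t‖ ^ 2 + ‖f t‖ ^ 2 + ‖g t‖ ^ 2)) ≤ c * (T + a + b + d) := by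
  have e1 : IntervalIntegrable (fun _ : ℝ => (1 : ℝ)) volume 0 T :=
    continuous_const.intervalIntegrable _ _
  have e2 : ∀ w : ℝ → H, Continuous w → IntervalIntegrable (fun t => ‖w t‖ ^ 2) volume 0 T :=
    fun w hw => (hw.norm.pow 2).intervalIntegrable _ _
  rw [intervalIntegral.integral_const_mul,
    intervalIntegral.integral_add ((e1.add (e2 u hu)).add (e2 f hf)) (e2 g hg),
    intervalIntegral.integral_add (e1.add (e2 u hu)) (e2 f hf),
    intervalIntegral.integral_add e1 (e2 u hu), intervalIntegral.integral_const, sub_zero,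
    smul_eq_mul, mul_one]
  gcongr

/-! ### A priori estimates uniform in the regularisation parameter -/

theorem exists_lower_order_bound : ∃ c : ℝ, 0 ≤ c ∧ ∀ l, 0 < l → l ≤ 1 → ∀ x y z : H,
    ‖p x + yosida S l (x - y) - z‖ ^ 2 ≤ c * (1 + ‖x‖ ^ 2 + ‖y‖ ^ 2 + ‖z‖ ^ 2) ∧
    ‖yosida S l (x - y)‖ ^ 2 ≤ c * (1 + ‖x‖ ^ 2 + ‖y‖ ^ 2 + ‖z‖ ^ 2) := by
  obtain ⟨L, hL⟩ := h.lipschitz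
  obtain ⟨Cs, hCs⟩ := h.growthS
  obtain ⟨c₁, hc₁, hS⟩ := h.maxS.exists_yosida_growth hCs
  set c : ℝ := 1 + L + ‖p 0‖ + c₁ with hc
  have hc0 : 0 ≤ c := by positivity
  have hsq : ∀ x y z : H, ∀ w : H, ‖w‖ ≤ c * (1 + ‖x‖ + ‖y‖ + ‖z‖) →
      ‖w‖ ^ 2 ≤ 4 * c ^ 2 * (1 + ‖x‖ ^ 2 + ‖y‖ ^ 2 + ‖z‖ ^ 2) := by
    intro x y z w hw
    refine (pow_le_pow_left₀ (norm_nonneg _) hw 2).trans ?_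
    have e2 : (1 + ‖x‖ + ‖y‖ + ‖z‖) ^ 2 ≤ 4 * (1 + ‖x‖ ^ 2 + ‖y‖ ^ 2 + ‖z‖ ^ 2) := by
      nlinarith [sq_nonneg (1 - ‖x‖), sq_nonneg (1 - ‖y‖), sq_nonneg (1 - ‖z‖),
        sq_nonneg (‖x‖ - ‖y‖), sq_nonneg (‖x‖ - ‖z‖), sq_nonneg (‖y‖ - ‖z‖)]
    rw [mul_pow]
    linarith [mul_le_mul_of_nonneg_left e2 (sq_nonneg c)]
  refine ⟨4 * c ^ 2, by positivity, fun l hl hl1 x y z => ?_⟩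
  have e1 : ‖p x‖ ≤ ‖p 0‖ + L * ‖x‖ := by
    have := hL.dist_le_mul x 0
    rw [dist_eq_norm, dist_eq_norm, sub_zero] at this
    linarith [norm_le_norm_sub_add (p x) (p 0)]
  have e2 := hS l hl hl1 (x - y)
  have e4 : ‖p x + yosida S l (x - y) - z‖ ≤ ‖p x‖ + ‖yosida S l (x - y)‖ + ‖z‖ :=
    (norm_sub_le _ _).trans (by gcongr; exact norm_add_le _ _)
  have e5 := mul_le_mul_of_nonneg_left (norm_sub_le x y) hc₁
  have a1 := norm_nonneg x
  have a2 := norm_nonneg y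
  have a3 := norm_nonneg z
  have a4 := norm_nonneg (p 0)
  have a5 := L.coe_nonneg
  have b1 := mul_nonneg a4 a1
  have b2 := mul_nonneg a4 a2
  have b3 := mul_nonneg a4 a3
  have b4 := mul_nonneg a5 a2
  have b5 := mul_nonneg a5 a3
  have b6 := mul_nonneg hc₁ a3
  have b7 := mul_nonneg a5 a1
  have b8 := mul_nonneg hc₁ a1
  have b9 := mul_nonneg hc₁ a2
  have e6 : c * (1 + ‖x‖ + ‖y‖ + ‖z‖) = (1 + ‖x‖ + ‖y‖ + ‖z‖)
    + (L + L * ‖x‖ + L * ‖y‖ + L * ‖z‖)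
    + (‖p 0‖ + ‖p 0‖ * ‖x‖ + ‖p 0‖ * ‖y‖ + ‖p 0‖ * ‖z‖)
    + (c₁ + c₁ * ‖x‖ + c₁ * ‖y‖ + c₁ * ‖z‖) := by rw [hc]; ring
  rw [mul_add, mul_one] at e2
  rw [mul_add] at e5
  refine ⟨hsq x y z _ ?_, hsq x y z _ ?_⟩ <;> linarith

/-- Test with `u'`. As `P u' = u'` the projection disappears, the approximations of `A` and `B` give
the derivative of `e (u t)`, `N` contributes a nonnegative term, and `τ ‖u'‖ ^ 2` absorbs the lower
order terms. The summand `‖u‖ ^ 2` is added to the energy because `e` need not be coercive. -/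
theorem exists_energy_bound (hT : 0 < T) (b : ℝ) : ∃ E : ℝ, 0 ≤ E ∧ ∀ l, 0 < l → l ≤ 1 →
    ∀ g f u u' : ℝ → H, Continuous g → Continuous f →
      (∫ t in (0 : ℝ)..T, ‖g t‖ ^ 2) ≤ b → (∫ t in (0 : ℝ)..T, ‖f t‖ ^ 2) ≤ b →
      IsRegularSolution tau A B S N P p φ₀ T l g f u u' →
      (∀ t ∈ Icc 0 T, ‖u t‖ ^ 2 ≤ E) ∧ (∫ t in (0 : ℝ)..T, ‖u' t‖ ^ 2) ≤ E := by
  obtain ⟨c, hc0, hr2⟩ := h.exists_lower_order_bound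
  obtain ⟨Ce, he⟩ := h.energy
  have htau := h.tau_pos
  -- `c / tau` pays for the lower order terms and `4 / tau` for the derivative of `‖u‖ ^ 2`; each
  -- takes a quarter of `τ ‖u'‖ ^ 2`, so that half of it survives as dissipation.
  set C₁ : ℝ := (c + 4) / tau with hC₁
  set b' := |b|
  set E : ℝ := Real.exp (C₁ * T) * (|Ce| + ‖φ₀‖ ^ 2 + c / tau * (T + 0 + b' + b')) with hE
  have hE0 : 0 ≤ E := by positivity
  refine ⟨E + E / (tau / 2), by positivity, ?_⟩
  intro l hl hl1 g f u u' hg hf hgb hfb hu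
  have hgb' : (∫ t in (0 : ℝ)..T, ‖g t‖ ^ 2) ≤ b' := hgb.trans (le_abs_self b)
  have hfb' : (∫ t in (0 : ℝ)..T, ‖f t‖ ^ 2) ≤ b' := hfb.trans (le_abs_self b)
  obtain ⟨e, he0, heφ, hsub⟩ := he l hl
  have cu := hu.continuous
  have cu' := hu.cont
  have hde := hasFDerivAt_of_subgradient
    ((h.maxA.lipschitzWith_yosida hl).add (h.maxB.lipschitzWith_yosida hl)) hsub
  let y : ℝ → ℝ := fun t => e (u t) + ‖u t‖ ^ 2
  have hy : ∀ t, HasDerivAt y (inner ℝ (yosida A l (u t) + yosida B l (u t)) (u' t)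
      + 2 * inner ℝ (u t) (u' t)) t := by
    intro t
    have e1 := (hde (u t)).comp_hasDerivAt t (hu.deriv t)
    exact e1.add (hu.deriv t).norm_sq
  -- The vanishing summand `‖(0 : H)‖ ^ 2` gives `k` the shape of the general integral bound; the
  -- actual `‖u t‖ ^ 2` is part of `C₁ * y t`.
  let k : ℝ → ℝ := fun t => c / tau * (1 + ‖(0 : H)‖ ^ 2 + ‖f t‖ ^ 2 + ‖g t‖ ^ 2)
  have hkc : Continuous k := by fun_prop
  have hk0 : ∀ t, 0 ≤ k t := fun t => by positivity
  have hineq : ∀ t ∈ Icc 0 T, inner ℝ (yosida A l (u t) + yosida B l (u t)) (u' t)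
      + 2 * inner ℝ (u t) (u' t) + tau / 2 * ‖u' t‖ ^ 2 ≤ C₁ * y t + k t := by
    intro t ht
    have e1 := hu.eqn t ht
    have e7 := (hr2 l hl hl1 (u t) (f t) (g t)).1
    set r := p (u t) + yosida S l (u t - f t) - g t with hrdef
    have e2 := h.fixed_of_eqn e1
    have e3 : inner ℝ (tau • u' t + N (u' t) + P (yosida A l (u t) + yosida B l (u t) + r))
      (u' t) = 0 := by rw [e1, inner_zero_left]
    rw [inner_add_left, h.inner_P_of_fixed e2, inner_add_left, real_inner_smul_left,
      inner_add_left _ r, real_inner_self_eq_norm_sq] at e3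
    have e4 := h.N_nonneg (u' t)
    have e5 : -inner ℝ r (u' t) ≤ ‖r‖ * ‖u' t‖ := by
      rw [← inner_neg_left, ← norm_neg r]; exact real_inner_le_norm _ _
    have e6 := real_inner_le_norm (u t) (u' t)
    have e8 : ‖r‖ * ‖u' t‖ ≤ tau / 4 * ‖u' t‖ ^ 2 + ‖r‖ ^ 2 / tau := by
      have : 0 ≤ (tau / 2 * ‖u' t‖ - ‖r‖) ^ 2 / tau := by positivity
      have e : (tau / 2 * ‖u' t‖ - ‖r‖) ^ 2 / tau
        = tau / 4 * ‖u' t‖ ^ 2 + ‖r‖ ^ 2 / tau - ‖r‖ * ‖u' t‖ := by field_simp; ring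
      linarith
    have e9 : 2 * (‖u t‖ * ‖u' t‖) ≤ tau / 4 * ‖u' t‖ ^ 2 + 4 * ‖u t‖ ^ 2 / tau := by
      have : 0 ≤ (tau / 2 * ‖u' t‖ - 2 * ‖u t‖) ^ 2 / tau := by positivity
      have e : (tau / 2 * ‖u' t‖ - 2 * ‖u t‖) ^ 2 / tau
        = tau / 4 * ‖u' t‖ ^ 2 + 4 * ‖u t‖ ^ 2 / tau - 2 * (‖u t‖ * ‖u' t‖) := by
        field_simp; ring
      linarith
    have e10 : ‖r‖ ^ 2 / tau
        ≤ c * (1 + ‖u t‖ ^ 2 + ‖f t‖ ^ 2 + ‖g t‖ ^ 2) / tau := by gcongr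
    have e11 : C₁ * y t + k t
        = C₁ * e (u t) + (c * (1 + ‖u t‖ ^ 2 + ‖f t‖ ^ 2 + ‖g t‖ ^ 2) / tau
          + 4 * ‖u t‖ ^ 2 / tau) := by
      simp only [y, hC₁, k, norm_zero]; field_simp; ring
    have e12 : 0 ≤ C₁ * e (u t) := mul_nonneg (by positivity) (he0 _)
    rw [e11]
    linarith
  have hgron := fun t (ht : t ∈ Icc 0 T) => gronwall_dissipation (C := C₁) (T := T)
    (by positivity) hy (fun t _ => by have := he0 (u t); positivity)
    (p := fun t => tau / 2 * ‖u' t‖ ^ 2) (by fun_prop) hkc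
    (fun t _ => by positivity) (fun t _ => hk0 t) hineq ht
  have hk : (∫ t in (0 : ℝ)..T, k t) ≤ c / tau * (T + 0 + b' + b') :=
    integral_const_mul_le hg hf (continuous_const (y := (0 : H))) (by positivity) (by simp)
      hfb' hgb'
  have hy0 : y 0 ≤ |Ce| + ‖φ₀‖ ^ 2 := by
    simp only [y, hu.init]
    linarith [le_abs_self Ce]
  have hEb : ∀ t ∈ Icc 0 T, ‖u t‖ ^ 2 + ∫ s in (0 : ℝ)..t, tau / 2 * ‖u' s‖ ^ 2 ≤ E := by
    intro t ht
    have e1 := hgron t ht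
    have e2 : (∫ s in (0 : ℝ)..t, k s) ≤ ∫ s in (0 : ℝ)..T, k s :=
      intervalIntegral.integral_mono_interval le_rfl ht.1 ht.2
        (Eventually.of_forall fun s => hk0 s) (hkc.intervalIntegrable _ _)
    have e3 : ‖u t‖ ^ 2 ≤ y t := by simp only [y]; linarith [he0 (u t)]
    rw [← mul_add] at e1
    have e4 : y t + ∫ s in (0 : ℝ)..t, tau / 2 * ‖u' s‖ ^ 2
        ≤ Real.exp (C₁ * T) * (y 0 + ∫ s in (0 : ℝ)..t, k s) := by
      have := mul_le_mul_of_nonneg_left e1 (Real.exp_pos (C₁ * T)).le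
      rwa [← mul_assoc, ← Real.exp_add, add_neg_cancel, Real.exp_zero, one_mul] at this
    calc _ ≤ _ := by gcongr
      _ ≤ _ := e4
      _ ≤ _ := by rw [hE]; gcongr; exact e2.trans hk
  have hEq : 0 ≤ E / (tau / 2) := by positivity
  refine ⟨fun t ht => ?_, ?_⟩
  · have : 0 ≤ ∫ s in (0 : ℝ)..t, tau / 2 * ‖u' s‖ ^ 2 :=
      intervalIntegral.integral_nonneg ht.1 fun s _ => by positivity
    linarith [hEb t ht]
  · have := hEb T ⟨hT.le, le_rfl⟩
    rw [intervalIntegral.integral_const_mul] at this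
    have : (∫ t in (0 : ℝ)..T, ‖u' t‖ ^ 2) ≤ E / (tau / 2) := by
      rw [le_div_iff₀ (by positivity)]
      linarith [sq_nonneg ‖u T‖]
    linarith

/-- The derivative of `P (u - φ₀) - (u - φ₀)` vanishes because `P u' = u'`. For the Neumann
condition this is conservation of the mean value. -/
theorem fixed_sub_init {l : ℝ} {g f u u' : ℝ → H}
    (hu : IsRegularSolution tau A B S N P p φ₀ T l g f u u') {t : ℝ} (ht : t ∈ Icc 0 T) :
    P (u t - φ₀) = u t - φ₀ := by
  have hd : ∀ s, HasDerivAt (fun s => P (u s - φ₀) - (u s - φ₀)) (P (u' s) - u' s) s := fun s =>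
    (P.hasFDerivAt.comp_hasDerivAt s ((hu.deriv s).sub_const φ₀)).sub
      ((hu.deriv s).sub_const φ₀)
  have := constant_of_has_deriv_right_zero (a := 0) (b := T)
    (fun s _ => (hd s).continuousAt.continuousWithinAt) (fun s hs => by
      have := (hd s).hasDerivWithinAt (s := Ici s)
      rwa [h.fixed_of_eqn (hu.eqn s ⟨hs.1, hs.2.le⟩), sub_self] at this) t ht
  simp only [hu.init, sub_self, map_zero] at this
  exact sub_eq_zero.1 this

-- In the expansion of `‖a + d‖ ^ 2` the mixed term is nonnegative, so a bound for the sum controls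
-- each summand. The variable `x` stands for the norm of `P (a + d)`, read off from the equation.
omit h in
theorem sq_norm_le_of_cross_nonneg {a d : H} (had : 0 ≤ inner ℝ a d) {m n x v r K k q : ℝ}
    (hx0 : 0 ≤ x) (hx : x ≤ m * v + n * r) (hv : v ^ 2 ≤ q) (hr : r ^ 2 ≤ k * q) (hq : 1 ≤ q)
    (hK : ‖a + d‖ ≤ K * (1 + x)) :
    ‖a‖ ^ 2 ≤ K ^ 2 * (4 * (1 + (m ^ 2 + n ^ 2 * k))) * q ∧
      ‖d‖ ^ 2 ≤ K ^ 2 * (4 * (1 + (m ^ 2 + n ^ 2 * k))) * q := by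
  have g1 := pow_le_pow_left₀ hx0 hx 2
  have g2 := sq_nonneg (m * v - n * r)
  have g3 := mul_le_mul_of_nonneg_left hr (sq_nonneg n)
  have g4 := mul_le_mul_of_nonneg_left hv (sq_nonneg m)
  have g5 : (1 + x) ^ 2 ≤ 4 * (1 + (m ^ 2 + n ^ 2 * k)) * q := by
    linarith [sq_nonneg (1 - x)]
  have g6 := pow_le_pow_left₀ (norm_nonneg _) hK 2
  rw [mul_pow] at g6
  have g7 := mul_le_mul_of_nonneg_left g5 (sq_nonneg K)
  have g8 : ‖a + d‖ ^ 2 = ‖a‖ ^ 2 + 2 * inner ℝ a d + ‖d‖ ^ 2 := norm_add_sq_real a d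
  constructor <;> linarith [sq_nonneg ‖a‖, sq_nonneg ‖d‖]

/-- Uniform bounds for the solutions of the regularised problems. -/
theorem exists_bounds (hT : 0 < T) (b : ℝ) : ∃ C : ℝ, 0 ≤ C ∧ ∀ l, 0 < l → l ≤ 1 →
    ∀ g f u u' : ℝ → H, Continuous g → Continuous f →
      (∫ t in (0 : ℝ)..T, ‖g t‖ ^ 2) ≤ b → (∫ t in (0 : ℝ)..T, ‖f t‖ ^ 2) ≤ b →
      IsRegularSolution tau A B S N P p φ₀ T l g f u u' →
      (∫ t in (0 : ℝ)..T, ‖u' t‖ ^ 2) ≤ C ∧ (∫ t in (0 : ℝ)..T, ‖yosida A l (u t)‖ ^ 2) ≤ C ∧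
      (∫ t in (0 : ℝ)..T, ‖yosida B l (u t)‖ ^ 2) ≤ C ∧
      (∫ t in (0 : ℝ)..T, ‖yosida S l (u t - f t)‖ ^ 2) ≤ C := by
  obtain ⟨c, hc0, hr2⟩ := h.exists_lower_order_bound
  obtain ⟨K, hK, hker⟩ := h.kernel_bound
  obtain ⟨E, hE0, hE⟩ := h.exists_energy_bound hT b
  set m : ℝ := ‖tau • ContinuousLinearMap.id ℝ H + N‖ with hm
  set b' := |b|
  -- `K₁` recovers the sum of the approximations from its image under `P`, `K₂` comes from the
  -- square of that image measured against `1 + ‖u'‖ ^ 2 + ‖f‖ ^ 2 + ‖g‖ ^ 2`, and `K'` also covers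
  -- the approximation of `S`.
  set K₁ : ℝ := 1 + K * (1 + (1 + E)) with hK₁
  set K₂ : ℝ := m ^ 2 + ‖P‖ ^ 2 * (c * (1 + E)) with hK₂
  set K₃ : ℝ := K₁ ^ 2 * (4 * (1 + K₂)) with hK₃
  have hK₂0 : 0 ≤ K₂ := by positivity
  set K' : ℝ := K₃ + c * (1 + E) with hK'
  have hK'0 : 0 ≤ K' := by positivity
  refine ⟨E + K' * (T + E + b' + b'), by positivity, ?_⟩
  intro l hl hl1 g f u u' hg hf hgb hfb hu
  obtain ⟨hsup, hu'b⟩ := hE l hl hl1 g f u u' hg hf hgb hfb hu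
  have cu := hu.continuous
  have cu' := hu.cont
  have cA := (h.maxA.lipschitzWith_yosida hl).continuous
  have cB := (h.maxB.lipschitzWith_yosida hl).continuous
  have cS := (h.maxS.lipschitzWith_yosida hl).continuous
  have hpt : ∀ t ∈ Icc 0 T,
      ‖yosida A l (u t)‖ ^ 2 ≤ K' * (1 + ‖u' t‖ ^ 2 + ‖f t‖ ^ 2 + ‖g t‖ ^ 2) ∧
      ‖yosida B l (u t)‖ ^ 2 ≤ K' * (1 + ‖u' t‖ ^ 2 + ‖f t‖ ^ 2 + ‖g t‖ ^ 2) ∧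
      ‖yosida S l (u t - f t)‖ ^ 2 ≤ K' * (1 + ‖u' t‖ ^ 2 + ‖f t‖ ^ 2 + ‖g t‖ ^ 2) := by
    intro t ht
    have e1 := hu.eqn t ht
    obtain ⟨e2, e3⟩ := hr2 l hl hl1 (u t) (f t) (g t)
    have e4 := hker l hl hl1 (u t) (h.fixed_sub_init hu ht)
    have e5 := h.cross l hl (u t)
    set r := p (u t) + yosida S l (u t - f t) - g t
    set a := yosida A l (u t)
    set d := yosida B l (u t)
    set q : ℝ := 1 + ‖u' t‖ ^ 2 + ‖f t‖ ^ 2 + ‖g t‖ ^ 2 with hq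
    have hq0 : 1 ≤ q := by
      rw [hq]; linarith [sq_nonneg ‖u' t‖, sq_nonneg ‖f t‖, sq_nonneg ‖g t‖]
    have f1 : c * (1 + ‖u t‖ ^ 2 + ‖f t‖ ^ 2 + ‖g t‖ ^ 2) ≤ c * (1 + E) * q := by
      rw [mul_assoc]
      gcongr
      have := hsup t ht
      have : E ≤ E * q := le_mul_of_one_le_right hE0 hq0
      rw [add_mul, one_mul]
      linarith [sq_nonneg ‖u' t‖]
    -- The equation expresses `P (a + d)` through `u'` and the lower order terms, which are already
    -- bounded.
    have f2 : P (a + d) = -((tau • ContinuousLinearMap.id ℝ H + N) (u' t) + P r) := by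
      rw [map_add P (a + d) r] at e1
      rw [eq_neg_iff_add_eq_zero, ← e1]
      simp only [add_apply, smul_apply, ContinuousLinearMap.id_apply]
      abel
    have f3 : ‖P (a + d)‖ ≤ m * ‖u' t‖ + ‖P‖ * ‖r‖ := by
      rw [f2, norm_neg]
      exact (norm_add_le _ _).trans (add_le_add (ContinuousLinearMap.le_opNorm _ _)
        (P.le_opNorm _))
    have f5 : ‖u t‖ ≤ 1 + E := by nlinarith [hsup t ht, sq_nonneg (‖u t‖ - 1)]
    have f6 : ‖a + d‖ ≤ K₁ * (1 + ‖P (a + d)‖) := by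
      have g1 := norm_le_norm_sub_add (a + d) (P (a + d))
      have g2 : K * (1 + ‖u t‖) * (1 + ‖P (a + d)‖) ≤ K * (1 + (1 + E)) * (1 + ‖P (a + d)‖) := by
        gcongr
      rw [hK₁, add_mul, one_mul]
      linarith
    obtain ⟨f7, f8⟩ := sq_norm_le_of_cross_nonneg e5 (norm_nonneg _) f3 (q := q)
      (by rw [hq]; linarith [sq_nonneg ‖f t‖, sq_nonneg ‖g t‖]) (e2.trans f1) hq0 f6
    have f9 : 0 ≤ K₃ * q := by positivity
    have f10 : 0 ≤ c * (1 + E) * q := by positivity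
    rw [hK', add_mul]
    exact ⟨f7.trans (le_add_of_nonneg_right f10), f8.trans (le_add_of_nonneg_right f10),
      (e3.trans f1).trans (le_add_of_nonneg_left f9)⟩
  have hfin : ∀ w : ℝ → H, Continuous w →
      (∀ t ∈ Icc 0 T, ‖w t‖ ^ 2 ≤ K' * (1 + ‖u' t‖ ^ 2 + ‖f t‖ ^ 2 + ‖g t‖ ^ 2)) →
      (∫ t in (0 : ℝ)..T, ‖w t‖ ^ 2) ≤ E + K' * (T + E + b' + b') := by
    intro w hw hwb
    have e1 : (∫ t in (0 : ℝ)..T, ‖w t‖ ^ 2)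
        ≤ ∫ t in (0 : ℝ)..T, K' * (1 + ‖u' t‖ ^ 2 + ‖f t‖ ^ 2 + ‖g t‖ ^ 2) :=
      intervalIntegral.integral_mono_on hT.le ((hw.norm.pow 2).intervalIntegrable _ _)
        (Continuous.intervalIntegrable (by fun_prop) _ _) hwb
    have e2 := integral_const_mul_le hg hf cu' hK'0 hu'b (hfb.trans (le_abs_self b))
      (hgb.trans (le_abs_self b))
    linarith
  refine ⟨?_, hfin _ (by fun_prop) fun t ht => (hpt t ht).1,
    hfin _ (by fun_prop) fun t ht => (hpt t ht).2.1,
    hfin _ (by fun_prop) fun t ht => (hpt t ht).2.2⟩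
  have : 0 ≤ K' * (T + E + b' + b') := by positivity
  linarith

end IsEvolutionSystem
-- Convergence of the regularised problems and passage to the limit
namespace IsEvolutionSystem
variable (h : IsEvolutionSystem tau A B S N P p φ₀)
include h

/-- Comparison of two solutions of regularised problems. -/
theorem exists_stability : ∃ C : ℝ, 0 ≤ C ∧ ∀ l₁ l₂, 0 < l₁ → 0 < l₂ →
    ∀ g₁ f₁ u₁ u₁' g₂ f₂ u₂ u₂' : ℝ → H, Continuous g₁ → Continuous f₁ → Continuous g₂ →
      Continuous f₂ → IsRegularSolution tau A B S N P p φ₀ T l₁ g₁ f₁ u₁ u₁' →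
      IsRegularSolution tau A B S N P p φ₀ T l₂ g₂ f₂ u₂ u₂' → ∀ t ∈ Icc 0 T,
      ‖u₁ t - u₂ t‖ ^ 2 ≤ C * ∫ t in (0 : ℝ)..T, (2 * (l₁ + l₂) *
        ((‖yosida A l₁ (u₁ t)‖ ^ 2 + ‖yosida A l₂ (u₂ t)‖ ^ 2)
          + (‖yosida B l₁ (u₁ t)‖ ^ 2 + ‖yosida B l₂ (u₂ t)‖ ^ 2)
          + (‖yosida S l₁ (u₁ t - f₁ t)‖ ^ 2 + ‖yosida S l₂ (u₂ t - f₂ t)‖ ^ 2))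
        + 2 * (‖yosida S l₁ (u₁ t - f₁ t) - yosida S l₂ (u₂ t - f₂ t)‖ * ‖f₁ t - f₂ t‖)
        + ‖g₁ t - g₂ t‖ ^ 2) := by
  obtain ⟨L, hL⟩ := h.lipschitz
  have htau := h.tau_pos
  set C₁ : ℝ := (2 * L + 1) / tau with hC₁
  refine ⟨Real.exp (C₁ * T) / tau, by positivity, ?_⟩
  intro l₁ l₂ hl₁ hl₂ g₁ f₁ u₁ u₁' g₂ f₂ u₂ u₂' hg₁ hf₁ hg₂ hf₂ h₁ h₂ t ht
  have cu₁ := h₁.continuous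
  have cu₂ := h₂.continuous
  have cA := fun l (hl : 0 < l) => (h.maxA.lipschitzWith_yosida hl).continuous
  have cB := fun l (hl : 0 < l) => (h.maxB.lipschitzWith_yosida hl).continuous
  have cS := fun l (hl : 0 < l) => (h.maxS.lipschitzWith_yosida hl).continuous
  have cA1 := cA l₁ hl₁
  have cA2 := cA l₂ hl₂
  have cB1 := cB l₁ hl₁
  have cB2 := cB l₂ hl₂
  have cS1 := cS l₁ hl₁
  have cS2 := cS l₂ hl₂
  set k : ℝ → ℝ := fun t => 2 * (l₁ + l₂) *
        ((‖yosida A l₁ (u₁ t)‖ ^ 2 + ‖yosida A l₂ (u₂ t)‖ ^ 2)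
          + (‖yosida B l₁ (u₁ t)‖ ^ 2 + ‖yosida B l₂ (u₂ t)‖ ^ 2)
          + (‖yosida S l₁ (u₁ t - f₁ t)‖ ^ 2 + ‖yosida S l₂ (u₂ t - f₂ t)‖ ^ 2))
        + 2 * (‖yosida S l₁ (u₁ t - f₁ t) - yosida S l₂ (u₂ t - f₂ t)‖ * ‖f₁ t - f₂ t‖)
        + ‖g₁ t - g₂ t‖ ^ 2 with hk
  have hkc : Continuous k := by fun_prop
  have hk0 : ∀ t, 0 ≤ k t := fun t => by positivity
  let w : ℝ → H := fun t => u₁ t - u₂ t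
  let w' : ℝ → H := fun t => u₁' t - u₂' t
  have hw : ∀ t, HasDerivAt w (w' t) t := fun t => (h₁.deriv t).sub (h₂.deriv t)
  -- The quadratic form of `τ + N` is the natural energy of the difference `w`: its derivative pairs
  -- the equation with `w` itself, and `P w = w` removes the projection.
  let M : H →L[ℝ] H := tau • ContinuousLinearMap.id ℝ H + N
  have hM : ∀ u, M u = tau • u + N u := fun u => rfl
  let q : ℝ → ℝ := fun t => inner ℝ (M (w t)) (w t)
  have hq : ∀ t, HasDerivAt q (2 * inner ℝ (M (w' t)) (w t)) t := by
    intro t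
    have e1 := (M.hasFDerivAt.comp_hasDerivAt t (hw t)).inner ℝ (hw t)
    refine e1.congr_deriv ?_
    have e2 : inner ℝ (M (w t)) (w' t) = inner ℝ (M (w' t)) (w t) := by
      rw [hM, hM, inner_add_left, inner_add_left, h.N_symm, real_inner_smul_left,
        real_inner_smul_left, real_inner_comm (w' t) (w t), real_inner_comm (N (w' t)) (w t)]
    rw [Function.comp_apply, e2]
    ring
  have hq0 : ∀ t, tau * ‖w t‖ ^ 2 ≤ q t := fun t => by
    simp only [q, hM, inner_add_left, real_inner_smul_left, real_inner_self_eq_norm_sq]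
    linarith [h.N_nonneg (w t)]
  have hineq : ∀ t ∈ Icc 0 T, 2 * inner ℝ (M (w' t)) (w t) + 0 ≤ C₁ * q t + k t := by
    intro t ht
    have hPw : P (w t) = w t := by
      have e : w t = (u₁ t - φ₀) - (u₂ t - φ₀) := by simp only [w]; abel
      rw [e, map_sub, h.fixed_sub_init h₁ ht, h.fixed_sub_init h₂ ht]
    have e1 := h₁.eqn t ht
    have e2 := h₂.eqn t ht
    have iA := h.maxA.inner_yosida_sub_ge hl₁ hl₂ (u₁ t) (u₂ t)
    have iB := h.maxB.inner_yosida_sub_ge hl₁ hl₂ (u₁ t) (u₂ t)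
    have iS := h.maxS.inner_yosida_sub_ge hl₁ hl₂ (u₁ t - f₁ t) (u₂ t - f₂ t)
    have ip : ‖p (u₁ t) - p (u₂ t)‖ ≤ L * ‖u₁ t - u₂ t‖ := by
      simpa [dist_eq_norm] using hL.dist_le_mul (u₁ t) (u₂ t)
    simp only [hk]
    set a₁ := yosida A l₁ (u₁ t)
    set a₂ := yosida A l₂ (u₂ t)
    set b₁ := yosida B l₁ (u₁ t)
    set b₂ := yosida B l₂ (u₂ t)
    set s₁ := yosida S l₁ (u₁ t - f₁ t)
    set s₂ := yosida S l₂ (u₂ t - f₂ t)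
    have e3 : M (w' t) = -(P ((a₁ - a₂) + (b₁ - b₂) + ((p (u₁ t) - p (u₂ t)) + (s₁ - s₂)
        - (g₁ t - g₂ t)))) := by
      have e4 : (a₁ - a₂) + (b₁ - b₂) + ((p (u₁ t) - p (u₂ t)) + (s₁ - s₂) - (g₁ t - g₂ t))
        = (a₁ + b₁ + (p (u₁ t) + s₁ - g₁ t)) - (a₂ + b₂ + (p (u₂ t) + s₂ - g₂ t)) := by abel
      rw [e4, map_sub P, eq_neg_iff_add_eq_zero, hM]
      simp only [w', smul_sub, map_sub]
      rw [← sub_self (0 : H)]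
      nth_rw 1 [← e1]
      rw [← e2]
      abel
    -- Monotonicity of `S` concerns the shifted arguments; the shift leaves an error that is only
    -- linear in `f₁ - f₂`.
    have e5 : u₁ t - f₁ t - (u₂ t - f₂ t) = w t - (f₁ t - f₂ t) := by simp only [w]; abel
    rw [e5, inner_sub_right] at iS
    rw [e3, inner_neg_left, h.inner_P_of_fixed hPw]
    simp only [inner_add_left, inner_sub_left _ (g₁ t - g₂ t)]
    have j1 := real_inner_le_norm (s₁ - s₂) (f₁ t - f₂ t)
    have j1' := neg_le_of_abs_le (abs_real_inner_le_norm (s₁ - s₂) (f₁ t - f₂ t))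
    have j2 := real_inner_le_norm (g₁ t - g₂ t) (w t)
    have j3 := neg_le_of_abs_le (abs_real_inner_le_norm (p (u₁ t) - p (u₂ t)) (w t))
    have j4 : ‖p (u₁ t) - p (u₂ t)‖ * ‖w t‖ ≤ L * ‖w t‖ ^ 2 := by
      rw [sq, ← mul_assoc]; gcongr
    have j5 : 2 * (‖g₁ t - g₂ t‖ * ‖w t‖) ≤ ‖g₁ t - g₂ t‖ ^ 2 + ‖w t‖ ^ 2 := by
      linarith [sq_nonneg (‖g₁ t - g₂ t‖ - ‖w t‖)]
    have j6 : (2 * L + 1) * ‖w t‖ ^ 2 ≤ C₁ * q t := by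
      have := mul_le_mul_of_nonneg_left (hq0 t) (show 0 ≤ C₁ by positivity)
      have e : C₁ * (tau * ‖w t‖ ^ 2) = (2 * L + 1) * ‖w t‖ ^ 2 := by rw [hC₁]; field_simp
      rwa [e] at this
    change -((l₁ + l₂) * (‖a₁‖ ^ 2 + ‖a₂‖ ^ 2)) ≤ inner ℝ (a₁ - a₂) (w t) at iA
    change -((l₁ + l₂) * (‖b₁‖ ^ 2 + ‖b₂‖ ^ 2)) ≤ inner ℝ (b₁ - b₂) (w t) at iB
    linarith
  have hgron := gronwall_dissipation (C := C₁) (T := T) (by positivity) hq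
    (fun t _ => le_trans (by positivity) (hq0 t)) (p := fun _ => 0) continuous_const hkc
    (fun _ _ => le_rfl) (fun t _ => hk0 t) hineq ht
  have e1 : q 0 = 0 := by simp [q, w, h₁.init, h₂.init]
  have e2 : (∫ s in (0 : ℝ)..t, k s) ≤ ∫ s in (0 : ℝ)..T, k s :=
    intervalIntegral.integral_mono_interval le_rfl ht.1 ht.2
      (Eventually.of_forall fun s => hk0 s) (hkc.intervalIntegrable _ _)
  rw [e1, zero_add, intervalIntegral.integral_zero, mul_zero, add_zero] at hgron
  have e3 := mul_le_mul_of_nonneg_left (hgron.trans e2) (Real.exp_pos (C₁ * T)).le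
  rw [← mul_assoc, ← Real.exp_add, add_neg_cancel, Real.exp_zero, one_mul] at e3
  rw [div_mul_eq_mul_div, le_div_iff₀ htau, mul_comm _ tau]
  exact (hq0 t).trans e3

end IsEvolutionSystem

theorem integral_norm_mul_norm_le (hT : 0 ≤ T) {f g : ℝ → H} (hf : Continuous f)
    (hg : Continuous g) :
    (∫ t in (0 : ℝ)..T, ‖f t‖ * ‖g t‖) ≤ ‖ofCont T hf‖ * ‖ofCont T hg‖ := by
  have e : ∀ (f : ℝ → H) (hf : Continuous f), ‖ofCont T hf.norm‖ = ‖ofCont T hf‖ := by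
    intro f hf
    have := sq_norm_ofCont hT hf.norm
    simp only [norm_norm] at this
    rw [← sq_norm_ofCont hT hf] at this
    exact (sq_eq_sq₀ (norm_nonneg _) (norm_nonneg _)).1 this
  rw [← e f hf, ← e g hg]
  refine le_trans (le_of_eq ?_) (real_inner_le_norm _ _)
  rw [L2.inner_def, ← integral_time hT]
  refine integral_congr_ae ?_
  filter_upwards [coeFn_ofCont (T := T) hf.norm, coeFn_ofCont (T := T) hg.norm] with t h1 h2
  rw [h1, h2]
  simp [mul_comm]

/-- Six squared norms bounded by `D`, with the factor `2 l`, give `12 D`. Cauchy–Schwarz for the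
mixed term, where `s₁ - s₂` has norm at most `2 √D`, gives `4 √D`; so `f` enters with power one and
`g` with power two. -/
theorem integral_error_le (hT : 0 ≤ T) {a₁ a₂ b₁ b₂ s₁ s₂ f₁ f₂ g₁ g₂ : ℝ → H}
    (ca₁ : Continuous a₁) (ca₂ : Continuous a₂) (cb₁ : Continuous b₁) (cb₂ : Continuous b₂)
    (cs₁ : Continuous s₁) (cs₂ : Continuous s₂) (hf₁ : Continuous f₁) (hf₂ : Continuous f₂)
    (hg₁ : Continuous g₁) (hg₂ : Continuous g₂) {l D : ℝ} (hl : 0 ≤ l) (hD : 0 ≤ D)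
    (A1 : (∫ t in (0 : ℝ)..T, ‖a₁ t‖ ^ 2) ≤ D) (A2 : (∫ t in (0 : ℝ)..T, ‖a₂ t‖ ^ 2) ≤ D)
    (B1 : (∫ t in (0 : ℝ)..T, ‖b₁ t‖ ^ 2) ≤ D) (B2 : (∫ t in (0 : ℝ)..T, ‖b₂ t‖ ^ 2) ≤ D)
    (S1 : (∫ t in (0 : ℝ)..T, ‖s₁ t‖ ^ 2) ≤ D) (S2 : (∫ t in (0 : ℝ)..T, ‖s₂ t‖ ^ 2) ≤ D) :
    (∫ t in (0 : ℝ)..T, (2 * l * ((‖a₁ t‖ ^ 2 + ‖a₂ t‖ ^ 2) + (‖b₁ t‖ ^ 2 + ‖b₂ t‖ ^ 2)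
          + (‖s₁ t‖ ^ 2 + ‖s₂ t‖ ^ 2)) + 2 * (‖s₁ t - s₂ t‖ * ‖f₁ t - f₂ t‖)
        + ‖g₁ t - g₂ t‖ ^ 2))
      ≤ (12 * D + 4 * Real.sqrt D + 1) * (l + ‖ofCont T hf₁ - ofCont T hf₂‖
        + ‖ofCont T hg₁ - ofCont T hg₂‖ ^ 2) := by
  have i2 : ∀ w : ℝ → H, Continuous w → IntervalIntegrable (fun t => ‖w t‖ ^ 2) volume 0 T :=
    fun w hw => (hw.norm.pow 2).intervalIntegrable _ _
  have i3 : IntervalIntegrable (fun t => ‖s₁ t - s₂ t‖ * ‖f₁ t - f₂ t‖) volume 0 T :=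
    ((cs₁.sub cs₂).norm.mul (hf₁.sub hf₂).norm).intervalIntegrable _ _
  have i4 := (i2 _ ca₁).add (i2 _ ca₂)
  have i5 := (i2 _ cb₁).add (i2 _ cb₂)
  have i6 := (i2 _ cs₁).add (i2 _ cs₂)
  have i7 := i4.add i5
  rw [intervalIntegral.integral_add (((i7.add i6).const_mul _).add (i3.const_mul _))
      (i2 (fun t => g₁ t - g₂ t) (hg₁.sub hg₂)),
    intervalIntegral.integral_add ((i7.add i6).const_mul _) (i3.const_mul _),
    intervalIntegral.integral_const_mul, intervalIntegral.integral_const_mul,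
    intervalIntegral.integral_add i7 i6, intervalIntegral.integral_add i4 i5,
    intervalIntegral.integral_add (i2 _ ca₁) (i2 _ ca₂),
    intervalIntegral.integral_add (i2 _ cb₁) (i2 _ cb₂),
    intervalIntegral.integral_add (i2 _ cs₁) (i2 _ cs₂)]
  have e1 : (∫ t in (0 : ℝ)..T, ‖s₁ t - s₂ t‖ * ‖f₁ t - f₂ t‖)
      ≤ ‖ofCont T cs₁ - ofCont T cs₂‖ * ‖ofCont T hf₁ - ofCont T hf₂‖ := by
    rw [ofCont_sub, ofCont_sub]
    exact integral_norm_mul_norm_le hT (cs₁.sub cs₂) (hf₁.sub hf₂)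
  have e2 : ‖ofCont T hg₁ - ofCont T hg₂‖ ^ 2 = ∫ t in (0 : ℝ)..T, ‖g₁ t - g₂ t‖ ^ 2 := by
    rw [ofCont_sub hg₁ hg₂, sq_norm_ofCont hT]
  have e3 : ∀ (w : ℝ → H) (hw : Continuous w), (∫ t in (0 : ℝ)..T, ‖w t‖ ^ 2) ≤ D →
      ‖ofCont T hw‖ ≤ Real.sqrt D := fun w hw hwD => by
    refine Real.le_sqrt_of_sq_le ?_
    rwa [sq_norm_ofCont hT]
  have e4 : ‖ofCont T cs₁ - ofCont T cs₂‖ ≤ Real.sqrt D + Real.sqrt D :=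
    (norm_sub_le _ _).trans (add_le_add (e3 _ _ S1) (e3 _ _ S2))
  have e5 := e1.trans (mul_le_mul_of_nonneg_right e4 (norm_nonneg _))
  have e6 := mul_le_mul_of_nonneg_left (add_le_add (add_le_add (add_le_add A1 A2)
    (add_le_add B1 B2)) (add_le_add S1 S2)) (show 0 ≤ 2 * l by positivity)
  rw [← e2]
  have n1 := norm_nonneg (ofCont T hf₁ - ofCont T hf₂)
  have n2 := sq_nonneg ‖ofCont T hg₁ - ofCont T hg₂‖
  have n3 := Real.sqrt_nonneg D
  have m1 := mul_nonneg hD n1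
  have m2 := mul_nonneg hD n2
  have m3 := mul_nonneg n3 n2
  have m4 := mul_nonneg n3 hl
  linarith

theorem IsEvolutionSystem.exists_stability_norm (h : IsEvolutionSystem tau A B S N P p φ₀)
    (hT : 0 < T) (b : ℝ) : ∃ C : ℝ, 0 ≤ C ∧ ∀ l₁ l₂, 0 < l₁ → l₁ ≤ 1 → 0 < l₂ → l₂ ≤ 1 →
    ∀ g₁ f₁ u₁ u₁' g₂ f₂ u₂ u₂' : ℝ → H, ∀ (hg₁ : Continuous g₁) (hf₁ : Continuous f₁)
      (hg₂ : Continuous g₂) (hf₂ : Continuous f₂),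
      ‖ofCont T hg₁‖ ^ 2 ≤ b → ‖ofCont T hf₁‖ ^ 2 ≤ b → ‖ofCont T hg₂‖ ^ 2 ≤ b →
      ‖ofCont T hf₂‖ ^ 2 ≤ b →
      IsRegularSolution tau A B S N P p φ₀ T l₁ g₁ f₁ u₁ u₁' →
      IsRegularSolution tau A B S N P p φ₀ T l₂ g₂ f₂ u₂ u₂' → ∀ t ∈ Icc 0 T,
      ‖u₁ t - u₂ t‖ ^ 2 ≤ C * (l₁ + l₂ + ‖ofCont T hf₁ - ofCont T hf₂‖
        + ‖ofCont T hg₁ - ofCont T hg₂‖ ^ 2) := by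
  obtain ⟨C, hC, hst⟩ := h.exists_stability (T := T)
  obtain ⟨D, hD, hbd⟩ := h.exists_bounds hT b
  refine ⟨C * (12 * D + 4 * Real.sqrt D + 1), by positivity, ?_⟩
  intro l₁ l₂ hl₁ hl₁' hl₂ hl₂' g₁ f₁ u₁ u₁' g₂ f₂ u₂ u₂' hg₁ hf₁ hg₂ hf₂ bg₁ bf₁ bg₂ bf₂ h₁ h₂
    t ht
  rw [sq_norm_ofCont hT.le] at bg₁ bf₁ bg₂ bf₂
  obtain ⟨-, A1, B1, S1⟩ := hbd l₁ hl₁ hl₁' g₁ f₁ u₁ u₁' hg₁ hf₁ bg₁ bf₁ h₁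
  obtain ⟨-, A2, B2, S2⟩ := hbd l₂ hl₂ hl₂' g₂ f₂ u₂ u₂' hg₂ hf₂ bg₂ bf₂ h₂
  have cu₁ := h₁.continuous
  have cu₂ := h₂.continuous
  have cA1 : Continuous fun t => yosida A l₁ (u₁ t) :=
    (h.maxA.lipschitzWith_yosida hl₁).continuous.comp cu₁
  have cA2 : Continuous fun t => yosida A l₂ (u₂ t) :=
    (h.maxA.lipschitzWith_yosida hl₂).continuous.comp cu₂
  have cB1 : Continuous fun t => yosida B l₁ (u₁ t) :=
    (h.maxB.lipschitzWith_yosida hl₁).continuous.comp cu₁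
  have cB2 : Continuous fun t => yosida B l₂ (u₂ t) :=
    (h.maxB.lipschitzWith_yosida hl₂).continuous.comp cu₂
  have cS1 : Continuous fun t => yosida S l₁ (u₁ t - f₁ t) :=
    (h.maxS.lipschitzWith_yosida hl₁).continuous.comp (cu₁.sub hf₁)
  have cS2 : Continuous fun t => yosida S l₂ (u₂ t - f₂ t) :=
    (h.maxS.lipschitzWith_yosida hl₂).continuous.comp (cu₂.sub hf₂)
  refine (hst l₁ l₂ hl₁ hl₂ g₁ f₁ u₁ u₁' g₂ f₂ u₂ u₂' hg₁ hf₁ hg₂ hf₂ h₁ h₂ t ht).trans ?_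
  rw [mul_assoc]
  gcongr
  exact integral_error_le hT.le cA1 cA2 cB1 cB2 cS1 cS2 hf₁ hf₂ hg₁ hg₂ (add_pos hl₁ hl₂).le hD
    A1 A2 B1 B2 S1 S2

theorem tendsto_inner_map_of_weak {X Y : Type*} [NormedAddCommGroup X] [InnerProductSpace ℝ X]
    [CompleteSpace X] [NormedAddCommGroup Y] [InnerProductSpace ℝ Y] [CompleteSpace Y]
    {ι : Type*} {U : Filter ι} {x : ι → X} {y : X}
    (hx : ∀ z, Tendsto (fun n => inner ℝ (x n) z) U (𝓝 (inner ℝ y z))) (L : X →L[ℝ] Y) (z : Y) :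
    Tendsto (fun n => inner ℝ (L (x n)) z) U (𝓝 (inner ℝ (L y) z)) := by
  simpa only [ContinuousLinearMap.adjoint_inner_right] using
    hx (ContinuousLinearMap.adjoint L z)

theorem norm_ofCont_le_of_bound (hT : 0 ≤ T) {f : ℝ → H} (hf : Continuous f) {c : ℝ} (hc : 0 ≤ c)
    (h : ∀ t ∈ Icc 0 T, ‖f t‖ ≤ c) : ‖ofCont T hf‖ ≤ Real.sqrt T * c := by
  refine le_of_sq_le_sq ?_ (by positivity)
  rw [sq_norm_ofCont hT, mul_pow, Real.sq_sqrt hT]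
  calc _ ≤ ∫ t in (0 : ℝ)..T, c ^ 2 := intervalIntegral.integral_mono_on hT
        ((hf.norm.pow 2).intervalIntegrable _ _) (continuous_const.intervalIntegrable _ _)
        fun t ht => pow_le_pow_left₀ (norm_nonneg _) (h t ht) 2
    _ = _ := by simp

/-- On `[0, T]` this is completeness of the space of continuous functions; the limit is extended by
constants, so that it is continuous on the whole line. -/
theorem exists_limit_of_uniform_cauchy [CompleteSpace H] (hT : 0 < T) {u : ℕ → ℝ → H}
    (hu : ∀ n, Continuous (u n)) {d : ℕ × ℕ → ℝ} (hd : Tendsto d atTop (𝓝 0))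
    (h : ∀ n m, ∀ t ∈ Icc 0 T, ‖u n t - u m t‖ ^ 2 ≤ d (n, m)) :
    ∃ (w : ℝ → H) (hw : Continuous w), Tendsto (fun n => ofCont T (hu n)) atTop (𝓝 (ofCont T hw)) ∧
      ∀ t ∈ Icc 0 T, Tendsto (fun n => u n t) atTop (𝓝 (w t)) := by
  let V : ℕ → C(Icc (0 : ℝ) T, H) := fun n => ⟨fun t => u n t, by have := hu n; fun_prop⟩
  have hV : CauchySeq V := by
    rw [cauchySeq_iff_tendsto_dist_atTop_0]
    have h0 : Tendsto (fun n => Real.sqrt (d n)) atTop (𝓝 0) := by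
      simpa using hd.sqrt
    refine squeeze_zero (fun _ => dist_nonneg) (fun n => ?_) h0
    rw [ContinuousMap.dist_le (Real.sqrt_nonneg _)]
    rintro ⟨t, ht⟩
    rw [dist_eq_norm]
    exact Real.le_sqrt_of_sq_le (h n.1 n.2 t ht)
  obtain ⟨W, hW⟩ := cauchySeq_tendsto_of_complete hV
  have hw : Continuous fun t => W (projIcc 0 T hT.le t) := W.continuous.comp continuous_projIcc
  refine ⟨_, hw, ?_, fun t ht => ?_⟩
  · rw [tendsto_iff_norm_sub_tendsto_zero]
    have h0 : Tendsto (fun n => Real.sqrt T * dist (V n) W) atTop (𝓝 0) := by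
      simpa using (tendsto_iff_dist_tendsto_zero.1 hW).const_mul (Real.sqrt T)
    refine squeeze_zero (fun _ => norm_nonneg _) (fun n => ?_) h0
    rw [ofCont_sub]
    refine norm_ofCont_le_of_bound hT.le _ dist_nonneg fun t ht => ?_
    rw [projIcc_of_mem hT.le ht, ← dist_eq_norm]
    exact ContinuousMap.dist_apply_le_dist (f := V n) (g := W) ⟨t, ht⟩
  · simp only [projIcc_of_mem hT.le ht]
    exact ((continuous_eval_const (F := C(Icc (0 : ℝ) T, H)) (⟨t, ht⟩ : Icc (0 : ℝ) T)).tendsto W).comp hW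

/-- Existence for the abstract evolution problem. -/
theorem IsEvolutionSystem.exists_solution [CompleteSpace H]
    (h : IsEvolutionSystem tau A B S N P p φ₀) (hT : 0 < T) (g φs : L2Time T H) :
    ∃ φ φ' α ξ ζ : L2Time T H, HasWeakTimeDeriv φ φ' ∧ HasInitialValue φ φ₀ ∧
      (∀ᵐ t ∂timeMeasure T, α t ∈ A (φ t)) ∧ (∀ᵐ t ∂timeMeasure T, ξ t ∈ B (φ t)) ∧
      (∀ᵐ t ∂timeMeasure T, ζ t ∈ S (φ t - φs t)) ∧
      ∀ᵐ t ∂timeMeasure T,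
        tau • φ' t + N (φ' t) + P (α t + ξ t + (p (φ t) + ζ t - g t)) = 0 := by
  obtain ⟨L, hL⟩ := h.lipschitz
  obtain ⟨G, hG, hGlim⟩ := exists_ofCont_tendsto g
  obtain ⟨F, hF, hFlim⟩ := exists_ofCont_tendsto φs
  let l : ℕ → ℝ := fun n => 1 / ((n : ℝ) + 1)
  have hl : ∀ n, 0 < l n := fun n => by positivity
  have hl1 : ∀ n, l n ≤ 1 := fun n => by
    rw [div_le_one (by positivity)]; linarith [n.cast_nonneg (α := ℝ)]
  have hl0 : Tendsto l atTop (𝓝 0) := tendsto_one_div_add_atTop_nhds_zero_nat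
  obtain ⟨b, hb⟩ : ∃ b, ∀ n, ‖ofCont T (hG n)‖ ^ 2 ≤ b ∧ ‖ofCont T (hF n)‖ ^ 2 ≤ b := by
    obtain ⟨b₁, hb₁⟩ := (hGlim.norm.pow 2).bddAbove_range
    obtain ⟨b₂, hb₂⟩ := (hFlim.norm.pow 2).bddAbove_range
    exact ⟨max b₁ b₂, fun n => ⟨(hb₁ ⟨n, rfl⟩).trans (le_max_left _ _),
      (hb₂ ⟨n, rfl⟩).trans (le_max_right _ _)⟩⟩
  choose u u' hu using fun n => h.exists_regularSolution hT (hl n) (hG n) (hF n)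
  have cu := fun n => (hu n).continuous
  have cu' := fun n => (hu n).cont
  obtain ⟨C, hC, hst⟩ := h.exists_stability_norm hT b
  obtain ⟨w, hw, hulim, hpt⟩ := exists_limit_of_uniform_cauchy hT cu
    (d := fun n => C * (l n.1 + l n.2 + ‖ofCont T (hF n.1) - ofCont T (hF n.2)‖
      + ‖ofCont T (hG n.1) - ofCont T (hG n.2)‖ ^ 2)) (by
      have e1 : Tendsto (fun n : ℕ × ℕ => l n.1) atTop (𝓝 0) := by
        rw [← prod_atTop_atTop_eq]; exact hl0.comp tendsto_fst
      have e2 : Tendsto (fun n : ℕ × ℕ => l n.2) atTop (𝓝 0) := by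
        rw [← prod_atTop_atTop_eq]; exact hl0.comp tendsto_snd
      have e3 := cauchySeq_iff_tendsto_dist_atTop_0.1 hFlim.cauchySeq
      have e4 := cauchySeq_iff_tendsto_dist_atTop_0.1 hGlim.cauchySeq
      simp only [dist_eq_norm] at e3 e4
      simpa using (((e1.add e2).add e3).add (e4.pow 2)).const_mul C)
    (fun n m => hst (l n) (l m) (hl n) (hl1 n) (hl m) (hl1 m) _ _ _ _ _ _ _ _ (hG n) (hF n)
      (hG m) (hF m) (hb n).1 (hb n).2 (hb m).1 (hb m).2 (hu n) (hu m))
  obtain ⟨D, hD, hbd⟩ := h.exists_bounds hT b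
  have hbd' := fun n => hbd (l n) (hl n) (hl1 n) _ _ _ _ (hG n) (hF n)
    (by rw [← sq_norm_ofCont hT.le (hG n)]; exact (hb n).1)
    (by rw [← sq_norm_ofCont hT.le (hF n)]; exact (hb n).2) (hu n)
  have cA : ∀ n, Continuous fun t => yosida A (l n) (u n t) := fun n =>
    (h.maxA.lipschitzWith_yosida (hl n)).continuous.comp (cu n)
  have cB : ∀ n, Continuous fun t => yosida B (l n) (u n t) := fun n =>
    (h.maxB.lipschitzWith_yosida (hl n)).continuous.comp (cu n)
  have cS : ∀ n, Continuous fun t => yosida S (l n) (u n t - F n t) := fun n =>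
    (h.maxS.lipschitzWith_yosida (hl n)).continuous.comp ((cu n).sub (hF n))
  have hnorm : ∀ (f : ℝ → H) (hf : Continuous f), (∫ t in (0 : ℝ)..T, ‖f t‖ ^ 2) ≤ D →
      ‖ofCont T hf‖ ≤ Real.sqrt D := fun f hf hfD => by
    refine Real.le_sqrt_of_sq_le ?_
    rwa [sq_norm_ofCont hT.le]
  -- One ultrafilter gives all four weak limits simultaneously; being finer than `atTop`, it keeps
  -- the strong limits.
  set U : Ultrafilter ℕ := hyperfilter ℕ
  have hU : (U : Filter ℕ) ≤ atTop := Nat.hyperfilter_le_atTop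
  have bD := fun n => hnorm _ (cu' n) (hbd' n).1
  have bA := fun n => hnorm _ (cA n) (hbd' n).2.1
  have bB := fun n => hnorm _ (cB n) (hbd' n).2.2.1
  have bS := fun n => hnorm _ (cS n) (hbd' n).2.2.2
  obtain ⟨φ', -, hφ'⟩ := exists_weak_limit U bD
  obtain ⟨α, -, hα⟩ := exists_weak_limit U bA
  obtain ⟨ξ, -, hξ⟩ := exists_weak_limit U bB
  obtain ⟨ζ, -, hζ⟩ := exists_weak_limit U bS
  -- the resolvents have the same limits
  have hres : ∀ {Q : H → Set H}, IsMaximalMonotone Q → ∀ (v : ℕ → ℝ → H)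
      (hv : ∀ n, Continuous (v n)) (cQ : ∀ n, Continuous fun t => yosida Q (l n) (v n t))
      (v' ζ' : L2Time T H), Tendsto (fun n => ofCont T (hv n)) U (𝓝 v') →
      (∀ n, ‖ofCont T (cQ n)‖ ≤ Real.sqrt D) →
      (∀ z, Tendsto (fun n => inner ℝ (ofCont T (cQ n)) z) U (𝓝 (inner ℝ ζ' z))) →
      ∀ᵐ t ∂timeMeasure T, ζ' t ∈ Q (v' t) := by
    intro Q hQ v hv cQ v' ζ' hlim hbQ hwk
    refine hQ.mem_of_tendsto_weak (u := fun n => ofCont T (hv n) - l n • ofCont T (cQ n))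
      (fun n => ?_) hbQ ?_ hwk
    · filter_upwards [coeFn_ofCont (T := T) (cQ n), coeFn_ofCont (T := T) (hv n),
        Lp.coeFn_sub (ofCont T (hv n)) (l n • ofCont T (cQ n)),
        Lp.coeFn_smul (l n) (ofCont T (cQ n))] with t h1 h2 h3 h4
      rw [h3, Pi.sub_apply, h4, Pi.smul_apply, h1, h2]
      have e := IsMaximalMonotone.resolvent_add_yosida (G := Q) (hl n) (v n t)
      rw [← eq_sub_iff_add_eq] at e
      rw [← e]
      exact hQ.yosida_mem (hl n) _
    · have e : Tendsto (fun n => l n • ofCont T (cQ n)) U (𝓝 0) := by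
        refine squeeze_zero_norm (a := fun n => l n * Real.sqrt D) (fun n => ?_) ?_
        · rw [norm_smul, Real.norm_eq_abs, abs_of_pos (hl n)]
          exact mul_le_mul_of_nonneg_left (hbQ n) (hl n).le
        · simpa using (hl0.mono_left hU).mul_const (Real.sqrt D)
      simpa using hlim.sub e
  have hulim' := hulim.mono_left hU
  refine ⟨ofCont T hw, φ', α, ξ, ζ, ?_, ⟨w, hw.continuousOn, coeFn_ofCont hw, ?_⟩,
    hres h.maxA _ cu cA _ _ hulim' bA hα, hres h.maxB _ cu cB _ _ hulim' bB hξ, ?_, ?_⟩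
  · refine hasWeakTimeDeriv_of_inner fun ψ hψ x => ?_
    refine tendsto_nhds_unique (hulim'.inner tendsto_const_nhds) ?_
    refine (hφ' _).neg.congr fun n => ?_
    exact (inner_ofCont_deriv hT (cu' n) (hu n).deriv (cu n) hψ x).symm
  · refine tendsto_nhds_unique (hpt 0 ⟨le_rfl, hT.le⟩) ?_
    simp only [(hu _).init]
    exact tendsto_const_nhds
  · have e := hres h.maxS (fun n t => u n t - F n t) (fun n => (cu n).sub (hF n)) cS
      (ofCont T hw - φs) ζ (by
        have := hulim'.sub (hFlim.mono_left hU)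
        simpa only [ofCont_sub] using this) bS hζ
    filter_upwards [e, Lp.coeFn_sub (ofCont T hw) φs] with t h1 h2
    rwa [h2] at h1
  · let Nc : L2Time T H →L[ℝ] L2Time T H := N.compLpL 2 (timeMeasure T)
    let Pc : L2Time T H →L[ℝ] L2Time T H := P.compLpL 2 (timeMeasure T)
    have hX : ∀ d a b s q γ : L2Time T H, tau • d + Nc d + Pc (a + b + (q + s - γ))
        =ᵐ[timeMeasure T] fun t => tau • d t + N (d t) + P (a t + b t + (q t + s t - γ t)) := by
      intro d a b s q γ
      filter_upwards [Lp.coeFn_add (tau • d + Nc d) (Pc (a + b + (q + s - γ))),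
        Lp.coeFn_add (tau • d) (Nc d), Lp.coeFn_smul tau d, N.coeFn_compLp d,
        P.coeFn_compLp (a + b + (q + s - γ)), Lp.coeFn_add (a + b) (q + s - γ), Lp.coeFn_add a b,
        Lp.coeFn_sub (q + s) γ, Lp.coeFn_add q s] with t h1 h2 h3 h4 h5 h6 h7 h8 h9
      rw [h1, Pi.add_apply, h2, Pi.add_apply, h3, Pi.smul_apply]
      change tau • d t + (N.compLp d) t + (P.compLp (a + b + (q + s - γ))) t = _
      rw [h4, h5, h6, Pi.add_apply, h7, Pi.add_apply, h8, Pi.sub_apply, h9, Pi.add_apply]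
    let Q : L2Time T H → L2Time T H := lipComp hL
    have hQ : Continuous Q := (lipschitzWith_lipComp hL).continuous
    -- The equation is linear in the weakly convergent quantities, and the only remaining
    -- nonlinearity, `Q`, is continuous along the strongly convergent `u n`.
    have hzero : tau • φ' + Nc φ' + Pc (α + ξ + (Q (ofCont T hw) + ζ - g)) = 0 := by
      refine ext_inner_right ℝ fun z => ?_
      rw [inner_zero_left]
      have hq := ((hQ.tendsto (ofCont T hw)).comp hulim')
      have hgU := hGlim.mono_left hU
      have hin : ∀ z, Tendsto (fun n => inner ℝ (ofCont T (cA n) + ofCont T (cB n)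
          + (Q (ofCont T (cu n)) + ofCont T (cS n) - ofCont T (hG n))) z) U
          (𝓝 (inner ℝ (α + ξ + (Q (ofCont T hw) + ζ - g)) z)) := by
        intro z
        simp only [inner_add_left, inner_sub_left]
        exact ((hα z).add (hξ z)).add (((hq.inner tendsto_const_nhds).add (hζ z)).sub
          (hgU.inner tendsto_const_nhds))
      have hlim : Tendsto (fun n => inner ℝ (tau • ofCont T (cu' n) + Nc (ofCont T (cu' n))
          + Pc (ofCont T (cA n) + ofCont T (cB n)
          + (Q (ofCont T (cu n)) + ofCont T (cS n) - ofCont T (hG n)))) z) U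
          (𝓝 (inner ℝ (tau • φ' + Nc φ' + Pc (α + ξ + (Q (ofCont T hw) + ζ - g))) z)) := by
        rw [inner_add_left, inner_add_left, real_inner_smul_left]
        simp_rw [inner_add_left (tau • _ + _), inner_add_left (tau • _), real_inner_smul_left]
        exact (((hφ' z).const_mul tau).add (tendsto_inner_map_of_weak hφ' Nc z)).add
          (tendsto_inner_map_of_weak hin Pc z)
      refine tendsto_nhds_unique hlim (tendsto_const_nhds.congr fun n => ?_)
      have : tau • ofCont T (cu' n) + Nc (ofCont T (cu' n)) + Pc (ofCont T (cA n) + ofCont T (cB n)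
          + (Q (ofCont T (cu n)) + ofCont T (cS n) - ofCont T (hG n))) = 0 := by
        rw [Lp.eq_zero_iff_ae_eq_zero]
        filter_upwards [hX (ofCont T (cu' n)) (ofCont T (cA n)) (ofCont T (cB n))
          (ofCont T (cS n)) (Q (ofCont T (cu n))) (ofCont T (hG n)), coeFn_ofCont (T := T) (cu' n),
          coeFn_ofCont (T := T) (cA n), coeFn_ofCont (T := T) (cB n), coeFn_ofCont (T := T) (cS n),
          coeFn_ofCont (T := T) (hG n), coeFn_ofCont (T := T) (cu n),
          coeFn_lipComp hL (ofCont T (cu n)), ae_restrict_mem measurableSet_Ioo]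
          with t h1 h2 h3 h4 h5 h6 h7 h8 ht
        rw [h1, h2, h3, h4, h5, h6]
        change tau • u' n t + N (u' n t) + P (_ + _ + (lipComp hL (ofCont T (cu n)) t + _ - _)) = 0
        rw [h8, h7]
        exact (hu n).eqn t (Ioo_subset_Icc_self ht)
      rw [this, inner_zero_left]
    have hz := hX φ' α ξ ζ (Q (ofCont T hw)) g
    rw [hzero] at hz
    filter_upwards [hz, Lp.coeFn_zero H 2 (timeMeasure T), coeFn_lipComp hL (ofCont T hw)]
      with t h1 h2 h3
    change _ = tau • φ' t + N (φ' t) + P (α t + ξ t + (lipComp hL (ofCont T hw) t + ζ t - g t)) at h1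
    rw [h2, h3] at h1
    exact h1.symm

end Evolution

/-! ### Subdifferentials -/

section Subdifferential

theorem mem_subdifferential_real {X : Type} [NormedAddCommGroup X] [InnerProductSpace ℝ X]
    {f : X → ℝ} {u v : X} :
    v ∈ subdifferential (fun u => (f u : EReal)) u ↔ ∀ w, f u + inner ℝ v (w - u) ≤ f w := by
  simp only [subdifferential, mem_ofPred_eq]
  norm_cast

theorem isMaximalMonotone_subdifferential {X : Type} [NormedAddCommGroup X]
    [InnerProductSpace ℝ X] [CompleteSpace X] {f : X → ℝ} (hcv : ConvexOn ℝ univ f)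
    (hlsc : LowerSemicontinuous f) :
    IsMaximalMonotone (subdifferential fun u => (f u : EReal)) := by
  refine ⟨fun {u v ξ η} hξ hη => ?_, fun {l} hl x => ?_⟩
  · rw [mem_subdifferential_real] at hξ hη
    have h1 := hξ v
    have h2 := hη u
    rw [← neg_sub u v, inner_neg_right] at h1
    rw [inner_sub_left]
    linarith
  · -- an affine lower bound from lower semicontinuity at `0` and convexity
    obtain ⟨r, hr, hball⟩ : ∃ r > 0, ∀ u, ‖u‖ ≤ r → f 0 - 1 < f u := by
      have := hlsc 0 (f 0 - 1) (by linarith)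
      obtain ⟨r, hr, h⟩ := Metric.eventually_nhds_iff.1 this
      refine ⟨r / 2, by positivity, fun u hu => h ?_⟩
      rw [dist_zero_right]; linarith
    have hlow : ∀ u, -(1 / r) * ‖u‖ - (1 - f 0) ≤ f u := by
      intro u
      by_cases hu : ‖u‖ ≤ r
      · have := hball u hu
        have : 0 ≤ 1 / r * ‖u‖ := by positivity
        linarith
      · push Not at hu
        have hu0 : 0 < ‖u‖ := hr.trans hu
        have hθ1 : r / ‖u‖ ≤ 1 := by rw [div_le_one hu0]; exact hu.le
        have h1 := hcv.2 (mem_univ (0 : X)) (mem_univ u) (sub_nonneg.2 hθ1)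
          (show 0 ≤ r / ‖u‖ by positivity) (by ring)
        have h2 := hball ((1 - r / ‖u‖) • (0 : X) + (r / ‖u‖) • u) (by
          rw [smul_zero, zero_add, norm_smul, Real.norm_eq_abs, abs_of_pos (by positivity),
            div_mul_cancel₀ _ hu0.ne'])
        simp only [smul_eq_mul] at h1
        have h3 := h2.trans_le h1
        have h4 : (‖u‖ / r) * (f 0 - 1) < (‖u‖ / r) * ((1 - r / ‖u‖) * f 0 + r / ‖u‖ * f u) :=
          mul_lt_mul_of_pos_left h3 (by positivity)
        have h5 : (‖u‖ / r) * ((1 - r / ‖u‖) * f 0 + r / ‖u‖ * f u)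
            = ‖u‖ / r * f 0 - f 0 + f u := by field_simp
        rw [h5] at h4
        have h6 : -(1 / r) * ‖u‖ = -(‖u‖ / r) := by ring
        linarith
    let E : Set (X × ℝ) := {p | f p.1 ≤ p.2}
    obtain ⟨p, hp, hmin⟩ := exists_epigraph_minimizer (E := E) (a := 1 / r) (b := 1 - f 0)
      hlsc.isClosed_epigraph (by simpa [E] using hcv.convex_epigraph) ⟨(0, f 0), le_refl (f 0)⟩
      (by positivity) (fun p hp => (hlow p.1).trans hp) hl x
    refine ⟨p.1, l⁻¹ • (x - p.1), ?_, ?_⟩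
    · rw [mem_subdifferential_real]
      intro w
      have := hmin (w, f w) (le_refl (f w))
      have hp' : f p.1 ≤ p.2 := hp
      simp only at this
      linarith
    · rw [smul_smul, mul_inv_cancel₀ hl.ne', one_smul, add_sub_cancel]

variable {b : ℝ → ℝ≥0∞}

/-- Comparison with the point `0`, where `b` is finite, forces `b r < ⊤`; afterwards the inequality
is one between reals, and it is trivial where `b s = ⊤`. -/
theorem mem_betaGraph (hb0 : b 0 = 0) {r v : ℝ} :
    v ∈ betaGraph b r ↔ b r < ⊤ ∧ ∀ s, b s < ⊤ → (b r).toReal + v * (s - r) ≤ (b s).toReal := by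
  have hcoe : ∀ r, b r < ⊤ → ((b r : ℝ≥0∞) : EReal) = ((b r).toReal : ℝ) := fun r hr =>
    (EReal.coe_ennreal_toReal hr.ne).symm
  simp only [betaGraph, subdifferential, mem_ofPred_eq]
  constructor
  · intro h
    have hr : b r < ⊤ := by
      by_contra hr
      have h1 := h 0
      rw [not_lt_top_iff.1 hr, hb0, EReal.coe_ennreal_top, EReal.top_add_coe] at h1
      simp at h1
    refine ⟨hr, fun s hs => ?_⟩
    have h1 := h s
    rw [hcoe r hr, hcoe s hs] at h1
    norm_cast at h1
    simpa [mul_comm] using h1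
  · rintro ⟨hr, h⟩ s
    by_cases hs : b s < ⊤
    · rw [hcoe r hr, hcoe s hs]
      norm_cast
      simpa [mul_comm] using h s hs
    · rw [not_lt_top_iff.1 hs, EReal.coe_ennreal_top]
      exact le_top

theorem zero_mem_betaGraph (hb0 : b 0 = 0) : (0 : ℝ) ∈ betaGraph b 0 := by
  rw [mem_betaGraph hb0]
  simp [hb0]

theorem isMaximalMonotone_betaGraph (hcv : ConvexOn ℝ≥0 univ b) (hlsc : LowerSemicontinuous b)
    (hb0 : b 0 = 0) : IsMaximalMonotone (betaGraph b) := by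
  refine ⟨fun {u v ξ η} hξ hη => ?_, fun {l} hl x => ?_⟩
  · rw [mem_betaGraph hb0] at hξ hη
    have h1 := hξ.2 v hη.1
    have h2 := hη.2 u hξ.1
    simp only [RCLike.inner_apply, conj_trivial]
    nlinarith
  · let E : Set (ℝ × ℝ) := {p | 0 ≤ p.2 ∧ b p.1 ≤ ENNReal.ofReal p.2}
    have hcl : IsClosed E := by
      refine (isClosed_le continuous_const continuous_snd).inter ?_
      have h1 : Continuous fun p : ℝ × ℝ => (p.1, ENNReal.ofReal p.2) :=
        continuous_fst.prodMk (ENNReal.continuous_ofReal.comp continuous_snd)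
      exact hlsc.isClosed_epigraph.preimage h1
    have hconv : Convex ℝ E := by
      rintro p ⟨hp0, hp⟩ q ⟨hq0, hq⟩ θ σ hθ hσ hsum
      refine ⟨by simp only [Prod.snd_add, Prod.smul_snd, smul_eq_mul]; positivity, ?_⟩
      have h1 := hcv.2 (mem_univ p.1) (mem_univ q.1) (zero_le (a := θ.toNNReal))
        (zero_le (a := σ.toNNReal)) (by rw [← Real.toNNReal_add hθ hσ, hsum, Real.toNNReal_one])
      have h2 : (θ • p + σ • q).1 = θ.toNNReal • p.1 + σ.toNNReal • q.1 := by
        simp [NNReal.smul_def, hθ, hσ]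
      rw [h2]
      refine h1.trans ?_
      simp only [Prod.snd_add, Prod.smul_snd, smul_eq_mul]
      rw [ENNReal.ofReal_add (by positivity) (by positivity), ENNReal.ofReal_mul hθ,
        ENNReal.ofReal_mul hσ]
      simp only [ENNReal.smul_def, smul_eq_mul]
      gcongr <;> exact le_rfl
    obtain ⟨p, hp, hmin⟩ := exists_epigraph_minimizer (E := E) (a := 0) (b := 0)
      hcl hconv ⟨(0, 0), by simp [E, hb0]⟩ le_rfl (fun p hp => by simpa using hp.1) hl x
    have hfin : b p.1 < ⊤ := hp.2.trans_lt ENNReal.ofReal_lt_top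
    have hle : (b p.1).toReal ≤ p.2 := ENNReal.toReal_le_of_le_ofReal hp.1 hp.2
    refine ⟨p.1, l⁻¹ • (x - p.1), (mem_betaGraph hb0).2 ⟨hfin, fun s hs => ?_⟩, ?_⟩
    · have := hmin (s, (b s).toReal) ⟨ENNReal.toReal_nonneg, (ENNReal.ofReal_toReal hs.ne).ge⟩
      simp only [RCLike.inner_apply, conj_trivial] at this
      linarith
    · rw [smul_smul, mul_inv_cancel₀ hl.ne', one_smul, add_sub_cancel]

/-- The Moreau regularisation of `b`. -/
noncomputable def moreau (b : ℝ → ℝ≥0∞) (l r : ℝ) : ℝ :=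
  (b (resolvent (betaGraph b) l r)).toReal + l / 2 * yosida (betaGraph b) l r ^ 2

theorem moreau_nonneg {l : ℝ} (hl : 0 < l) (r : ℝ) : 0 ≤ moreau b l r := by
  unfold moreau; positivity

section Moreau
variable (hG : IsMaximalMonotone (betaGraph b)) (hb0 : b 0 = 0) {l : ℝ} (hl : 0 < l)
include hG hb0 hl

theorem resolvent_betaGraph_zero : resolvent (betaGraph b) l 0 = 0 := by
  simpa using hG.resolvent_eq hl (zero_mem_betaGraph hb0)

theorem yosida_betaGraph_zero : yosida (betaGraph b) l 0 = 0 := by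
  rw [yosida, resolvent_betaGraph_zero hG hb0 hl]
  simp

/-- Use the subgradient inequality of `b` between the two resolvents and add the square `l / 2 * (z
- y) ^ 2 ≥ 0` of the difference of the Yosida values. -/
theorem moreau_add_le (r s : ℝ) :
    moreau b l r + inner ℝ (yosida (betaGraph b) l r) (s - r) ≤ moreau b l s := by
  have h1 := (mem_betaGraph hb0).1 (hG.yosida_mem hl r)
  have h2 := (mem_betaGraph hb0).1 (hG.yosida_mem hl s)
  have h3 := h1.2 _ h2.1
  have e1 := IsMaximalMonotone.resolvent_add_yosida (G := betaGraph b) hl r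
  have e2 := IsMaximalMonotone.resolvent_add_yosida (G := betaGraph b) hl s
  simp only [RCLike.inner_apply, conj_trivial, smul_eq_mul, moreau] at *
  set y := yosida (betaGraph b) l r
  set z := yosida (betaGraph b) l s
  have h4 : 0 ≤ l / 2 * (z - y) ^ 2 := by positivity
  have e3 : s - r = (resolvent (betaGraph b) l s - resolvent (betaGraph b) l r) + l * (z - y) := by
    linarith
  rw [e3]
  nlinarith

theorem moreau_le {r : ℝ} (hr : b r < ⊤) : moreau b l r ≤ (b r).toReal := by
  have h1 := ((mem_betaGraph hb0).1 (hG.yosida_mem hl r)).2 r hr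
  have e1 := IsMaximalMonotone.resolvent_add_yosida (G := betaGraph b) hl r
  rw [smul_eq_mul] at e1
  have e2 : r - resolvent (betaGraph b) l r = l * yosida (betaGraph b) l r := by linarith
  rw [e2] at h1
  unfold moreau
  nlinarith [mul_nonneg hl.le (sq_nonneg (yosida (betaGraph b) l r))]

/-- The subgradient inequality from `r` to `0`, where the regularisation vanishes, combined with the
Lipschitz constant `l⁻¹`. It makes the integral functional finite on all of `L²`. -/
theorem moreau_le_sq (r : ℝ) : moreau b l r ≤ l⁻¹ * r ^ 2 := by
  have h1 := moreau_add_le hG hb0 hl r 0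
  have h2 : moreau b l 0 = 0 := by
    rw [moreau, resolvent_betaGraph_zero hG hb0 hl, yosida_betaGraph_zero hG hb0 hl, hb0]; simp
  have h3 := hG.norm_yosida_sub_le hl r 0
  rw [yosida_betaGraph_zero hG hb0 hl, sub_zero, sub_zero, Real.norm_eq_abs, Real.norm_eq_abs] at h3
  simp only [RCLike.inner_apply, conj_trivial, zero_sub] at h1
  have h4 : r * yosida (betaGraph b) l r ≤ |r| * |yosida (betaGraph b) l r| := by
    rw [← abs_mul]; exact le_abs_self _
  have h5 := mul_le_mul_of_nonneg_left h3 (abs_nonneg r)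
  rw [← sq_abs r]
  nlinarith

theorem continuous_moreau : Continuous (moreau b l) :=
  continuous_iff_continuousAt.2 fun r => (hasFDerivAt_of_subgradient (hG.lipschitzWith_yosida hl)
    (moreau_add_le hG hb0 hl) r).continuousAt

end Moreau

end Subdifferential

/-! ### Graphs on `L²` induced by graphs on `ℝ` -/

section SuperpositionGraph
variable {α : Type*} [MeasurableSpace α] {μ : Measure α}

/-- The graph of `L²(μ)` induced by a graph of `ℝ`. -/
def lpGraph (μ : Measure α) (G : ℝ → Set ℝ) (u : Lp ℝ 2 μ) : Set (Lp ℝ 2 μ) :=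
  {ξ | ∀ᵐ x ∂μ, ξ x ∈ G (u x)}

variable [IsFiniteMeasure μ] {G : ℝ → Set ℝ} (hG : IsMaximalMonotone G)
include hG

theorem lipComp_yosida_mem {l : ℝ} (hl : 0 < l) (f : Lp ℝ 2 μ) :
    lipComp (hG.lipschitzWith_yosida hl) f
      ∈ lpGraph μ G (lipComp (hG.lipschitzWith_resolvent hl) f) := by
  unfold lpGraph
  filter_upwards [coeFn_lipComp (hG.lipschitzWith_yosida hl) f,
    coeFn_lipComp (hG.lipschitzWith_resolvent hl) f] with x h1 h2
  rw [h1, h2]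
  exact hG.yosida_mem hl _

theorem lipComp_resolvent_add {l : ℝ} (hl : 0 < l) (f : Lp ℝ 2 μ) :
    lipComp (hG.lipschitzWith_resolvent hl) f + l • lipComp (hG.lipschitzWith_yosida hl) f = f := by
  refine Lp.ext ?_
  filter_upwards [coeFn_lipComp (hG.lipschitzWith_yosida hl) f,
    coeFn_lipComp (hG.lipschitzWith_resolvent hl) f,
    Lp.coeFn_add (lipComp (hG.lipschitzWith_resolvent hl) f)
      (l • lipComp (hG.lipschitzWith_yosida hl) f),
    Lp.coeFn_smul l (lipComp (hG.lipschitzWith_yosida hl) f)] with x h1 h2 h3 h4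
  rw [h3, Pi.add_apply, h4, Pi.smul_apply, h1, h2]
  exact IsMaximalMonotone.resolvent_add_yosida hl _

theorem isMaximalMonotone_lpGraph : IsMaximalMonotone (lpGraph μ G) := by
  refine ⟨fun {u v ξ η} hξ hη => ?_, fun {l} hl f => ?_⟩
  · rw [L2.inner_def]
    refine integral_nonneg_of_ae ?_
    filter_upwards [hξ, hη, Lp.coeFn_sub u v, Lp.coeFn_sub ξ η] with x h1 h2 h3 h4
    rw [h3, h4]
    exact hG.monotone h1 h2
  · exact ⟨_, _, lipComp_yosida_mem hG hl f, lipComp_resolvent_add hG hl f⟩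

/-- The pointwise resolvent solves the resolvent equation in `L²`, whose solution is unique. -/
theorem resolvent_lpGraph {l : ℝ} (hl : 0 < l) (f : Lp ℝ 2 μ) :
    resolvent (lpGraph μ G) l f = lipComp (hG.lipschitzWith_resolvent hl) f := by
  conv_lhs => rw [← lipComp_resolvent_add hG hl f]
  exact (isMaximalMonotone_lpGraph hG).resolvent_eq hl (lipComp_yosida_mem hG hl f)

theorem yosida_lpGraph {l : ℝ} (hl : 0 < l) (f : Lp ℝ 2 μ) :
    yosida (lpGraph μ G) l f = lipComp (hG.lipschitzWith_yosida hl) f := by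
  rw [yosida, resolvent_lpGraph hG hl, inv_smul_eq_iff₀ hl.ne', sub_eq_iff_eq_add',
    lipComp_resolvent_add hG hl]

end SuperpositionGraph

/-- The Moreau regularisations on `L²` of an integral functional. -/
theorem exists_lpGraph_energy {α : Type*} [MeasurableSpace α] {μ : Measure α} [IsFiniteMeasure μ]
    {b : ℝ → ℝ≥0∞} (hG : IsMaximalMonotone (betaGraph b)) (hlsc : LowerSemicontinuous b)
    (hb0 : b 0 = 0)
    (φ₀ : Lp ℝ 2 μ) (hφ₀ : ∫⁻ x, b (φ₀ x) ∂μ < ⊤) :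
    ∀ l, 0 < l → ∃ e : Lp ℝ 2 μ → ℝ, (∀ u, 0 ≤ e u) ∧ e φ₀ ≤ (∫⁻ x, b (φ₀ x) ∂μ).toReal ∧
      ∀ u v, e u + inner ℝ (yosida (lpGraph μ (betaGraph b)) l u) (v - u) ≤ e v := by
  intro l hl
  have hint : ∀ u : Lp ℝ 2 μ, Integrable (fun x => moreau b l (u x)) μ := fun u => by
    refine Integrable.mono' (((Lp.memLp u).integrable_sq).const_mul l⁻¹)
      ((continuous_moreau hG hb0 hl).comp_aestronglyMeasurable (Lp.aestronglyMeasurable u))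
      (Eventually.of_forall fun x => ?_)
    rw [Real.norm_eq_abs, abs_of_nonneg (moreau_nonneg hl _)]
    exact moreau_le_sq hG hb0 hl _
  refine ⟨fun u => ∫ x, moreau b l (u x) ∂μ, fun u => integral_nonneg fun x => moreau_nonneg hl _,
    ?_, fun u v => ?_⟩
  · have hmeas : AEMeasurable (fun x => b (φ₀ x)) μ :=
      hlsc.measurable.comp_aemeasurable (Lp.aestronglyMeasurable φ₀).aemeasurable
    have hfin : ∀ᵐ x ∂μ, b (φ₀ x) < ⊤ := ae_lt_top' hmeas hφ₀.ne
    rw [← integral_toReal hmeas hfin]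
    refine integral_mono_ae (hint φ₀) (integrable_toReal_of_lintegral_ne_top hmeas hφ₀.ne) ?_
    filter_upwards [hfin] with x hx
    exact moreau_le hG hb0 hl hx
  · rw [yosida_lpGraph hG hl, L2.inner_def, ← integral_add (hint u) (L2.integrable_inner _ _)]
    refine integral_mono_ae ((hint u).add (L2.integrable_inner _ _)) (hint v) ?_
    filter_upwards [coeFn_lipComp (hG.lipschitzWith_yosida hl) u, Lp.coeFn_sub v u] with x h1 h2
    simp only [h1, h2, Pi.sub_apply]
    exact moreau_add_le hG hb0 hl _ _

/-! ### Test functions -/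

section TestFunctions
variable {E : Type*} [NormedAddCommGroup E] [NormedSpace ℝ E] {O : Set E}

theorem isTestFunction_zero : IsTestFunction O (fun _ : E => (0 : ℝ)) :=
  ⟨contDiff_const, HasCompactSupport.zero, by
    rw [show (fun _ : E => (0 : ℝ)) = 0 from rfl, tsupport_zero]; exact empty_subset _⟩

theorem _root_.CahnHilliard.IsTestFunction.add {ψ η : E → ℝ} (hψ : IsTestFunction O ψ) (hη : IsTestFunction O η) :
    IsTestFunction O (ψ + η) :=
  ⟨hψ.contDiff.add hη.contDiff, hψ.hasCompactSupport.add hη.hasCompactSupport,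
    (tsupport_add ψ η).trans (union_subset hψ.tsupport_subset hη.tsupport_subset)⟩

theorem _root_.CahnHilliard.IsTestFunction.smul {ψ : E → ℝ} (hψ : IsTestFunction O ψ) (c : ℝ) :
    IsTestFunction O (c • ψ) :=
  ⟨contDiff_const.smul hψ.contDiff, hψ.hasCompactSupport.smul_left (f := fun _ => c),
    (tsupport_smul_subset_right (fun _ => c) ψ).trans hψ.tsupport_subset⟩

theorem _root_.CahnHilliard.IsTestFunction.mul_left {ψ η : E → ℝ} (hψ : IsTestFunction O ψ) (hη : ContDiff ℝ ∞ η) :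
    IsTestFunction O (η * ψ) :=
  ⟨hη.mul hψ.contDiff, hψ.hasCompactSupport.mul_left,
    (tsupport_mul_subset_right).trans hψ.tsupport_subset⟩

theorem _root_.CahnHilliard.IsTestFunction.translate {Ω : Set E} {ψ : E → ℝ} (hψ : IsTestFunction O ψ) (z : E)
    (h : ∀ x ∈ tsupport ψ, x + z ∈ Ω) : IsTestFunction Ω (fun x => ψ (x - z)) := by
  have e : (fun x => ψ (x - z)) = ψ ∘ (Homeomorph.addRight (-z)) := by
    ext x; simp [sub_eq_add_neg]
  refine ⟨hψ.contDiff.comp (contDiff_id.sub contDiff_const), ?_, ?_⟩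
  · rw [e]; exact hψ.hasCompactSupport.comp_homeomorph _
  · rw [e, tsupport_comp_eq_preimage]
    intro x hx
    have := h _ hx
    simpa using this

end TestFunctions

/-! ### Duality with test functions -/

section Density
variable {E : Type*} [NormedAddCommGroup E] [NormedSpace ℝ E] [FiniteDimensional ℝ E]
  [MeasurableSpace E] [BorelSpace E] {μ : Measure E} [IsLocallyFiniteMeasure μ] {O : Set E}

/-- An `L²` bound obtained by duality with test functions. -/
theorem eLpNorm_le_of_testFunctions (hO : IsOpen O) {f : E → ℝ}
    (hf : MemLp f 2 (μ.restrict O)) {C : ℝ} (hC : 0 ≤ C)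
    (h : ∀ ψ, IsTestFunction O ψ → |∫ x in O, f x * ψ x ∂μ|
      ≤ C * (eLpNorm ψ 2 (μ.restrict O)).toReal) :
    eLpNorm f 2 (μ.restrict O) ≤ ENNReal.ofReal C := by
  have hmem : ∀ ψ : E → ℝ, IsTestFunction O ψ → MemLp ψ 2 (μ.restrict O) := fun ψ hψ =>
    hψ.contDiff.continuous.memLp_of_hasCompactSupport hψ.hasCompactSupport
  let D : Submodule ℝ (Lp ℝ 2 (μ.restrict O)) :=
    { carrier := {v | ∃ ψ, IsTestFunction O ψ ∧ v =ᵐ[μ.restrict O] ψ}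
      zero_mem' := ⟨_, isTestFunction_zero, Lp.coeFn_zero _ _ _⟩
      add_mem' := by
        rintro v w ⟨ψ, hψ, hv⟩ ⟨η, hη, hw⟩
        exact ⟨_, hψ.add hη, (Lp.coeFn_add v w).trans (hv.add hw)⟩
      smul_mem' := by
        rintro c v ⟨ψ, hψ, hv⟩
        exact ⟨_, hψ.smul c, (Lp.coeFn_smul c v).trans (hv.const_smul c)⟩ }
  -- A function orthogonal to all test functions vanishes by the fundamental lemma of the calculus
  -- of variations. The bound then extends to all of `L²` by continuity, and is applied to `f`
  -- itself.
  have hD : D.topologicalClosure = ⊤ := by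
    rw [Submodule.topologicalClosure_eq_top_iff, Submodule.eq_bot_iff]
    intro v hv
    rw [Submodule.mem_orthogonal] at hv
    have hloc : LocallyIntegrableOn v O μ := by
      have : LocallyIntegrable v (μ.restrict O) := (Lp.memLp v).locallyIntegrable (by norm_num)
      exact locallyIntegrableOn_of_locallyIntegrable_restrict this
    have hz := hO.ae_eq_zero_of_integral_contDiff_smul_eq_zero hloc (fun ψ h1 h2 h3 => by
      have hψ : IsTestFunction O ψ := ⟨h1, h2, h3⟩
      have e1 := hv ((hmem ψ hψ).toLp ψ) ⟨ψ, hψ, MemLp.coeFn_toLp _⟩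
      rw [L2.inner_def] at e1
      have h0 : ∀ x, x ∉ O → ψ x • v x = 0 := fun x hx => by
        rw [image_eq_zero_of_notMem_tsupport fun h => hx (h3 h), zero_smul]
      rw [← setIntegral_eq_integral_of_forall_compl_eq_zero h0, ← e1]
      refine integral_congr_ae ?_
      filter_upwards [MemLp.coeFn_toLp (hmem ψ hψ)] with x hx
      rw [hx]
      simp [mul_comm])
    rw [Lp.eq_zero_iff_ae_eq_zero]
    exact (ae_restrict_iff' hO.measurableSet).2 hz
  have key : ∀ v : Lp ℝ 2 (μ.restrict O), |inner ℝ (hf.toLp f) v| ≤ C * ‖v‖ := by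
    have hcl : IsClosed {v : Lp ℝ 2 (μ.restrict O) | |inner ℝ (hf.toLp f) v| ≤ C * ‖v‖} :=
      isClosed_le (by fun_prop) (by fun_prop)
    have hsub : (D : Set (Lp ℝ 2 (μ.restrict O)))
        ⊆ {v | |inner ℝ (hf.toLp f) v| ≤ C * ‖v‖} := by
      rintro v ⟨ψ, hψ, hv⟩
      have e1 := h ψ hψ
      have e2 : inner ℝ (hf.toLp f) v = ∫ x in O, f x * ψ x ∂μ := by
        rw [L2.inner_def]
        refine integral_congr_ae ?_
        filter_upwards [MemLp.coeFn_toLp hf, hv] with x h1 h2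
        rw [h1, h2]
        simp [mul_comm]
      have e3 : ‖v‖ = (eLpNorm ψ 2 (μ.restrict O)).toReal := by
        rw [Lp.norm_def, eLpNorm_congr_ae hv]
      rw [mem_ofPred_eq, e2, e3]
      exact e1
    intro v
    have hv : v ∈ D.topologicalClosure := by rw [hD]; trivial
    exact closure_minimal hsub hcl hv
  have h1 := key (hf.toLp f)
  rw [real_inner_self_eq_norm_mul_norm, abs_of_nonneg (by positivity)] at h1
  have h2 : ‖hf.toLp f‖ ≤ C := by
    by_cases h0 : ‖hf.toLp f‖ = 0
    · rw [h0]; exact hC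
    · exact le_of_mul_le_mul_right h1 (lt_of_le_of_ne (norm_nonneg _) (Ne.symm h0))
  rw [Lp.norm_toLp] at h2
  exact (ENNReal.le_ofReal_iff_toReal_le hf.eLpNorm_ne_top hC).2 h2

end Density

/-! ### Translations of Sobolev functions -/

section Translation
variable {d : ℕ} {Ω : Set (EuclideanSpace ℝ (Fin d))}

/-- The component of a vector field in the direction `z`. -/
noncomputable def dirComp (z : EuclideanSpace ℝ (Fin d)) (G : L2Vec Ω) : L2 Ω :=
  (innerSL ℝ z).compLp G

theorem coeFn_dirComp (z : EuclideanSpace ℝ (Fin d)) (G : L2Vec Ω) :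
    dirComp z G =ᵐ[volume.restrict Ω] fun x => inner ℝ z (G x) :=
  (innerSL ℝ z).coeFn_compLp G

theorem norm_dirComp_le (z : EuclideanSpace ℝ (Fin d)) (G : L2Vec Ω) :
    ‖dirComp z G‖ ≤ ‖z‖ * ‖G‖ := by
  refine ((innerSL ℝ z).norm_compLp_le G).trans ?_
  rw [innerSL_apply_norm]

theorem dirComp_smul (c : ℝ) (z : EuclideanSpace ℝ (Fin d)) (G : L2Vec Ω) :
    dirComp (c • z) G = c • dirComp z G := by
  refine Lp.ext ?_
  filter_upwards [coeFn_dirComp (c • z) G, coeFn_dirComp z G, Lp.coeFn_smul c (dirComp z G)]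
    with x h1 h2 h3
  rw [h1, h3, Pi.smul_apply, h2, real_inner_smul_left, smul_eq_mul]

/-- The weak derivative in an arbitrary direction. -/
theorem integral_mul_fderiv_dir {u : L2 Ω} {G : L2Vec Ω} (h : HasWeakGradient Ω u G)
    {ψ : EuclideanSpace ℝ (Fin d) → ℝ} (hψ : IsTestFunction Ω ψ) (z : EuclideanSpace ℝ (Fin d)) :
    ∫ x in Ω, u x * fderiv ℝ ψ x z = -∫ x in Ω, dirComp z G x * ψ x := by
  have hz : z = ∑ i, z i • EuclideanSpace.single i (1 : ℝ) := by
    ext j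
    simp [Finset.sum_apply, Pi.single_apply]
  have e1 : ∀ x, u x * fderiv ℝ ψ x z
      = ∑ i, z i * (u x * fderiv ℝ ψ x (EuclideanSpace.single i 1)) := fun x => by
    conv_lhs => rw [hz]
    rw [map_sum, Finset.mul_sum]
    refine Finset.sum_congr rfl fun i _ => ?_
    rw [map_smul, smul_eq_mul]; ring
  have e2 : ∫ x in Ω, dirComp z G x * ψ x = ∫ x in Ω, ∑ i, z i * (G x i * ψ x) := by
    refine integral_congr_ae ?_
    filter_upwards [coeFn_dirComp z G] with x hx
    rw [hx, PiLp.inner_apply, Finset.sum_mul]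
    refine Finset.sum_congr rfl fun i _ => ?_
    simp; ring
  simp_rw [e1]
  rw [e2, integral_finsetSum _ fun i _ => (integrable_mul_fderiv hψ u _).const_mul _,
    integral_finsetSum _ fun i _ => (integrable_coord_mul hψ G i).const_mul _,
    ← Finset.sum_neg_distrib]
  refine Finset.sum_congr rfl fun i _ => ?_
  rw [integral_const_mul, integral_const_mul, h ψ hψ i]
  ring

/-- Extension by zero. -/
noncomputable def ext0 (Ω : Set (EuclideanSpace ℝ (Fin d))) (u : L2 Ω) :
    EuclideanSpace ℝ (Fin d) → ℝ := Ω.indicator u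

theorem memLp_ext0 (hΩ : MeasurableSet Ω) (u : L2 Ω) : MemLp (ext0 Ω u) 2 volume :=
  (memLp_indicator_iff_restrict hΩ).2 (Lp.memLp u)

theorem integral_ext0_mul (hΩ : MeasurableSet Ω) (u : L2 Ω)
    (f : EuclideanSpace ℝ (Fin d) → ℝ) : ∫ x, ext0 Ω u x * f x = ∫ x in Ω, u x * f x := by
  rw [← integral_indicator hΩ]
  congr 1
  ext x
  by_cases hx : x ∈ Ω <;> simp [ext0, hx]

theorem integrable_ext0 (hΩ : MeasurableSet Ω) [IsFiniteMeasure (volume.restrict Ω)] (u : L2 Ω) :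
    Integrable (ext0 Ω u) :=
  (integrable_indicator_iff hΩ).2 ((Lp.memLp u).integrable (by norm_num))

theorem hasDerivAt_integral_translate (hΩ : MeasurableSet Ω) [IsFiniteMeasure (volume.restrict Ω)]
    (u : L2 Ω) {O : Set (EuclideanSpace ℝ (Fin d))} {ψ : EuclideanSpace ℝ (Fin d) → ℝ}
    (hψ : IsTestFunction O ψ) (z : EuclideanSpace ℝ (Fin d)) (s : ℝ) :
    HasDerivAt (fun s : ℝ => ∫ x, ext0 Ω u x * ψ (x - s • z))
      (∫ x, ext0 Ω u x * -(fderiv ℝ ψ (x - s • z) z)) s := by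
  have hc : Continuous fun x => fderiv ℝ ψ x z :=
    (hψ.contDiff.continuous_fderiv (by simp)).clm_apply continuous_const
  obtain ⟨C, hC⟩ := (hψ.hasCompactSupport.fderiv_apply ℝ z).exists_bound_of_continuous hc
  have hint := integrable_ext0 hΩ u
  have hcs : ∀ s : ℝ, Continuous fun x => ψ (x - s • z) := fun s => by
    have := hψ.contDiff.continuous; fun_prop
  obtain ⟨C', hC'⟩ := hψ.hasCompactSupport.exists_bound_of_continuous hψ.contDiff.continuous
  refine (hasDerivAt_integral_of_dominated_loc_of_deriv_le (s := univ)
    (F := fun s x => ext0 Ω u x * ψ (x - s • z))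
    (F' := fun s x => ext0 Ω u x * -(fderiv ℝ ψ (x - s • z) z))
    (bound := fun x => ‖ext0 Ω u x‖ * C) univ_mem
    (Eventually.of_forall fun s => hint.aestronglyMeasurable.mul (hcs s).aestronglyMeasurable)
    ?_ (hint.aestronglyMeasurable.mul (Continuous.aestronglyMeasurable ?_))
    (Eventually.of_forall fun x s _ => ?_) (hint.norm.mul_const C)
    (Eventually.of_forall fun x s _ => ?_)).2
  · exact hint.mul_bdd (c := C') (hcs s).aestronglyMeasurable
      (Eventually.of_forall fun x => hC' _)
  · exact (hc.comp (continuous_id.sub continuous_const)).neg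
  · rw [norm_mul, norm_neg]
    gcongr
    exact hC _
  · have h1 : HasDerivAt (fun s : ℝ => x - s • z) (-z) s := by
      simpa using ((hasDerivAt_id s).smul_const z).const_sub x
    have h2 := (hψ.contDiff.differentiable (by simp) (x - s • z)).hasFDerivAt.comp_hasDerivAt s h1
    rw [map_neg] at h2
    exact h2.const_mul _

theorem integral_translate_sub (hΩ : MeasurableSet Ω) [IsFiniteMeasure (volume.restrict Ω)]
    (u : L2 Ω) {ψ : EuclideanSpace ℝ (Fin d) → ℝ} (hψc : Continuous ψ) (hψ : HasCompactSupport ψ)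
    (z : EuclideanSpace ℝ (Fin d)) :
    ∫ x, (ext0 Ω u (x + z) - ext0 Ω u x) * ψ x
      = (∫ x, ext0 Ω u x * ψ (x - z)) - ∫ x, ext0 Ω u x * ψ x := by
  obtain ⟨C', hC'⟩ := hψ.exists_bound_of_continuous hψc
  have hint := integrable_ext0 hΩ u
  have e : ∫ x, ext0 Ω u x * ψ (x - z) = ∫ x, ext0 Ω u (x + z) * ψ x := by
    rw [← integral_add_right_eq_self _ z]
    simp
  simp_rw [sub_mul]
  rw [e, integral_sub]
  · exact (hint.comp_add_right z).mul_bdd (c := C') hψc.aestronglyMeasurable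
      (Eventually.of_forall fun x => hC' _)
  · exact hint.mul_bdd (c := C') hψc.aestronglyMeasurable (Eventually.of_forall fun x => hC' _)

/-- The basic estimate for translations of Sobolev functions. -/
theorem eLpNorm_translate_sub_le (hΩ : MeasurableSet Ω) [IsFiniteMeasure (volume.restrict Ω)]
    {u : L2 Ω} {G : L2Vec Ω} (h : HasWeakGradient Ω u G) {O : Set (EuclideanSpace ℝ (Fin d))}
    (hO : IsOpen O) {z : EuclideanSpace ℝ (Fin d)}
    (hz : ∀ x ∈ O, ∀ s ∈ Icc (0 : ℝ) 1, x + s • z ∈ Ω) :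
    eLpNorm (fun x => ext0 Ω u (x + z) - ext0 Ω u x) 2 (volume.restrict O)
      ≤ ENNReal.ofReal ‖dirComp z G‖ := by
  have hm := memLp_ext0 hΩ u
  have hmt : MemLp (fun x => ext0 Ω u (x + z)) 2 volume :=
    hm.comp_measurePreserving (measurePreserving_add_right volume z)
  refine eLpNorm_le_of_testFunctions (f := fun x => ext0 Ω u (x + z) - ext0 Ω u x) hO ((hmt.sub hm).restrict O) (norm_nonneg _) fun ψ hψ => ?_
  have hψ0 : ∀ x, x ∉ O → ψ x = 0 := fun x hx =>
    image_eq_zero_of_notMem_tsupport fun h => hx (hψ.tsupport_subset h)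
  have e1 : ∫ x in O, (ext0 Ω u (x + z) - ext0 Ω u x) * ψ x
      = ∫ x, (ext0 Ω u (x + z) - ext0 Ω u x) * ψ x :=
    setIntegral_eq_integral_of_forall_compl_eq_zero fun x hx => by rw [hψ0 x hx, mul_zero]
  have e2 : (eLpNorm ψ 2 (volume.restrict O)) = eLpNorm ψ 2 volume := by
    rw [← eLpNorm_indicator_eq_eLpNorm_restrict hO.measurableSet]
    congr 1
    exact indicator_eq_self.2 fun x hx => by_contra fun hx' => hx (hψ0 x hx')
  rw [e1, e2, integral_translate_sub hΩ u hψ.contDiff.continuous hψ.hasCompactSupport z]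
  -- The translation is put on `ψ` and followed along the segment. The hypothesis `hz` keeps the
  -- support of each translate in `Ω`, so the weak gradient turns the derivative into a pairing with
  -- `dirComp z G`; the mean value inequality concludes.
  let F : ℝ → ℝ := fun s => ∫ x, ext0 Ω u x * ψ (x - s • z)
  have hF : ∀ s, HasDerivAt F (∫ x, ext0 Ω u x * -(fderiv ℝ ψ (x - s • z) z)) s :=
    hasDerivAt_integral_translate hΩ u hψ z
  have hbound : ∀ s ∈ Ico (0 : ℝ) 1, ‖∫ x, ext0 Ω u x * -(fderiv ℝ ψ (x - s • z) z)‖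
      ≤ ‖dirComp z G‖ * (eLpNorm ψ 2 volume).toReal := by
    intro s hs
    have hψs : IsTestFunction Ω (fun x => ψ (x - s • z)) :=
      hψ.translate (s • z) fun x hx => hz x (hψ.tsupport_subset hx) s ⟨hs.1, hs.2.le⟩
    have e3 := integral_mul_fderiv_dir h hψs z
    have e4 : ∀ x, fderiv ℝ (fun x => ψ (x - s • z)) x = fderiv ℝ ψ (x - s • z) := fun x =>
      fderiv_comp_sub (s • z)
    simp only [e4] at e3
    have hψL : MemLp (fun x => ψ (x - s • z)) 2 (volume.restrict Ω) := hψs.memLp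
    have e5 : ∫ x, ext0 Ω u x * -(fderiv ℝ ψ (x - s • z) z)
        = inner ℝ (dirComp z G) (hψL.toLp _) := by
      rw [integral_ext0_mul hΩ]
      simp_rw [mul_neg]
      rw [integral_neg, e3, neg_neg, L2.inner_def]
      refine integral_congr_ae ?_
      filter_upwards [MemLp.coeFn_toLp hψL] with x hx
      rw [hx]
      simp [mul_comm]
    rw [e5]
    refine (norm_inner_le_norm _ _).trans ?_
    gcongr
    rw [Lp.norm_toLp]
    refine ENNReal.toReal_mono (hψ.contDiff.continuous.memLp_of_hasCompactSupport
      hψ.hasCompactSupport).eLpNorm_ne_top ?_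
    refine (eLpNorm_mono_measure _ Measure.restrict_le_self).trans (le_of_eq ?_)
    have := eLpNorm_comp_measurePreserving (p := 2)
      hψ.contDiff.continuous.aestronglyMeasurable
      (measurePreserving_sub_right volume (s • z) (G := EuclideanSpace ℝ (Fin d)))
    exact this
  have := norm_image_sub_le_of_norm_deriv_le_segment_01' (f := F)
    (fun s _ => (hF s).hasDerivWithinAt) hbound
  simpa [F] using this

/-! ### Lipschitz contractions of Sobolev functions -/

theorem sq_norm_eq_sum_dirComp (G : L2Vec Ω) :
    ‖G‖ ^ 2 = ∑ i, ‖dirComp (EuclideanSpace.single i 1) G‖ ^ 2 := by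
  simp_rw [sq_norm_lp]
  rw [← integral_finsetSum _ fun i _ => (Lp.memLp _).norm.integrable_sq]
  refine integral_congr_ae ?_
  filter_upwards [ae_all_iff.2 fun i : Fin d => coeFn_dirComp (EuclideanSpace.single i 1) G]
    with x hx
  simp only [hx]
  rw [EuclideanSpace.norm_sq_eq]
  simp [EuclideanSpace.inner_single_left]

theorem exists_l2Vec_of_components (g : Fin d → L2 Ω) :
    ∃ G : L2Vec Ω, ∀ᵐ x ∂volume.restrict Ω, ∀ i, G x i = g i x := by
  have hm : MemLp (fun x => ∑ i, g i x • EuclideanSpace.single i (1 : ℝ)) 2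
      (volume.restrict Ω) :=
    memLp_finsetSum _ fun i _ => by
      have h1 := (ContinuousLinearMap.toSpanSingleton ℝ
        (EuclideanSpace.single i (1 : ℝ))).comp_memLp' (Lp.memLp (g i))
      simpa [Function.comp_def, ContinuousLinearMap.toSpanSingleton_apply] using h1
  refine ⟨hm.toLp _, ?_⟩
  filter_upwards [MemLp.coeFn_toLp hm] with x hx i
  rw [hx]
  simp [Finset.sum_apply, Pi.single_apply]

/-- A Lipschitz contraction of a Sobolev function has weak derivatives. -/
theorem exists_weak_deriv_of_contraction (hΩ : IsOpen Ω) [IsFiniteMeasure (volume.restrict Ω)]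
    {u : L2 Ω} {G : L2Vec Ω} (h : HasWeakGradient Ω u G) {g : ℝ → ℝ} (hg : LipschitzWith 1 g)
    (hg0 : g 0 = 0) (e : EuclideanSpace ℝ (Fin d)) :
    ∃ w : L2 Ω, ‖w‖ ≤ ‖dirComp e G‖ ∧ ∀ ψ, IsTestFunction Ω ψ →
      ∫ x in Ω, lipComp hg u x * fderiv ℝ ψ x e = -∫ x in Ω, w x * ψ x := by
  have hΩm := hΩ.measurableSet
  let v : L2 Ω := lipComp hg u
  -- Since `g 0 = 0`, extension by zero commutes with `g`.
  have hv : ∀ᵐ x, ext0 Ω v x = g (ext0 Ω u x) := by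
    have h1 := (ae_restrict_iff' hΩm).1 (coeFn_lipComp hg u)
    filter_upwards [h1] with x hx
    by_cases hxΩ : x ∈ Ω
    · simpa [ext0, hxΩ] using hx hxΩ
    · simp [ext0, hxΩ, hg0]
  let t : ℕ → ℝ := fun n => 1 / ((n : ℝ) + 1)
  have ht : ∀ n, 0 < t n := fun n => by positivity
  have ht0 : Tendsto t atTop (𝓝 0) := tendsto_one_div_add_atTop_nhds_zero_nat
  -- On these sets the whole segment used by the difference quotient stays in `Ω`; they eventually
  -- contain the support of any given test function.
  let O : ℕ → Set (EuclideanSpace ℝ (Fin d)) := fun n =>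
    interior {x | ∀ s ∈ Icc (0 : ℝ) 1, x + s • (t n • e) ∈ Ω}
  have hO : ∀ n, IsOpen (O n) := fun n => isOpen_interior
  have hOz : ∀ n, ∀ x ∈ O n, ∀ s ∈ Icc (0 : ℝ) 1, x + s • (t n • e) ∈ Ω := fun n x hx =>
    interior_subset hx
  have hOΩ : ∀ n, O n ⊆ Ω := fun n x hx => by simpa using hOz n x hx 0 (by simp)
  let q : ℕ → EuclideanSpace ℝ (Fin d) → ℝ := fun n =>
    (O n).indicator fun x => (t n)⁻¹ * (ext0 Ω v (x + t n • e) - ext0 Ω v x)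
  have hmv := memLp_ext0 hΩm v
  have hmt : ∀ n, MemLp (fun x => ext0 Ω v (x + t n • e) - ext0 Ω v x) 2 volume := fun n =>
    (hmv.comp_measurePreserving (measurePreserving_add_right volume (t n • e))).sub hmv
  have hq : ∀ n, MemLp (q n) 2 (volume.restrict Ω) := fun n =>
    (((hmt n).const_mul (t n)⁻¹).indicator (hO n).measurableSet).restrict Ω
  have hqn : ∀ n, ‖(hq n).toLp _‖ ≤ ‖dirComp e G‖ := by
    intro n
    rw [Lp.norm_toLp]
    refine ENNReal.toReal_le_of_le_ofReal (norm_nonneg _) ?_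
    -- The increments of `v` are dominated pointwise by those of `u`, to which the translation
    -- estimate applies. Thus no chain rule is needed to bound the weak limit of the difference
    -- quotients.
    have h1 : eLpNorm (fun x => ext0 Ω v (x + t n • e) - ext0 Ω v x) 2 (volume.restrict (O n))
        ≤ ENNReal.ofReal (t n * ‖dirComp e G‖) := by
      have h2 := eLpNorm_translate_sub_le hΩm h (hO n) (hOz n)
      rw [dirComp_smul, norm_smul, Real.norm_eq_abs, abs_of_pos (ht n)] at h2
      refine le_trans (eLpNorm_mono_ae (ae_restrict_of_ae ?_)) h2
      have h3 := (measurePreserving_add_right (volume : Measure (EuclideanSpace ℝ (Fin d)))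
        (t n • e)).quasiMeasurePreserving.ae hv
      filter_upwards [hv, h3] with x hx hx'
      rw [hx, hx', ← dist_eq_norm, ← dist_eq_norm]
      simpa using hg.dist_le_mul (ext0 Ω u (x + t n • e)) (ext0 Ω u x)
    calc eLpNorm (q n) 2 (volume.restrict Ω) ≤ eLpNorm (q n) 2 volume :=
          eLpNorm_mono_measure _ Measure.restrict_le_self
      _ = eLpNorm (fun x => (t n)⁻¹ * (ext0 Ω v (x + t n • e) - ext0 Ω v x)) 2
          (volume.restrict (O n)) := eLpNorm_indicator_eq_eLpNorm_restrict (hO n).measurableSet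
      _ = ENNReal.ofReal (t n)⁻¹ * eLpNorm (fun x => ext0 Ω v (x + t n • e) - ext0 Ω v x) 2
          (volume.restrict (O n)) := by
          have := eLpNorm_const_smul (t n)⁻¹ (fun x => ext0 Ω v (x + t n • e) - ext0 Ω v x) 2
            (volume.restrict (O n))
          rw [Real.enorm_of_nonneg (inv_pos.2 (ht n)).le] at this
          exact this
      _ ≤ ENNReal.ofReal (t n)⁻¹ * ENNReal.ofReal (t n * ‖dirComp e G‖) := by gcongr
      _ = ENNReal.ofReal ‖dirComp e G‖ := by
          rw [← ENNReal.ofReal_mul (inv_pos.2 (ht n)).le, ← mul_assoc,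
            inv_mul_cancel₀ (ht n).ne', one_mul]
  obtain ⟨w, hw, hwlim⟩ := exists_weak_limit (hyperfilter ℕ) hqn
  refine ⟨w, hw, fun ψ hψ => ?_⟩
  have hin : ∀ (f : L2 Ω), inner ℝ f (hψ.memLp.toLp ψ) = ∫ x in Ω, f x * ψ x := fun f => by
    rw [L2.inner_def]
    refine integral_congr_ae ?_
    filter_upwards [MemLp.coeFn_toLp hψ.memLp] with x hx
    rw [hx]
    simp [mul_comm]
  have h1 := hwlim (hψ.memLp.toLp ψ)
  rw [hin w] at h1
  -- the difference quotients of the pairing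
  let F : ℝ → ℝ := fun s => ∫ x, ext0 Ω v x * ψ (x - s • e)
  have hF := hasDerivAt_integral_translate hΩm v hψ e 0
  have hev : ∀ᶠ n in atTop, inner ℝ ((hq n).toLp _) (hψ.memLp.toLp ψ)
      = (t n)⁻¹ • (F (0 + t n) - F 0) := by
    obtain ⟨δ, hδ, hthick⟩ := hψ.hasCompactSupport.isCompact.exists_thickening_subset_open hΩ
      hψ.tsupport_subset
    have hsmall : ∀ᶠ n in atTop, t n * ‖e‖ < δ / 2 := by
      have : Tendsto (fun n => t n * ‖e‖) atTop (𝓝 0) := by simpa using ht0.mul_const ‖e‖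
      exact this.eventually_lt_const (by positivity)
    filter_upwards [hsmall] with n hn
    have hsub : tsupport ψ ⊆ O n := by
      refine (Metric.self_subset_thickening (half_pos hδ) _).trans
        (interior_maximal ?_ Metric.isOpen_thickening)
      intro x hx s hs
      obtain ⟨y, hy, hxy⟩ := Metric.mem_thickening_iff.1 hx
      refine hthick (Metric.mem_thickening_iff.2 ⟨y, hy, ?_⟩)
      have h3 : dist (x + s • (t n • e)) x ≤ t n * ‖e‖ := by
        rw [dist_eq_norm, add_sub_cancel_left, norm_smul, norm_smul, Real.norm_eq_abs,
          Real.norm_eq_abs, abs_of_nonneg hs.1, abs_of_pos (ht n)]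
        exact mul_le_of_le_one_left (by have := ht n; positivity) hs.2
      linarith [dist_triangle (x + s • (t n • e)) x y]
    rw [hin]
    have h4 : ∫ x in Ω, (hq n).toLp _ x * ψ x
        = ∫ x in Ω, (t n)⁻¹ * ((ext0 Ω v (x + t n • e) - ext0 Ω v x) * ψ x) := by
      refine integral_congr_ae ?_
      filter_upwards [MemLp.coeFn_toLp (hq n)] with x hx
      rw [hx]
      by_cases hxO : x ∈ O n
      · simp only [q, indicator_of_mem hxO]; ring
      · rw [image_eq_zero_of_notMem_tsupport fun h => hxO (hsub h)]; simp
    rw [h4, integral_const_mul, setIntegral_eq_integral_of_forall_compl_eq_zero (fun x hx => by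
      rw [image_eq_zero_of_notMem_tsupport fun h => hx (hψ.tsupport_subset h), mul_zero]),
      integral_translate_sub hΩm v hψ.contDiff.continuous hψ.hasCompactSupport]
    simp [F]
  have h2 : Tendsto (fun n => (t n)⁻¹ • (F (0 + t n) - F 0)) atTop
      (𝓝 (∫ x, ext0 Ω v x * -(fderiv ℝ ψ (x - (0 : ℝ) • e) e))) := by
    refine hF.tendsto_slope_zero.comp (tendsto_nhdsWithin_iff.2 ⟨ht0, ?_⟩)
    exact Eventually.of_forall fun n => (ht n).ne'
  have h5 := tendsto_nhds_unique h1 ((h2.congr' (hev.mono fun n hn => hn.symm)).mono_left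
    Nat.hyperfilter_le_atTop)
  rw [h5, integral_ext0_mul hΩm]
  simp [integral_neg, v]

/-- A Lipschitz contraction decreases the norm of the gradient. -/
theorem exists_gradient_of_contraction (hΩ : IsOpen Ω) [IsFiniteMeasure (volume.restrict Ω)]
    {u : L2 Ω} {G : L2Vec Ω} (h : HasWeakGradient Ω u G) {g : ℝ → ℝ} (hg : LipschitzWith 1 g)
    (hg0 : g 0 = 0) : ∃ G' : L2Vec Ω, HasWeakGradient Ω (lipComp hg u) G' ∧ ‖G'‖ ≤ ‖G‖ := by
  choose w hw hwd using fun i : Fin d =>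
    exists_weak_deriv_of_contraction hΩ h hg hg0 (EuclideanSpace.single i 1)
  obtain ⟨G', hG'⟩ := exists_l2Vec_of_components w
  refine ⟨G', fun ψ hψ i => ?_, ?_⟩
  · rw [hwd i ψ hψ]
    congr 1
    refine integral_congr_ae ?_
    filter_upwards [hG'] with x hx
    rw [hx i]
  · refine le_of_sq_le_sq ?_ (norm_nonneg _)
    rw [sq_norm_eq_sum_dirComp G, sq_norm_eq_sum_dirComp G']
    refine Finset.sum_le_sum fun i _ => pow_le_pow_left₀ (norm_nonneg _) ?_ 2
    refine le_trans (le_of_eq ?_) (hw i)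
    congr 1
    refine Lp.ext ?_
    filter_upwards [coeFn_dirComp (EuclideanSpace.single i 1) G', hG'] with x h1 h2
    rw [h1, ← h2 i, EuclideanSpace.inner_single_left]
    simp

end Translation

/-! ### The Poincaré–Wirtinger inequality -/

theorem eLpNorm_two_sq {α F : Type*} [MeasurableSpace α] [NormedAddCommGroup F] (μ : Measure α)
    (f : α → F) : eLpNorm f 2 μ ^ 2 = ∫⁻ x, ‖f x‖ₑ ^ 2 ∂μ := by
  have := eLpNorm_nnreal_pow_eq_lintegral (f := f) (μ := μ) (p := 2) (by norm_num)
  simpa using this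

section Poincare
variable {d : ℕ} {Ω : Set (EuclideanSpace ℝ (Fin d))}

/-- On `O`, Sobolev functions of `Ω` differ from a constant by at most a multiple of the gradient. -/
def PoincareOn (Ω O : Set (EuclideanSpace ℝ (Fin d))) : Prop :=
  ∃ C : ℝ≥0, ∀ (u : L2 Ω) (G : L2Vec Ω), HasWeakGradient Ω u G → ∃ c : ℝ,
    eLpNorm (fun x => ext0 Ω u x - c) 2 (volume.restrict O) ≤ C * ‖G‖ₑ

theorem PoincareOn.mono {O O' : Set (EuclideanSpace ℝ (Fin d))} (h : PoincareOn Ω O)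
    (hs : O' ⊆ O) : PoincareOn Ω O' := by
  obtain ⟨C, hC⟩ := h
  refine ⟨C, fun u G hu => ?_⟩
  obtain ⟨c, hc⟩ := hC u G hu
  exact ⟨c, (eLpNorm_mono_measure _ (Measure.restrict_mono hs le_rfl)).trans hc⟩

theorem measurable_ext0 (hΩ : MeasurableSet Ω) (u : L2 Ω) : Measurable (ext0 Ω u) :=
  (Lp.stronglyMeasurable u).measurable.indicator hΩ

/-- Integrate `|f y - f x| ^ 2` over the ball in both variables and put `y = x + z`: for fixed `z`
the translation estimate bounds the integral in `x`, and only `‖z‖ < 2 r` matters. Some `x` does no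
worse than the average, and `f x` is the constant. -/
theorem poincareOn_ball (hΩ : MeasurableSet Ω) [IsFiniteMeasure (volume.restrict Ω)]
    {x₀ : EuclideanSpace ℝ (Fin d)} {r : ℝ} (hr : 0 < r) (hB : Metric.ball x₀ r ⊆ Ω) :
    PoincareOn Ω (Metric.ball x₀ r) := by
  set B := Metric.ball x₀ r
  set m := volume B
  have hm0 : m ≠ 0 := (Metric.measure_ball_pos volume x₀ hr).ne'
  have hmt : m ≠ ⊤ := measure_ball_lt_top.ne
  set m' := volume (Metric.ball (0 : EuclideanSpace ℝ (Fin d)) (2 * r))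
  have hmt' : m' ≠ ⊤ := measure_ball_lt_top.ne
  set C2 : ℝ≥0∞ := m⁻¹ * m' * ENNReal.ofReal (2 * r) ^ 2 with hC2
  have hC2t : C2 ≠ ⊤ :=
    ENNReal.mul_ne_top (ENNReal.mul_ne_top (ENNReal.inv_ne_top.2 hm0) hmt')
      (ENNReal.pow_ne_top ENNReal.ofReal_ne_top)
  refine ⟨NNReal.sqrt C2.toNNReal, fun u G hu => ?_⟩
  set f := ext0 Ω u
  have hf : Measurable f := measurable_ext0 hΩ u
  have hk : Measurable fun p : EuclideanSpace ℝ (Fin d) × EuclideanSpace ℝ (Fin d) =>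
      B.indicator (fun y => ‖f y - f p.1‖ₑ ^ 2) (p.1 + p.2) := by
    have : (fun p : EuclideanSpace ℝ (Fin d) × EuclideanSpace ℝ (Fin d) =>
      B.indicator (fun y => ‖f y - f p.1‖ₑ ^ 2) (p.1 + p.2))
      = {p | p.1 + p.2 ∈ B}.indicator fun p => ‖f (p.1 + p.2) - f p.1‖ₑ ^ 2 := by
      ext p
      by_cases hp : p.1 + p.2 ∈ B <;> simp [hp]
    rw [this]
    refine Measurable.indicator ?_ (measurableSet_ball.preimage (by fun_prop))
    fun_prop
  have hdouble : ∫⁻ x in B, ∫⁻ y in B, ‖f y - f x‖ₑ ^ 2 ≤ m' * (ENNReal.ofReal (2 * r) * ‖G‖ₑ) ^ 2 := by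
    calc ∫⁻ x in B, ∫⁻ y in B, ‖f y - f x‖ₑ ^ 2
        = ∫⁻ x in B, ∫⁻ z, B.indicator (fun y => ‖f y - f x‖ₑ ^ 2) (x + z) := by
          refine lintegral_congr fun x => ?_
          rw [lintegral_add_left_eq_self (fun y => B.indicator (fun y => ‖f y - f x‖ₑ ^ 2) y) x,
            lintegral_indicator measurableSet_ball]
      _ = ∫⁻ z, ∫⁻ x in B, B.indicator (fun y => ‖f y - f x‖ₑ ^ 2) (x + z) :=
          lintegral_lintegral_swap hk.aemeasurable
      _ ≤ ∫⁻ z, (Metric.ball (0 : EuclideanSpace ℝ (Fin d)) (2 * r)).indicator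
            (fun _ => (ENNReal.ofReal (2 * r) * ‖G‖ₑ) ^ 2) z := by
          refine lintegral_mono fun z => ?_
          by_cases hz : z ∈ Metric.ball (0 : EuclideanSpace ℝ (Fin d)) (2 * r)
          · rw [indicator_of_mem hz]
            let O := B ∩ (fun x => x + z) ⁻¹' B
            have hO : IsOpen O := Metric.isOpen_ball.inter
              (Metric.isOpen_ball.preimage (by fun_prop))
            have e1 : ∫⁻ x in B, B.indicator (fun y => ‖f y - f x‖ₑ ^ 2) (x + z)
                = ∫⁻ x in O, ‖f (x + z) - f x‖ₑ ^ 2 := by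
              have e2 : ∀ x, B.indicator (fun y => ‖f y - f x‖ₑ ^ 2) (x + z)
                  = ((fun x => x + z) ⁻¹' B).indicator (fun x => ‖f (x + z) - f x‖ₑ ^ 2) x :=
                fun x => by
                  by_cases hx : x + z ∈ B
                  · rw [indicator_of_mem hx, indicator_of_mem (by exact hx)]
                  · rw [indicator_of_notMem hx, indicator_of_notMem (by exact hx)]
              simp_rw [e2]
              rw [lintegral_indicator (measurableSet_ball.preimage (by fun_prop)),
                Measure.restrict_restrict (measurableSet_ball.preimage (by fun_prop)), inter_comm]
            rw [e1, ← eLpNorm_two_sq]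
            have h3 := eLpNorm_translate_sub_le hΩ hu hO (z := z) fun x hx s hs => by
              have h4 := (convex_ball x₀ r) hx.1 hx.2 (sub_nonneg.2 hs.2) hs.1 (sub_add_cancel 1 s)
              refine hB ?_
              convert h4 using 1
              module
            gcongr
            refine h3.trans ?_
            rw [← ofReal_norm, ← ENNReal.ofReal_mul (by positivity)]
            refine ENNReal.ofReal_le_ofReal ((norm_dirComp_le z G).trans ?_)
            gcongr
            exact (mem_ball_zero_iff.1 hz).le
          · rw [indicator_of_notMem hz]
            refine le_of_eq ?_
            rw [setLIntegral_congr_fun measurableSet_ball (g := fun _ => 0), lintegral_zero]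
            intro x hx
            refine indicator_of_notMem (fun hxz => hz ?_) _
            rw [mem_ball_zero_iff]
            have h1 := mem_ball_iff_norm.1 hx
            have h2 := mem_ball_iff_norm.1 hxz
            have e : z = (x + z - x₀) - (x - x₀) := by abel
            rw [e]
            linarith [norm_sub_le (x + z - x₀) (x - x₀)]
      _ = _ := by
          rw [lintegral_indicator measurableSet_ball, setLIntegral_const, mul_comm]
  have hmeas : AEMeasurable (fun x => ∫⁻ y in B, ‖f y - f x‖ₑ ^ 2) (volume.restrict B) := by
    refine (Measurable.lintegral_prod_right' (f := fun p : EuclideanSpace ℝ (Fin d)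
      × EuclideanSpace ℝ (Fin d) => ‖f p.2 - f p.1‖ₑ ^ 2) ?_).aemeasurable
    fun_prop
  obtain ⟨x, hx, hle⟩ := exists_le_setLAverage hm0 hmt hmeas
  refine ⟨f x, ?_⟩
  rw [setLAverage_eq] at hle
  have h1 : eLpNorm (fun y => f y - f x) 2 (volume.restrict B) ^ 2
      ≤ (((NNReal.sqrt C2.toNNReal : ℝ≥0) : ℝ≥0∞) * ‖G‖ₑ) ^ 2 := by
    rw [eLpNorm_two_sq]
    refine hle.trans ?_
    rw [mul_pow, ← ENNReal.coe_pow, NNReal.sq_sqrt, ENNReal.coe_toNNReal hC2t, ENNReal.div_eq_inv_mul]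
    calc _ ≤ m⁻¹ * (m' * (ENNReal.ofReal (2 * r) * ‖G‖ₑ) ^ 2) := by gcongr
      _ = _ := by rw [hC2, mul_pow]; ring
  exact (ENNReal.pow_le_pow_left_iff two_ne_zero).1 h1

/-- Compare `f x` with `f (x + z)` by the translation estimate, and `f (x + z)` with the constant
belonging to `B`. This transfers the inequality from an interior ball to a piece touching the
boundary. -/
theorem PoincareOn.of_translate (hΩ : MeasurableSet Ω) [IsFiniteMeasure (volume.restrict Ω)]
    {O B : Set (EuclideanSpace ℝ (Fin d))} (h : PoincareOn Ω B) (hB : MeasurableSet B)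
    (hO : IsOpen O) {z : EuclideanSpace ℝ (Fin d)}
    (hz : ∀ x ∈ O, ∀ s ∈ Icc (0 : ℝ) 1, x + s • z ∈ Ω) (hOB : ∀ x ∈ O, x + z ∈ B) :
    PoincareOn Ω O := by
  obtain ⟨C, hC⟩ := h
  refine ⟨‖z‖₊ + C, fun u G hu => ?_⟩
  obtain ⟨c, hc⟩ := hC u G hu
  refine ⟨c, ?_⟩
  set f := ext0 Ω u
  have hf : Measurable f := measurable_ext0 hΩ u
  have h1 := eLpNorm_translate_sub_le hΩ hu hO hz
  have h2 : eLpNorm (fun x => f (x + z) - c) 2 (volume.restrict O) ≤ C * ‖G‖ₑ := by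
    refine le_trans ?_ hc
    have h3 := (measurePreserving_add_right (volume : Measure (EuclideanSpace ℝ (Fin d)))
      z).restrict_preimage hB
    have h4 := eLpNorm_comp_measurePreserving (p := 2) (g := fun x => f x - c)
      (by fun_prop) h3
    rw [← h4]
    exact eLpNorm_mono_measure _ (Measure.restrict_mono hOB le_rfl)
  have e : (fun x => f x - c) = (fun x => f (x + z) - c) - fun x => f (x + z) - f x := by
    ext x; simp
  have hfz : Measurable fun x => f (x + z) := hf.comp (measurable_add_const z)
  rw [e]
  refine (eLpNorm_sub_le (hfz.sub_const c).aestronglyMeasurable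
    (hfz.sub hf).aestronglyMeasurable (by norm_num)).trans ?_
  rw [add_comm, ENNReal.coe_add, add_mul]
  refine add_le_add (h1.trans ?_) h2
  rw [← ofReal_norm, ← enorm_eq_nnnorm, ← ofReal_norm,
    ← ENNReal.ofReal_mul (norm_nonneg _)]
  exact ENNReal.ofReal_le_ofReal (norm_dirComp_le z G)

/-- On the overlap, which has positive measure, `f` is close to both constants, so their difference
is bounded by the gradient and the first constant also serves on the second set. -/
theorem PoincareOn.union (hΩ : MeasurableSet Ω) {O₁ O₂ : Set (EuclideanSpace ℝ (Fin d))}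
    (h₁ : PoincareOn Ω O₁) (h₂ : PoincareOn Ω O₂) (hO₁ : IsOpen O₁) (hO₂ : IsOpen O₂)
    (hne : (O₁ ∩ O₂).Nonempty) (hfin : volume O₂ ≠ ⊤) : PoincareOn Ω (O₁ ∪ O₂) := by
  obtain ⟨C₁, hC₁⟩ := h₁
  obtain ⟨C₂, hC₂⟩ := h₂
  set a : ℝ≥0∞ := volume (O₁ ∩ O₂) ^ (1 / (2 : ℝ≥0∞).toReal) with ha
  set b : ℝ≥0∞ := volume O₂ ^ (1 / (2 : ℝ≥0∞).toReal) with hb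
  have ha0 : a ≠ 0 := by
    rw [ha, ne_eq, ENNReal.rpow_eq_zero_iff]
    have := ((hO₁.inter hO₂).measure_pos volume hne).ne'
    simp [this]
  have hat : a ≠ ⊤ := ENNReal.rpow_ne_top_of_nonneg (by positivity)
    (ne_top_of_le_ne_top hfin (measure_mono inter_subset_right))
  have hbt : b ≠ ⊤ := ENNReal.rpow_ne_top_of_nonneg (by positivity) hfin
  have hK : (C₁ + C₂) * a⁻¹ * b ≠ ⊤ :=
    ENNReal.mul_ne_top (ENNReal.mul_ne_top (by simp) (ENNReal.inv_ne_top.2 ha0)) hbt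
  refine ⟨C₁ + (((C₁ + C₂) * a⁻¹ * b).toNNReal + C₂), fun u G hu => ?_⟩
  obtain ⟨c₁, hc₁⟩ := hC₁ u G hu
  obtain ⟨c₂, hc₂⟩ := hC₂ u G hu
  refine ⟨c₁, ?_⟩
  set f := ext0 Ω u
  have hf : Measurable f := measurable_ext0 hΩ u
  have hdiff : ‖c₂ - c₁‖ₑ * a ≤ (C₁ + C₂) * ‖G‖ₑ := by
    have e1 := eLpNorm_const' (μ := volume.restrict (O₁ ∩ O₂)) (p := 2) (c₂ - c₁) (by norm_num)
      (by norm_num)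
    rw [Measure.restrict_apply_univ] at e1
    rw [ha, ← e1]
    have e2 : (fun _ : EuclideanSpace ℝ (Fin d) => c₂ - c₁)
        = (fun x => f x - c₁) - fun x => f x - c₂ := by ext x; simp
    rw [e2]
    refine (eLpNorm_sub_le (by fun_prop) (by fun_prop) (by norm_num)).trans ?_
    rw [add_mul]
    exact add_le_add
      ((eLpNorm_mono_measure _ (Measure.restrict_mono inter_subset_left le_rfl)).trans hc₁)
      ((eLpNorm_mono_measure _ (Measure.restrict_mono inter_subset_right le_rfl)).trans hc₂)
  have hdiff' : ‖c₂ - c₁‖ₑ * b ≤ (C₁ + C₂) * a⁻¹ * b * ‖G‖ₑ := by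
    calc ‖c₂ - c₁‖ₑ * b = ‖c₂ - c₁‖ₑ * a * a⁻¹ * b := by
          rw [mul_assoc ‖c₂ - c₁‖ₑ, ENNReal.mul_inv_cancel ha0 hat, mul_one]
      _ ≤ (C₁ + C₂) * ‖G‖ₑ * a⁻¹ * b := by gcongr
      _ = _ := by ring
  have h3 : eLpNorm (fun x => f x - c₁) 2 (volume.restrict O₂)
      ≤ ((C₁ + C₂) * a⁻¹ * b + C₂) * ‖G‖ₑ := by
    have e2 : (fun x => f x - c₁) = (fun _ => c₂ - c₁) + fun x => f x - c₂ := by ext x; simp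
    rw [e2]
    refine (eLpNorm_add_le (by fun_prop) (by fun_prop) (by norm_num)).trans ?_
    rw [add_mul, eLpNorm_const' _ (by norm_num) (by norm_num), Measure.restrict_apply_univ]
    exact add_le_add hdiff' hc₂
  have h4 : eLpNorm (fun x => f x - c₁) 2 (volume.restrict (O₁ ∪ O₂))
      ≤ eLpNorm (fun x => f x - c₁) 2 (volume.restrict O₁)
        + eLpNorm (fun x => f x - c₁) 2 (volume.restrict O₂) := by
    have hg : Measurable fun x => f x - c₁ := by fun_prop
    rw [← eLpNorm_indicator_eq_eLpNorm_restrict (hO₁.union hO₂).measurableSet,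
      ← eLpNorm_indicator_eq_eLpNorm_restrict hO₁.measurableSet,
      ← eLpNorm_indicator_eq_eLpNorm_restrict (f := fun x => f x - c₁) hO₂.measurableSet]
    have hm1 : Measurable (O₁.indicator fun x => f x - c₁) := hg.indicator hO₁.measurableSet
    have hm2 : Measurable (O₂.indicator fun x => f x - c₁) := hg.indicator hO₂.measurableSet
    rw [← eLpNorm_norm (O₁.indicator _), ← eLpNorm_norm (O₂.indicator _)]
    refine le_trans (eLpNorm_mono_real fun x => ?_) (eLpNorm_add_le
      hm1.norm.aestronglyMeasurable hm2.norm.aestronglyMeasurable (by norm_num))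
    by_cases hx1 : x ∈ O₁ <;> by_cases hx2 : x ∈ O₂ <;> simp [hx1, hx2]
  refine h4.trans ?_
  rw [ENNReal.coe_add, ENNReal.coe_add, ENNReal.coe_toNNReal hK, add_mul]
  exact add_le_add hc₁ h3

/-- At a boundary point, `ρ` decreases strictly along a direction in which its differential is
negative. A short shift in this direction keeps nearby points of `Ω` inside `Ω` and carries them
into a ball contained in `Ω`. -/
theorem exists_poincareOn_nhds (hΩ : IsSmoothBoundedDomain Ω)
    [IsFiniteMeasure (volume.restrict Ω)] {x₀ : EuclideanSpace ℝ (Fin d)} (hx₀ : x₀ ∈ closure Ω) :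
    ∃ W, IsOpen W ∧ x₀ ∈ W ∧ PoincareOn Ω (W ∩ Ω) := by
  have hΩo := hΩ.isOpen
  by_cases hxΩ : x₀ ∈ Ω
  · obtain ⟨r, hr, hB⟩ := Metric.isOpen_iff.1 hΩo x₀ hxΩ
    exact ⟨Metric.ball x₀ r, Metric.isOpen_ball, Metric.mem_ball_self hr,
      (poincareOn_ball hΩo.measurableSet hr hB).mono inter_subset_left⟩
  obtain ⟨U, hU, hxU, ρ, hρ, hdρ, hΩU⟩ := hΩ.smooth x₀ (by
    rw [frontier, hΩo.interior_eq]; exact ⟨hx₀, hxΩ⟩)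
  obtain ⟨e, he⟩ : ∃ e, fderiv ℝ ρ x₀ e < 0 := by
    obtain ⟨v, hv⟩ := DFunLike.ne_iff.1 hdρ
    rcases lt_or_gt_of_ne hv with h | h
    · exact ⟨v, by simpa using h⟩
    · exact ⟨-v, by simpa using h⟩
  have hcont : ContinuousOn (fun y => fderiv ℝ ρ y e) U :=
    (hρ.continuousOn_fderiv_of_isOpen hU (by simp)).clm_apply continuousOn_const
  have hev : ∀ᶠ y in 𝓝 x₀, y ∈ U ∧ fderiv ℝ ρ y e < 0 :=
    (hU.eventually_mem hxU).and
      ((hcont.continuousAt (hU.mem_nhds hxU)).tendsto.eventually_lt_const he)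
  obtain ⟨r₀, hr₀, hball⟩ := Metric.eventually_nhds_iff_ball.1 hev
  obtain ⟨h, hh, hhe⟩ : ∃ h : ℝ, 0 < h ∧ h * ‖e‖ < r₀ / 2 := by
    refine ⟨r₀ / 2 / (‖e‖ + 1), by positivity, ?_⟩
    rw [div_mul_eq_mul_div, div_lt_iff₀ (by positivity)]
    nlinarith [norm_nonneg e]
  set z := h • e with hz
  have hzn : ‖z‖ < r₀ / 2 := by rw [hz, norm_smul, Real.norm_eq_abs, abs_of_pos hh]; exact hhe
  have hin : ∀ x ∈ Metric.ball x₀ (r₀ / 2), ∀ s ∈ Icc (0 : ℝ) 1, x + s • z ∈ Metric.ball x₀ r₀ := by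
    intro x hx s hs
    rw [mem_ball_iff_norm] at hx ⊢
    have h1 : ‖s • z‖ ≤ ‖z‖ := by
      rw [norm_smul, Real.norm_eq_abs, abs_of_nonneg hs.1]
      exact mul_le_of_le_one_left (norm_nonneg _) hs.2
    have h2 : x + s • z - x₀ = (x - x₀) + s • z := by abel
    rw [h2]
    linarith [norm_add_le (x - x₀) (s • z)]
  have hanti : ∀ x ∈ Metric.ball x₀ (r₀ / 2), StrictAntiOn (fun s : ℝ => ρ (x + s • z)) (Icc 0 1) := by
    intro x hx
    have hd : ∀ s ∈ Icc (0 : ℝ) 1, HasDerivAt (fun s : ℝ => ρ (x + s • z))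
        (fderiv ℝ ρ (x + s • z) z) s := by
      intro s hs
      have h1 : HasDerivAt (fun s : ℝ => x + s • z) z s := by
        simpa using ((hasDerivAt_id s).smul_const z).const_add x
      have h2 : DifferentiableAt ℝ ρ (x + s • z) :=
        (hρ.contDiffAt (hU.mem_nhds (hball _ (hin x hx s hs)).1)).differentiableAt (by simp)
      exact h2.hasFDerivAt.comp_hasDerivAt s h1
    refine strictAntiOn_of_deriv_neg (convex_Icc 0 1)
      (fun s hs => (hd s hs).continuousAt.continuousWithinAt) fun s hs => ?_
    have hs' := interior_subset hs
    rw [(hd s hs').deriv, hz, map_smul, smul_eq_mul]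
    exact mul_neg_of_pos_of_neg hh (hball _ (hin x hx s hs')).2
  -- `x₀` is a limit of points of `Ω`, where `ρ < 0`; hence `ρ` is strictly negative after the
  -- shift.
  have hρ0 : ρ x₀ ≤ 0 := by
    have h1 : ContinuousAt ρ x₀ := (hρ.contDiffAt (hU.mem_nhds hxU)).continuousAt
    by_contra hpos
    push Not at hpos
    obtain ⟨y, ⟨hy1, hy2⟩, hyΩ⟩ := mem_closure_iff_nhds.1 hx₀ _
      (inter_mem (h1.tendsto.eventually_const_lt hpos) (hU.mem_nhds hxU))
    have h2 : y ∈ Ω ∩ U := ⟨hyΩ, hy2⟩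
    rw [hΩU] at h2
    exact lt_asymm h2.2 hy1
  have hx₀b : x₀ ∈ Metric.ball x₀ (r₀ / 2) := Metric.mem_ball_self (by positivity)
  have hz1 : x₀ + z ∈ Ω := by
    have h1 := hanti x₀ hx₀b (left_mem_Icc.2 zero_le_one) (right_mem_Icc.2 zero_le_one) one_pos
    simp only [one_smul, zero_smul, add_zero] at h1
    have h2 := (hball _ (hin x₀ hx₀b 1 (right_mem_Icc.2 zero_le_one))).1
    rw [one_smul] at h2
    have : x₀ + z ∈ Ω ∩ U := by rw [hΩU]; exact ⟨h2, h1.trans_le hρ0⟩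
    exact this.1
  obtain ⟨r₁, hr₁, hB⟩ := Metric.isOpen_iff.1 hΩo _ hz1
  refine ⟨Metric.ball x₀ (min (r₀ / 2) r₁), Metric.isOpen_ball,
    Metric.mem_ball_self (by positivity), ?_⟩
  refine (poincareOn_ball hΩo.measurableSet hr₁ hB).of_translate hΩo.measurableSet
    measurableSet_ball (Metric.isOpen_ball.inter hΩo) (z := z) ?_ ?_
  · rintro x ⟨hx, hxΩ⟩ s hs
    have hx' := Metric.ball_subset_ball (min_le_left _ _) hx
    have h1 := (hanti x hx').antitoneOn (left_mem_Icc.2 zero_le_one) hs hs.1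
    simp only [zero_smul, add_zero] at h1
    have h2 : x ∈ Ω ∩ U := ⟨hxΩ, by simpa using (hball _ (hin x hx' 0 (by simp))).1⟩
    rw [hΩU] at h2
    have : x + s • z ∈ Ω ∩ U := by
      rw [hΩU]; exact ⟨(hball _ (hin x hx' s hs)).1, h1.trans_lt h2.2⟩
    exact this.1
  · rintro x ⟨hx, -⟩
    have hx' := Metric.ball_subset_ball (min_le_right _ _) hx
    rw [mem_ball_iff_norm] at hx' ⊢
    simpa using hx'

/-- Cover the compact closure by finitely many good pieces and take a largest subfamily, containing
a fixed piece, whose union is good. Any other piece meeting this union could be added, so the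
remaining pieces are disjoint from it and connectedness shows that it is all of `Ω`. -/
theorem poincareOn_domain (hΩ : IsSmoothBoundedDomain Ω) [IsFiniteMeasure (volume.restrict Ω)] :
    PoincareOn Ω Ω := by
  classical
  have hΩo := hΩ.isOpen
  have hfin : ∀ O ⊆ Ω, volume O ≠ ⊤ := fun O hO =>
    ne_top_of_le_ne_top (hΩ.isBounded.measure_lt_top (μ := volume)).ne (measure_mono hO)
  choose! W hW hxW hP using fun x (hx : x ∈ closure Ω) => exists_poincareOn_nhds hΩ hx
  obtain ⟨t, ht, hcov⟩ := hΩ.isBounded.isCompact_closure.elim_nhds_subcover W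
    fun x hx => (hW x hx).mem_nhds (hxW x hx)
  let O : EuclideanSpace ℝ (Fin d) → Set (EuclideanSpace ℝ (Fin d)) := fun i => W i ∩ Ω
  have hO : ∀ i ∈ t, IsOpen (O i) := fun i hi => (hW i (ht i hi)).inter hΩo
  have hcovΩ : Ω ⊆ ⋃ i ∈ t, O i := fun x hx => by
    obtain ⟨i, hi, hxi⟩ := mem_iUnion₂.1 (hcov (subset_closure hx))
    exact mem_iUnion₂.2 ⟨i, hi, hxi, hx⟩
  obtain ⟨y, hy⟩ := hΩ.isConnected.nonempty
  obtain ⟨i₀, hi₀, hyi₀⟩ := mem_iUnion₂.1 (hcovΩ hy)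
  let 𝒮 : Finset (Finset (EuclideanSpace ℝ (Fin d))) :=
    t.powerset.filter fun s => i₀ ∈ s ∧ PoincareOn Ω (⋃ i ∈ s, O i)
  have h𝒮 : 𝒮.Nonempty := ⟨{i₀}, by
    simp only [𝒮, Finset.mem_filter, Finset.mem_powerset, Finset.singleton_subset_iff,
      Finset.mem_singleton, iUnion_iUnion_eq_left, true_and]
    exact ⟨hi₀, hP i₀ (ht i₀ hi₀)⟩⟩
  obtain ⟨s, hs, hmax⟩ := 𝒮.exists_max_image Finset.card h𝒮
  obtain ⟨hst, hi₀s, hPs⟩ : s ⊆ t ∧ i₀ ∈ s ∧ PoincareOn Ω (⋃ i ∈ s, O i) := by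
    simpa [𝒮] using hs
  have hAo : IsOpen (⋃ i ∈ s, O i) := isOpen_biUnion fun i hi => hO i (hst hi)
  have hBo : IsOpen (⋃ i ∈ t \ s, O i) :=
    isOpen_biUnion fun i hi => hO i (Finset.mem_sdiff.1 hi).1
  have hdisj : Disjoint (⋃ i ∈ s, O i) (⋃ i ∈ t \ s, O i) := by
    rw [Set.disjoint_iff_inter_eq_empty, ← not_nonempty_iff_eq_empty]
    rintro ⟨x, hxA, hxB⟩
    obtain ⟨j, hj, hxj⟩ := mem_iUnion₂.1 hxB
    obtain ⟨hjt, hjs⟩ := Finset.mem_sdiff.1 hj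
    have hun := hPs.union hΩo.measurableSet (hP j (ht j hjt)) hAo (hO j hjt) ⟨x, hxA, hxj⟩
      (hfin _ inter_subset_right)
    have hins : insert j s ∈ 𝒮 := by
      simp only [𝒮, Finset.mem_filter, Finset.mem_powerset]
      refine ⟨Finset.insert_subset hjt hst, Finset.mem_insert_of_mem hi₀s, ?_⟩
      rw [Finset.set_biUnion_insert, union_comm]
      exact hun
    have := hmax _ hins
    rw [Finset.card_insert_of_notMem hjs] at this
    omega
  refine hPs.mono (IsPreconnected.subset_left_of_subset_union hAo hBo hdisj ?_
    ⟨y, hy, mem_iUnion₂.2 ⟨i₀, hi₀s, hyi₀⟩⟩ hΩ.isConnected.isPreconnected)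
  intro x hx
  obtain ⟨i, hi, hxi⟩ := mem_iUnion₂.1 (hcovΩ hx)
  by_cases his : i ∈ s
  · exact Or.inl (mem_iUnion₂.2 ⟨i, his, hxi⟩)
  · exact Or.inr (mem_iUnion₂.2 ⟨i, Finset.mem_sdiff.2 ⟨hi, his⟩, hxi⟩)

/-- The Poincaré–Wirtinger inequality. -/
theorem exists_poincare_wirtinger (hΩ : IsSmoothBoundedDomain Ω) :
    ∃ C : ℝ, 0 ≤ C ∧ ∀ (u : L2 Ω) (G : L2Vec Ω), HasWeakGradient Ω u G → ∫ x in Ω, u x = 0 →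
      ‖u‖ ≤ C * ‖G‖ := by
  have : IsFiniteMeasure (volume.restrict Ω) :=
    ⟨by rw [Measure.restrict_apply_univ]; exact hΩ.isBounded.measure_lt_top⟩
  obtain ⟨C, hC⟩ := poincareOn_domain hΩ
  refine ⟨C, C.coe_nonneg, fun u G hu hmean => ?_⟩
  obtain ⟨c, hc⟩ := hC u G hu
  let k : L2 Ω := (memLp_const (μ := volume.restrict Ω) (p := 2) c).toLp _
  have h1 : ‖u - k‖ ≤ C * ‖G‖ := by
    rw [Lp.norm_def]
    refine ENNReal.toReal_le_of_le_ofReal (by positivity) ?_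
    rw [ENNReal.ofReal_mul C.coe_nonneg, ofReal_norm, ENNReal.ofReal_coe_nnreal]
    refine le_trans (le_of_eq (eLpNorm_congr_ae ?_)) hc
    filter_upwards [Lp.coeFn_sub u k, MemLp.coeFn_toLp (memLp_const (μ := volume.restrict Ω)
      (p := 2) c), ae_restrict_mem hΩ.isOpen.measurableSet] with x hx1 hx2 hx3
    rw [hx1, Pi.sub_apply, hx2, ext0, indicator_of_mem hx3]
  have h2 : inner ℝ u k = 0 := by
    rw [L2.inner_def]
    have : ∫ x in Ω, inner ℝ (u x) (k x) = ∫ x in Ω, c * u x := by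
      refine integral_congr_ae ?_
      filter_upwards [MemLp.coeFn_toLp (memLp_const (μ := volume.restrict Ω) (p := 2) c)] with x hx
      rw [hx]
      simp
    rw [this, integral_const_mul, hmean, mul_zero]
  -- Mean zero means orthogonality to constants, so subtracting `k` cannot reduce the norm.
  have h3 : ‖u‖ * ‖u‖ ≤ ‖u‖ * ‖u - k‖ := by
    rw [← real_inner_self_eq_norm_mul_norm]
    have : inner ℝ u u = inner ℝ u (u - k) := by rw [inner_sub_right, h2, sub_zero]
    rw [this]
    exact real_inner_le_norm _ _
  by_cases h0 : ‖u‖ = 0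
  · rw [h0]; positivity
  · exact (le_of_mul_le_mul_left h3 (lt_of_le_of_ne (norm_nonneg _) (Ne.symm h0))).trans h1

end Poincare

/-! ### Operators associated with Dirichlet forms -/

section Form
variable {H V K : Type*} [NormedAddCommGroup H] [InnerProductSpace ℝ H]
  [NormedAddCommGroup V] [InnerProductSpace ℝ V] [NormedAddCommGroup K] [InnerProductSpace ℝ K]

theorem sq_norm_half_add_le (x y : H) : ‖x‖ ^ 2 / 2 + inner ℝ x (y - x) ≤ ‖y‖ ^ 2 / 2 := by
  have := sq_nonneg ‖y - x‖
  rw [norm_sub_sq_real, real_inner_comm] at this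
  rw [inner_sub_right, real_inner_self_eq_norm_sq]
  linarith

/-- Lax–Milgram on the closed subspace `W`. The weights `a = 1, b = l` give resolvents of the form
operator, and `a = 0, b = 1` gives the potential. -/
theorem exists_coercive_solution [CompleteSpace V] {J : V →L[ℝ] H} {D : V →L[ℝ] K} {W : Submodule ℝ V}
    (hW : IsClosed (W : Set V)) {a b c : ℝ} (hc : 0 < c)
    (h : ∀ v ∈ W, c * ‖v‖ ^ 2 ≤ a * ‖J v‖ ^ 2 + b * ‖D v‖ ^ 2) :
    ∃ R : V →L[ℝ] V, ∀ f, R f ∈ W ∧ ∀ w ∈ W,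
      a * inner ℝ (J (R f)) (J w) + b * inner ℝ (D (R f)) (D w) = inner ℝ f w := by
  have : CompleteSpace W := hW.completeSpace_coe
  let B : W →L[ℝ] W →L[ℝ] ℝ :=
    a • (innerSL ℝ).bilinearComp (J.comp W.subtypeL) (J.comp W.subtypeL)
      + b • (innerSL ℝ).bilinearComp (D.comp W.subtypeL) (D.comp W.subtypeL)
  have hB : ∀ v w : W, B v w = a * inner ℝ (J v) (J w) + b * inner ℝ (D v) (D w) := fun v w => rfl
  have hco : IsCoercive B := ⟨c, hc, fun v => by
    rw [hB, real_inner_self_eq_norm_sq, real_inner_self_eq_norm_sq, mul_assoc, ← sq]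
    exact h v v.2⟩
  let E := hco.continuousLinearEquivOfBilin
  refine ⟨W.subtypeL.comp ((E.symm : W →L[ℝ] W).comp W.subtypeL.adjoint), fun f => ⟨?_, ?_⟩⟩
  · exact (E.symm (W.subtypeL.adjoint f)).2
  · intro w hw
    have h1 := hco.continuousLinearEquivOfBilin_apply (E.symm (W.subtypeL.adjoint f)) ⟨w, hw⟩
    rw [hB] at h1
    have h2 : E (E.symm (W.subtypeL.adjoint f)) = W.subtypeL.adjoint f := E.apply_symm_apply _
    change inner ℝ (E (E.symm (W.subtypeL.adjoint f))) _ = _ at h1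
    rw [h2, ContinuousLinearMap.adjoint_inner_left] at h1
    exact h1.symm

/-- The operator associated with the form `⟪D v, D w⟫` in the pivot space `H ⊇ J V`. -/
def formGraph (J : V →L[ℝ] H) (D : V →L[ℝ] K) (u : H) : Set H :=
  {α | ∃ v, J v = u ∧ ∀ w, inner ℝ (D v) (D w) = inner ℝ α (J w)}

variable {J : V →L[ℝ] H} {D : V →L[ℝ] K}
  (hV : ∀ v w : V, inner ℝ v w = inner ℝ (J v) (J w) + inner ℝ (D v) (D w))

include hV

theorem sq_norm_form (v : V) : ‖v‖ ^ 2 = ‖J v‖ ^ 2 + ‖D v‖ ^ 2 := by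
  rw [← real_inner_self_eq_norm_sq, hV, real_inner_self_eq_norm_sq, real_inner_self_eq_norm_sq]

theorem isMaximalMonotone_formGraph [CompleteSpace V] [CompleteSpace H] : IsMaximalMonotone (formGraph J D) := by
  refine ⟨?_, fun {l} hl f => ?_⟩
  · rintro _ _ ξ η ⟨v, rfl, hv⟩ ⟨w, rfl, hw⟩
    rw [← map_sub, inner_sub_left, ← hv, ← hw, ← inner_sub_left, ← map_sub]
    exact real_inner_self_nonneg
  · obtain ⟨R, hR⟩ := exists_coercive_solution (J := J) (D := D) (W := ⊤) isClosed_univ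
      (a := 1) (b := l) (c := min 1 l) (by positivity) fun v _ => by
        rw [sq_norm_form hV, mul_add]
        gcongr
        · exact min_le_left _ _
        · exact min_le_right _ _
    set v := R (J.adjoint f)
    have hv : ∀ w, inner ℝ (J v) (J w) + l * inner ℝ (D v) (D w) = inner ℝ f (J w) := fun w => by
      simpa [ContinuousLinearMap.adjoint_inner_left] using (hR (J.adjoint f)).2 w trivial
    refine ⟨J v, l⁻¹ • (f - J v), ⟨v, rfl, fun w => ?_⟩, ?_⟩
    · rw [real_inner_smul_left, inner_sub_left, ← hv w]
      field_simp
      ring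
    · rw [smul_inv_smul₀ hl.ne']
      abel

/-- The underlying `v` satisfies `⟪v, w⟫ = ⟪u + α, J w⟫`, so it is `J.adjoint (u + α)`. Recovering
the element of `V` by a bounded operator makes it depend on time as an `L²` function. -/
theorem formGraph_adjoint [CompleteSpace V] [CompleteSpace H] {u α : H} (h : α ∈ formGraph J D u) :
    J (J.adjoint (u + α)) = u ∧
      ∀ w, inner ℝ (D (J.adjoint (u + α))) (D w) = inner ℝ α (J w) := by
  obtain ⟨v, rfl, hv⟩ := h
  have : J.adjoint (J v + α) = v := by
    refine ext_inner_right ℝ fun w => ?_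
    rw [ContinuousLinearMap.adjoint_inner_left, hV, hv, inner_add_left]
  rw [this]
  exact ⟨rfl, hv⟩

/-- The witness is the Moreau regularisation of `‖D v‖ ^ 2 / 2`: the energy of the resolvent plus `l
/ 2` times the squared Yosida value. Convexity of the two squares gives the subgradient inequality.
-/
theorem exists_formGraph_energy [CompleteSpace V] [CompleteSpace H] (v₀ : V) {l : ℝ} (hl : 0 < l) :
    ∃ e : H → ℝ, (∀ u, 0 ≤ e u) ∧ e (J v₀) ≤ ‖D v₀‖ ^ 2 / 2 ∧
      ∀ u v, e u + inner ℝ (yosida (formGraph J D) l u) (v - u) ≤ e v := by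
  have hA := isMaximalMonotone_formGraph hV
  choose w hJw hDw using fun u => hA.yosida_mem hl u
  set Y := yosida (formGraph J D) l
  have hu : ∀ u, J (w u) + l • Y u = u := fun u => by
    rw [hJw]
    exact IsMaximalMonotone.resolvent_add_yosida hl u
  refine ⟨fun u => ‖D (w u)‖ ^ 2 / 2 + l * (‖Y u‖ ^ 2 / 2), fun u => by positivity, ?_, fun u v => ?_⟩
  · have h1 := sq_norm_half_add_le (D (w (J v₀))) (D v₀)
    rw [← map_sub, hDw, map_sub] at h1
    have h2 : J v₀ - J (w (J v₀)) = l • Y (J v₀) := by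
      rw [sub_eq_iff_eq_add']; exact (hu _).symm
    rw [h2, real_inner_smul_right, real_inner_self_eq_norm_sq] at h1
    nlinarith [mul_nonneg hl.le (sq_nonneg ‖Y (J v₀)‖)]
  · have h1 := sq_norm_half_add_le (D (w u)) (D (w v))
    rw [← map_sub, hDw, map_sub] at h1
    have h2 := mul_le_mul_of_nonneg_left (sq_norm_half_add_le (Y u) (Y v)) hl.le
    have h3 : v - u = (J (w v) - J (w u)) + l • (Y v - Y u) := by
      conv_lhs => rw [← hu u, ← hu v]
      module
    rw [h3, inner_add_right, real_inner_smul_right]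
    linarith

-- With `J w` the resolvent of `u`, monotonicity of `b` allows `b u` to be replaced by `b (J w)` in
-- the pairing, which then equals `⟪D w, D z⟫`.
omit hV in
theorem inner_yosida_formGraph_nonneg (hA : IsMaximalMonotone (formGraph J D)) {l : ℝ} (hl : 0 < l) {b : H → H}
    (hb : ∀ u v, 0 ≤ inner ℝ (b u - b v) (u - v))
    (hD : ∀ v, ∃ z, J z = b (J v) ∧ 0 ≤ inner ℝ (D v) (D z)) (u : H) :
    0 ≤ inner ℝ (yosida (formGraph J D) l u) (b u) := by
  obtain ⟨w, hw, hDw⟩ := hA.yosida_mem hl u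
  obtain ⟨z, hz, hz0⟩ := hD w
  set Y := yosida (formGraph J D) l u
  have hu : J w + l • Y = u := by rw [hw]; exact IsMaximalMonotone.resolvent_add_yosida hl u
  have h1 := hb u (J w)
  have h2 : u - J w = l • Y := by rw [sub_eq_iff_eq_add']; exact hu.symm
  rw [h2, real_inner_smul_right, inner_sub_left] at h1
  rw [hDw, hz] at hz0
  have h3 := nonneg_of_mul_nonneg_right h1 hl
  rw [real_inner_comm]
  rw [real_inner_comm] at hz0
  linarith

end Form

/-- The solution operators of `-Δ μ = P f`, `μ ∈ 𝒱`, where `P` is the projection onto the functionals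
for which the problem is solvable and `Q` lifts the complement to the kernel of the form. -/
structure IsPotentialSolver {H V K : Type*} [NormedAddCommGroup H] [InnerProductSpace ℝ H]
    [NormedAddCommGroup V] [InnerProductSpace ℝ V] [NormedAddCommGroup K] [InnerProductSpace ℝ K]
    (J : V →L[ℝ] H) (D : V →L[ℝ] K) (𝒱 : Submodule ℝ V)
    (N : H →L[ℝ] V) (P : H →L[ℝ] H) (Q : H →L[ℝ] V) : Prop where
  N_mem : ∀ f, N f ∈ 𝒱
  Q_mem : ∀ f, Q f ∈ 𝒱
  inner_N : ∀ f, ∀ v ∈ 𝒱, inner ℝ (D (N f)) (D v) = inner ℝ (P f) (J v)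
  P_symm : ∀ u v, inner ℝ (P u) v = inner ℝ u (P v)
  P_P : ∀ u, P (P u) = P u
  P_N : ∀ u, P (J (N u)) = J (N u)
  D_Q : ∀ f, D (Q f) = 0
  J_Q : ∀ f, J (Q f) = f - P f

/-! ### Solving the equation for the potential -/

section ExistsSolver
variable {H V K : Type*} [NormedAddCommGroup H] [InnerProductSpace ℝ H] [CompleteSpace H]
  [NormedAddCommGroup V] [InnerProductSpace ℝ V] [CompleteSpace V]
  [NormedAddCommGroup K] [InnerProductSpace ℝ K] {J : V →L[ℝ] H} {D : V →L[ℝ] K}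

theorem exists_solver_of_poincare
    (hV : ∀ v w : V, inner ℝ v w = inner ℝ (J v) (J w) + inner ℝ (D v) (D w))
    {W : Submodule ℝ V} (hW : IsClosed (W : Set V)) {C : ℝ} (hC : ∀ v ∈ W, ‖J v‖ ≤ C * ‖D v‖) :
    ∃ N : H →L[ℝ] V, ∀ f, N f ∈ W ∧ ∀ v ∈ W, inner ℝ (D (N f)) (D v) = inner ℝ f (J v) := by
  -- Poincaré gives `‖v‖ ^ 2 ≤ (C ^ 2 + 1) ‖D v‖ ^ 2` on `W`, hence this coercivity constant.
  obtain ⟨R, hR⟩ := exists_coercive_solution (J := J) (D := D) hW (a := 0) (b := 1)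
    (c := (C ^ 2 + 1)⁻¹) (by positivity) fun v hv => by
      rw [inv_mul_le_iff₀ (by positivity), sq_norm_form hV]
      nlinarith [pow_le_pow_left₀ (norm_nonneg _) (hC v hv) 2]
  refine ⟨R.comp J.adjoint, fun f => ⟨(hR _).1, fun v hv => ?_⟩⟩
  have := (hR (J.adjoint f)).2 v hv
  rw [ContinuousLinearMap.adjoint_inner_left] at this
  simpa using this

theorem exists_potentialSolver_of_poincare
    (hV : ∀ v w : V, inner ℝ v w = inner ℝ (J v) (J w) + inner ℝ (D v) (D w))
    {W : Submodule ℝ V} (hW : IsClosed (W : Set V)) {C : ℝ} (hC : ∀ v ∈ W, ‖J v‖ ≤ C * ‖D v‖) :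
    ∃ N : H →L[ℝ] V, IsPotentialSolver J D W N (ContinuousLinearMap.id ℝ H) 0 := by
  obtain ⟨N, hN⟩ := exists_solver_of_poincare hV hW hC
  exact ⟨N, fun f => (hN f).1, fun f => by simp, fun f v hv => by simpa using (hN f).2 v hv,
    fun u v => rfl, fun u => rfl, fun u => rfl, fun f => by simp, fun f => by simp⟩

/-- The orthogonal projection along `e`. -/
noncomputable def removeMean (e : H) : H →L[ℝ] H :=
  ContinuousLinearMap.id ℝ H - ((‖e‖ ^ 2)⁻¹ • innerSL ℝ e).smulRight e

omit [CompleteSpace H] in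
theorem removeMean_apply (e u : H) : removeMean e u = u - ((‖e‖ ^ 2)⁻¹ * inner ℝ e u) • e := by
  simp [removeMean]

omit [CompleteSpace H] in
theorem removeMean_self (e : H) : removeMean e e = 0 := by
  by_cases he : e = 0
  · simp [he]
  · rw [removeMean_apply, real_inner_self_eq_norm_sq, inv_mul_cancel₀ (by simpa using he)]
    simp

omit [CompleteSpace H] in
theorem removeMean_symm (e u v : H) : inner ℝ (removeMean e u) v = inner ℝ u (removeMean e v) := by
  simp only [removeMean_apply, inner_sub_left, inner_sub_right, real_inner_smul_left,
    real_inner_smul_right]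
  rw [real_inner_comm u e]
  ring

omit [CompleteSpace H] in
theorem removeMean_of_inner_eq_zero {e u : H} (h : inner ℝ e u = 0) : removeMean e u = u := by
  simp [removeMean_apply, h]

omit [CompleteSpace H] in
theorem inner_removeMean (e u : H) : inner ℝ e (removeMean e u) = 0 := by
  rw [← removeMean_symm, removeMean_self, inner_zero_left]

/-- Solve on the kernel of the mean value, where Poincaré–Wirtinger holds. An arbitrary test
function is reduced to that kernel by subtracting a multiple of `one`, which changes neither its
gradient nor its pairing with `P f`. -/
theorem exists_potentialSolver_removeMean
    (hV : ∀ v w : V, inner ℝ v w = inner ℝ (J v) (J w) + inner ℝ (D v) (D w))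
    {one : V} (h1 : D one = 0) {C : ℝ} (hC : ∀ v, inner ℝ (J one) (J v) = 0 → ‖J v‖ ≤ C * ‖D v‖) :
    ∃ (N : H →L[ℝ] V) (Q : H →L[ℝ] V),
      IsPotentialSolver J D ⊤ N (removeMean (J one)) Q := by
  let ℓ : V →L[ℝ] ℝ := (innerSL ℝ (J one)).comp J
  have hmem : ∀ v, v ∈ ℓ.ker ↔ inner ℝ (J one) (J v) = 0 := fun v => Iff.rfl
  obtain ⟨N, hN⟩ := exists_solver_of_poincare hV (W := ℓ.ker) ℓ.isClosed_ker
    (C := C) fun v hv => hC v ((hmem v).1 hv)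
  refine ⟨N, ((‖J one‖ ^ 2)⁻¹ • innerSL ℝ (J one)).smulRight one, fun f => trivial, fun f => trivial,
    fun f v _ => ?_, removeMean_symm _, fun u => ?_, fun u => ?_, fun f => by simp [h1], fun f => ?_⟩
  · have h2 : J (v - ((‖J one‖ ^ 2)⁻¹ * inner ℝ (J one) (J v)) • one) = removeMean (J one) (J v) := by
      rw [map_sub, map_smul, removeMean_apply]
    have h3 := (hN f).2 (v - ((‖J one‖ ^ 2)⁻¹ * inner ℝ (J one) (J v)) • one) (by
      rw [hmem, h2, inner_removeMean])
    rw [h2, map_sub, map_smul, h1, smul_zero, sub_zero] at h3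
    rw [h3, removeMean_symm]
  · exact removeMean_of_inner_eq_zero (inner_removeMean _ _)
  · exact removeMean_of_inner_eq_zero ((hmem _).1 (hN u).1)
  · simp [removeMean_apply]

end ExistsSolver

namespace IsPotentialSolver
variable {H V K : Type*} [NormedAddCommGroup H] [InnerProductSpace ℝ H]
    [NormedAddCommGroup V] [InnerProductSpace ℝ V] [NormedAddCommGroup K] [InnerProductSpace ℝ K]
    {J : V →L[ℝ] H} {D : V →L[ℝ] K} {𝒱 : Submodule ℝ V}
    {N : H →L[ℝ] V} {P : H →L[ℝ] H} {Q : H →L[ℝ] V}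
    (h : IsPotentialSolver J D 𝒱 N P Q)
include h

theorem inner_N_N (u v : H) : inner ℝ (D (N u)) (D (N v)) = inner ℝ u (J (N v)) := by
  rw [h.inner_N u _ (h.N_mem v), h.P_symm, h.P_N]

theorem N_symm (u v : H) : inner ℝ (J (N u)) v = inner ℝ u (J (N v)) := by
  rw [← h.inner_N_N, real_inner_comm, ← h.inner_N_N, real_inner_comm]

theorem N_nonneg (u : H) : 0 ≤ inner ℝ (J (N u)) u := by
  rw [h.N_symm, ← h.inner_N_N]
  exact real_inner_self_nonneg

end IsPotentialSolver

/-! ### Control of the mean value -/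

section Kernel
variable {H : Type*} [NormedAddCommGroup H] [InnerProductSpace ℝ H]

/-- The control of the mean value of the constraint. -/
theorem exists_kernel_bound {A B : H → Set H} (hA : IsMaximalMonotone A) (hB : IsMaximalMonotone B)
    {e : H} (he : ∀ u α, α ∈ A u → inner ℝ α e = 0) (hA0 : (0 : H) ∈ A 0) (hB0 : (0 : H) ∈ B 0)
    {P : H →L[ℝ] H} (hP : ∀ u, ∃ c : ℝ, u - P u = c • e) (hPs : ∀ u v, inner ℝ (P u) v = inner ℝ u (P v))
    (hPe : P e = 0) {m δ a b : ℝ} (hδ : 0 < δ) (ha : a • e ∈ B ((m + δ) • e))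
    (hb : b • e ∈ B ((m - δ) • e)) {φ₀ : H} (hφ₀ : φ₀ - P φ₀ = m • e) :
    ∃ K : ℝ, 0 ≤ K ∧ ∀ l, 0 < l → l ≤ 1 → ∀ u, P (u - φ₀) = u - φ₀ →
    ‖yosida A l u + yosida B l u - P (yosida A l u + yosida B l u)‖
      ≤ K * (1 + ‖u‖) * (1 + ‖P (yosida A l u + yosida B l u)‖) := by
  by_cases he0 : e = 0
  · refine ⟨0, le_rfl, fun l _ _ u _ => ?_⟩
    obtain ⟨c, hc⟩ := hP (yosida A l u + yosida B l u)
    rw [hc, he0]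
    simp
  have hen : 0 < ‖e‖ := norm_pos_iff.2 he0
  set R : ℝ := (|a| + |b|) * ‖e‖ * (1 + (|m| + δ) * ‖e‖) with hR
  have hR0 : 0 ≤ R := by positivity
  refine ⟨(1 + R) / (δ * ‖e‖), by positivity, fun l hl hl1 u hu => ?_⟩
  have hres : ‖resolvent B l u‖ ≤ ‖u‖ := by
    have h1 := hB.norm_resolvent_sub_le hl u 0
    have h2 : resolvent B l 0 = 0 := by simpa using hB.resolvent_eq hl hB0
    simpa [h2] using h1
  -- Monotonicity of `B` between the resolvent of `u` and a constant point `r • e` of its domain;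
  -- the term `l ‖yosida B l u‖ ^ 2` has the good sign.
  have key : ∀ r s : ℝ, s • e ∈ B (r • e) → |s| ≤ |a| + |b| → |r| ≤ |m| + δ →
      -(R * (1 + ‖u‖)) ≤ inner ℝ (yosida B l u) (u - r • e) := by
    intro r s hrs hs hr
    have h1 := hB.monotone (hB.yosida_mem hl u) hrs
    have h2 : u - r • e = (resolvent B l u - r • e) + l • yosida B l u := by
      have : resolvent B l u + l • yosida B l u = u := IsMaximalMonotone.resolvent_add_yosida hl u
      conv_lhs => rw [← this]
      abel
    rw [h2, inner_add_right, real_inner_smul_right, real_inner_self_eq_norm_sq]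
    rw [inner_sub_left] at h1
    have h3 : -(R * (1 + ‖u‖)) ≤ inner ℝ (s • e) (resolvent B l u - r • e) := by
      refine (neg_le_of_abs_le ((abs_real_inner_le_norm _ _).trans ?_))
      have h4 : ‖resolvent B l u - r • e‖ ≤ (1 + (|m| + δ) * ‖e‖) * (1 + ‖u‖) := by
        refine (norm_sub_le _ _).trans ?_
        rw [norm_smul, Real.norm_eq_abs]
        have : |r| * ‖e‖ ≤ (|m| + δ) * ‖e‖ := by gcongr
        have : 0 ≤ (|m| + δ) * ‖e‖ * ‖u‖ := by positivity
        linarith [norm_nonneg u]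
      calc ‖s • e‖ * ‖resolvent B l u - r • e‖
          ≤ ((|a| + |b|) * ‖e‖) * ((1 + (|m| + δ) * ‖e‖) * (1 + ‖u‖)) := by
            rw [norm_smul, Real.norm_eq_abs]
            gcongr
        _ = R * (1 + ‖u‖) := by rw [hR]; ring
    nlinarith [mul_nonneg hl.le (sq_nonneg ‖yosida B l u‖)]
  have k1 := key (m + δ) a ha (by linarith [abs_nonneg b])
    ((abs_add_le _ _).trans_eq (by rw [abs_of_pos hδ]))
  have k2 := key (m - δ) b hb (by linarith [abs_nonneg a])
    ((abs_sub _ _).trans_eq (by rw [abs_of_pos hδ]))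
  set Y := yosida A l u + yosida B l u with hY
  have hYe : inner ℝ (yosida A l u) e = 0 := he _ _ (hA.yosida_mem hl u)
  have hYu : 0 ≤ inner ℝ (yosida A l u) u := by
    have h1 := hA.inner_yosida_sub_nonneg hl u 0
    have h2 : yosida A l 0 = 0 := by
      have : resolvent A l 0 = 0 := by simpa using hA.resolvent_eq hl hA0
      rw [yosida, this]; simp
    simpa [h2] using h1
  have huP : u - P u = m • e := by
    rw [map_sub] at hu
    rw [← hφ₀, sub_eq_sub_iff_sub_eq_sub]
    exact hu.symm
  have hPu : inner ℝ Y (u - m • e) = inner ℝ (P Y) u := by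
    rw [hPs, ← huP]; congr 1; abel
  have hPYu : inner ℝ (P Y) u ≤ ‖P Y‖ * ‖u‖ := real_inner_le_norm _ _
  -- Using the constants `m + δ` and `m - δ` gives both signs of `⟪Y, e⟫`. The part from `A` has no
  -- component along `e` and pairs nonnegatively with `u`, and `⟪Y, u - m • e⟫` only involves `P Y`.
  have hineq : δ * |inner ℝ Y e| ≤ ‖P Y‖ * ‖u‖ + R * (1 + ‖u‖) := by
    have hYe' : inner ℝ Y e = inner ℝ (yosida B l u) e := by rw [hY, inner_add_left, hYe, zero_add]
    have hYu' : inner ℝ Y u = inner ℝ (yosida A l u) u + inner ℝ (yosida B l u) u := by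
      rw [hY, inner_add_left]
    rw [← hPu] at hPYu
    simp only [inner_sub_right, real_inner_smul_right] at k1 k2 hPYu
    rw [hYe', hYu'] at hPYu
    rw [hYe']
    rcases abs_cases (inner ℝ (yosida B l u) e) with ⟨h1, -⟩ | ⟨h1, -⟩ <;> rw [h1] <;> linarith
  obtain ⟨c, hc⟩ := hP Y
  have hce : inner ℝ Y e = c * ‖e‖ ^ 2 := by
    have h1 : inner ℝ (Y - P Y) e = inner ℝ Y e := by
      rw [inner_sub_left, hPs, hPe, inner_zero_right, sub_zero]
    rw [← h1, hc, real_inner_smul_left, real_inner_self_eq_norm_sq]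
  rw [hc, norm_smul, Real.norm_eq_abs, div_mul_eq_mul_div, div_mul_eq_mul_div,
    le_div_iff₀ (by positivity)]
  have : |c| * ‖e‖ * (δ * ‖e‖) = δ * |inner ℝ Y e| := by
    rw [hce, abs_mul, abs_of_nonneg (sq_nonneg ‖e‖)]; ring
  rw [this]
  refine hineq.trans ?_
  nlinarith [norm_nonneg u, norm_nonneg (P Y), mul_nonneg (norm_nonneg u) (norm_nonneg (P Y)),
    mul_nonneg hR0 (norm_nonneg (P Y)),
    mul_nonneg (mul_nonneg hR0 (norm_nonneg u)) (norm_nonneg (P Y))]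

end Kernel

/-! ### The space `H¹(Ω)` -/

section Sobolev
variable {d : ℕ} {Ω : Set (EuclideanSpace ℝ (Fin d))}

theorem inner_H1 (v w : H1 Ω) : inner ℝ v w
    = inner ℝ (H1.toL2 Ω v) (H1.toL2 Ω w) + inner ℝ (H1.grad Ω v) (H1.grad Ω w) := rfl

theorem hasWeakGradient_H1 (v : H1 Ω) : HasWeakGradient Ω (H1.toL2 Ω v) (H1.grad Ω v) := v.2

theorem exists_H1 {u : L2 Ω} {G : L2Vec Ω} (h : HasWeakGradient Ω u G) :
    ∃ v : H1 Ω, H1.toL2 Ω v = u ∧ H1.grad Ω v = G :=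
  ⟨⟨WithLp.toLp 2 (u, G), h⟩, rfl, rfl⟩

theorem integral_mul_eq_inner (u v : L2 Ω) : ∫ x in Ω, u x * v x = inner ℝ u v := by
  rw [L2.inner_def]
  simp [mul_comm]

theorem inner_toLp {f : EuclideanSpace ℝ (Fin d) → ℝ} (hf : MemLp f 2 (volume.restrict Ω))
    (u : L2 Ω) : inner ℝ u (hf.toLp f) = ∫ x in Ω, u x * f x := by
  rw [← integral_mul_eq_inner]
  refine integral_congr_ae ?_
  filter_upwards [hf.coeFn_toLp] with x hx
  rw [hx]

/-- As scalar products with fixed elements of `L²` the defining identities are closed conditions,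
which yields completeness of `H¹(Ω)`. -/
theorem hasWeakGradient_iff {u : L2 Ω} {G : L2Vec Ω} : HasWeakGradient Ω u G ↔
    ∀ (ψ : EuclideanSpace ℝ (Fin d) → ℝ) (hψ : IsTestFunction Ω ψ) (i : Fin d),
      inner ℝ u ((hψ.memLp_fderiv (EuclideanSpace.single i 1)).toLp _)
        = -inner ℝ (dirComp (EuclideanSpace.single i 1) G) (hψ.memLp.toLp ψ) := by
  refine forall_congr' fun ψ => forall_congr' fun hψ => forall_congr' fun i => ?_
  rw [inner_toLp, inner_toLp]
  have : ∫ x in Ω, dirComp (EuclideanSpace.single i 1) G x * ψ x = ∫ x in Ω, G x i * ψ x := by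
    refine integral_congr_ae ?_
    filter_upwards [coeFn_dirComp (EuclideanSpace.single i 1) G] with x hx
    rw [hx]
    simp [EuclideanSpace.inner_single_left]
  rw [this]

theorem isClosed_sobolevGraph : IsClosed (sobolevGraph Ω : Set (WithLp 2 (L2 Ω × L2Vec Ω))) := by
  have : (sobolevGraph Ω : Set (WithLp 2 (L2 Ω × L2Vec Ω))) = {p | ∀ (ψ : EuclideanSpace ℝ (Fin d) → ℝ)
      (hψ : IsTestFunction Ω ψ) (i : Fin d),
      inner ℝ p.fst ((hψ.memLp_fderiv (EuclideanSpace.single i 1)).toLp _)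
        = -inner ℝ (dirComp (EuclideanSpace.single i 1) p.snd) (hψ.memLp.toLp ψ)} :=
    Set.ext fun p => hasWeakGradient_iff
  rw [this]
  simp only [ofPred_forall]
  refine isClosed_iInter fun ψ => isClosed_iInter fun hψ => isClosed_iInter fun i => ?_
  have h1 : Continuous fun p : WithLp 2 (L2 Ω × L2Vec Ω) => p.fst := (WithLp.fstL 2 ℝ _ _).continuous
  have h2 : Continuous fun p : WithLp 2 (L2 Ω × L2Vec Ω) =>
      dirComp (EuclideanSpace.single i 1) p.snd :=
    ((innerSL ℝ (EuclideanSpace.single i (1 : ℝ))).compLpL 2 (volume.restrict Ω)).continuous.comp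
      (WithLp.sndL 2 ℝ _ _).continuous
  exact isClosed_eq (h1.inner continuous_const) (h2.inner continuous_const).neg

instance completeSpace_H1 : CompleteSpace (H1 Ω) := isClosed_sobolevGraph.completeSpace_coe

/-- Monotone Lipschitz superpositions act in `H¹(Ω)`. -/
theorem exists_yosida_superposition (hΩ : IsOpen Ω) [IsFiniteMeasure (volume.restrict Ω)]
    {G : ℝ → Set ℝ} (hG : IsMaximalMonotone G) {l : ℝ} (hl : 0 < l) (h0 : resolvent G l 0 = 0)
    (v : H1 Ω) : ∃ z : H1 Ω, H1.toL2 Ω z = lipComp (hG.lipschitzWith_yosida hl) (H1.toL2 Ω v) ∧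
      0 ≤ inner ℝ (H1.grad Ω v) (H1.grad Ω z) := by
  -- The resolvent is a contraction fixing `0`, so it yields `y` in `H¹` with no larger gradient;
  -- the Yosida approximation is `(v - y) / l`, and Cauchy–Schwarz gives the sign.
  obtain ⟨G', hG', hle⟩ := exists_gradient_of_contraction hΩ (hasWeakGradient_H1 v)
    (hG.lipschitzWith_resolvent hl) h0
  obtain ⟨y, hy, rfl⟩ := exists_H1 hG'
  refine ⟨l⁻¹ • (v - y), ?_, ?_⟩
  · rw [map_smul, map_sub, hy, inv_smul_eq_iff₀ hl.ne', sub_eq_iff_eq_add', lipComp_resolvent_add hG hl]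
  · rw [map_smul, map_sub, real_inner_smul_right, inner_sub_right, real_inner_self_eq_norm_sq]
    have h1 := real_inner_le_norm (H1.grad Ω v) (H1.grad Ω y)
    have h2 : ‖H1.grad Ω v‖ * ‖H1.grad Ω y‖ ≤ ‖H1.grad Ω v‖ ^ 2 := by
      rw [sq]; gcongr
    exact mul_nonneg (by positivity) (by linarith)

/-- The constant function `1` in `L²(Ω)`. -/
noncomputable def oneL2 (Ω : Set (EuclideanSpace ℝ (Fin d))) [IsFiniteMeasure (volume.restrict Ω)] :
    L2 Ω := (memLp_const (1 : ℝ)).toLp _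

variable [IsFiniteMeasure (volume.restrict Ω)]

theorem coeFn_oneL2 : oneL2 Ω =ᵐ[volume.restrict Ω] fun _ => (1 : ℝ) :=
  MemLp.coeFn_toLp _

theorem inner_oneL2 (u : L2 Ω) : inner ℝ (oneL2 Ω) u = ∫ x in Ω, u x := by
  rw [real_inner_comm, oneL2, inner_toLp]
  simp

theorem mean_eq (u : L2 Ω) : mean u = (‖oneL2 Ω‖ ^ 2)⁻¹ * inner ℝ (oneL2 Ω) u := by
  have h : ‖oneL2 Ω‖ ^ 2 = (volume.restrict Ω).real univ := by
    rw [← real_inner_self_eq_norm_sq, inner_oneL2, integral_congr_ae coeFn_oneL2]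
    simp
  rw [mean, average_eq, h, inner_oneL2, smul_eq_mul]

theorem exists_one_H1 : ∃ one : H1 Ω, H1.toL2 Ω one = oneL2 Ω ∧ H1.grad Ω one = 0 := by
  refine exists_H1 fun ψ hψ i => ?_
  have h1 : ∫ x in Ω, oneL2 Ω x * fderiv ℝ ψ x (EuclideanSpace.single i 1) = 0 := by
    have e1 : ∫ x in Ω, oneL2 Ω x * fderiv ℝ ψ x (EuclideanSpace.single i 1)
        = ∫ x in Ω, fderiv ℝ ψ x (EuclideanSpace.single i 1) := by
      refine integral_congr_ae ?_
      filter_upwards [coeFn_oneL2 (Ω := Ω)] with x hx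
      rw [hx, one_mul]
    have e2 : ∫ x in Ω, fderiv ℝ ψ x (EuclideanSpace.single i 1)
        = ∫ x, fderiv ℝ ψ x (EuclideanSpace.single i 1) := by
      refine setIntegral_eq_integral_of_forall_compl_eq_zero fun x hx => ?_
      have : x ∉ tsupport ψ := fun h => hx (hψ.tsupport_subset h)
      rw [fderiv_of_notMem_tsupport ℝ this]
      simp
    have hd : Continuous fun x => fderiv ℝ ψ x (EuclideanSpace.single i 1) :=
      (hψ.contDiff.continuous_fderiv (by simp)).clm_apply continuous_const
    have hi : Integrable fun x => fderiv ℝ ψ x (EuclideanSpace.single i 1) :=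
      hd.integrable_of_hasCompactSupport (hψ.hasCompactSupport.fderiv_apply ℝ _)
    have e3 := integral_mul_fderiv_eq_neg_fderiv_mul_of_integrable (μ := volume)
      (f := fun _ : EuclideanSpace ℝ (Fin d) => (1 : ℝ)) (g := ψ)
      (v := EuclideanSpace.single i (1 : ℝ)) (by simp) (by simpa using hi)
      (by simpa using hψ.contDiff.continuous.integrable_of_hasCompactSupport hψ.hasCompactSupport)
      (by fun_prop) (fun x _ => hψ.contDiff.differentiable (by simp) x)
    rw [e1, e2]
    simpa using e3
  rw [h1]
  have h2 : ∫ x in Ω, (0 : L2Vec Ω) x i * ψ x = 0 := by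
    rw [integral_eq_zero_of_ae]
    filter_upwards [Lp.coeFn_zero (EuclideanSpace ℝ (Fin d)) 2 (volume.restrict Ω)] with x hx
    rw [hx]
    simp
  rw [h2, neg_zero]

omit [IsFiniteMeasure (volume.restrict Ω)] in
/-- Poincaré's inequality for test functions. -/
theorem norm_le_of_testFunction {R : ℝ} (hR0 : 0 ≤ R) (hR : ∀ x ∈ Ω, ‖x‖ ≤ R) (hΩ : MeasurableSet Ω) (i : Fin d)
    {v : H1 Ω} {ψ : EuclideanSpace ℝ (Fin d) → ℝ} (hψ : IsTestFunction Ω ψ)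
    (hv : H1.toL2 Ω v =ᵐ[volume.restrict Ω] ψ) : ‖H1.toL2 Ω v‖ ≤ 2 * R * ‖H1.grad Ω v‖ := by
  set z : EuclideanSpace ℝ (Fin d) := EuclideanSpace.single i 1
  set u := H1.toL2 Ω v
  -- Multiplying by a coordinate produces `ψ` itself under differentiation, as `∂ᵢ(xᵢ ψ) = ψ + xᵢ
  -- ∂ᵢψ`, while the coordinate is bounded by `R` on `Ω`.
  set p : EuclideanSpace ℝ (Fin d) → ℝ := fun x => x i
  have hp : ContDiff ℝ ∞ p := (EuclideanSpace.proj (𝕜 := ℝ) i).contDiff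
  have hη : IsTestFunction Ω fun x => p x * ψ x := hψ.mul_left hp
  have hψd : Differentiable ℝ ψ := hψ.contDiff.differentiable (by simp)
  have hpd : ∀ x, fderiv ℝ p x z = 1 := fun x => by
    have : fderiv ℝ p x = EuclideanSpace.proj (𝕜 := ℝ) i :=
      (EuclideanSpace.proj (𝕜 := ℝ) i).fderiv
    rw [this]
    simp [z]
  have hprod : ∀ x, fderiv ℝ (fun x => p x * ψ x) x z = p x * fderiv ℝ ψ x z + ψ x := fun x => by
    rw [fderiv_fun_mul (hp.differentiable (by simp) x) (hψd x)]
    simp [hpd]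
  have hψc := hψ.contDiff.continuous
  have hdc : Continuous fun x => fderiv ℝ ψ x z :=
    (hψ.contDiff.continuous_fderiv (by simp)).clm_apply continuous_const
  have hpc : Continuous p := hp.continuous
  have hint1 : Integrable fun x => ψ x * ψ x :=
    (hψc.mul hψc).integrable_of_hasCompactSupport hψ.hasCompactSupport.mul_left
  have hint2 : Integrable fun x => ψ x * (p x * fderiv ℝ ψ x z) :=
    (hψc.mul (hpc.mul hdc)).integrable_of_hasCompactSupport hψ.hasCompactSupport.mul_right
  have hint3 : Integrable fun x => ψ x * (p x * ψ x) :=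
    (hψc.mul (hpc.mul hψc)).integrable_of_hasCompactSupport hψ.hasCompactSupport.mul_right
  have e1 : ∫ x, ψ x * fderiv ℝ (fun x => p x * ψ x) x z
      = -∫ x, fderiv ℝ ψ x z * (p x * ψ x) :=
    integral_mul_fderiv_eq_neg_fderiv_mul_of_integrable
      (hint2.congr (Eventually.of_forall fun x => by ring))
      ((hint2.add hint1).congr (Eventually.of_forall fun x => by
        simp only [hprod, Pi.add_apply]; ring)) hint3 (fun x _ => hψd x)
      (fun x _ => hη.contDiff.differentiable (by simp) x)
  have e2 : ∫ x, ψ x * fderiv ℝ (fun x => p x * ψ x) x z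
      = (∫ x, ψ x * (p x * fderiv ℝ ψ x z)) + ∫ x, ψ x * ψ x := by
    rw [← integral_add hint2 hint1]
    refine integral_congr_ae (Eventually.of_forall fun x => ?_)
    simp only [hprod]; ring
  have e3 : ∫ x, fderiv ℝ ψ x z * (p x * ψ x) = ∫ x, ψ x * (p x * fderiv ℝ ψ x z) :=
    integral_congr_ae (Eventually.of_forall fun x => by ring)
  have hzero : ∀ f : EuclideanSpace ℝ (Fin d) → ℝ,
      ∫ x in Ω, ψ x * f x = ∫ x, ψ x * f x := fun f => by
    refine setIntegral_eq_integral_of_forall_compl_eq_zero fun x hx => ?_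
    rw [image_eq_zero_of_notMem_tsupport fun h => hx (hψ.tsupport_subset h), zero_mul]
  have e4 := integral_mul_fderiv_dir (hasWeakGradient_H1 v) hη z
  have e5 : ∫ x in Ω, u x * fderiv ℝ (fun x => p x * ψ x) x z
      = ∫ x, ψ x * fderiv ℝ (fun x => p x * ψ x) x z := by
    rw [← hzero]
    refine integral_congr_ae ?_
    filter_upwards [hv] with x hx
    rw [hx]
  have e6 : ∫ x, ψ x * ψ x = ‖u‖ ^ 2 := by
    rw [← hzero, ← real_inner_self_eq_norm_sq, ← integral_mul_eq_inner]
    refine integral_congr_ae ?_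
    filter_upwards [hv] with x hx
    rw [hx]
  -- Classical integration by parts gives `∫ ψ² = -2 ∫ xᵢ ψ ∂ᵢψ`; the weak gradient tested with `xᵢ
  -- ψ` replaces the last integral by one over the gradient of `v`.
  have e7 : ‖u‖ ^ 2 = -2 * ∫ x in Ω, dirComp z (H1.grad Ω v) x * (p x * ψ x) := by
    change ∫ x in Ω, u x * fderiv ℝ (fun x => p x * ψ x) x z = _ at e4
    linarith
  have hlp : ‖(hη.memLp.toLp _ : L2 Ω)‖ ≤ R * ‖u‖ := by
    refine Lp.norm_le_mul_norm_of_ae_le_mul ?_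
    filter_upwards [hη.memLp.coeFn_toLp, hv, ae_restrict_mem hΩ] with x h1 h2 h3
    rw [h1, h2, norm_mul]
    gcongr
    exact (PiLp.norm_apply_le x i).trans (hR x h3)
  have e8 : ∫ x in Ω, dirComp z (H1.grad Ω v) x * (p x * ψ x)
      = inner ℝ (dirComp z (H1.grad Ω v)) (hη.memLp.toLp _) := (inner_toLp _ _).symm
  have e9 := abs_real_inner_le_norm (dirComp z (H1.grad Ω v)) (hη.memLp.toLp _ : L2 Ω)
  have e10 : ‖dirComp z (H1.grad Ω v)‖ ≤ ‖H1.grad Ω v‖ := by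
    simpa [z] using norm_dirComp_le z (H1.grad Ω v)
  have e11 : ‖u‖ * ‖u‖ ≤ ‖u‖ * (2 * R * ‖H1.grad Ω v‖) := by
    rw [← sq, e7, e8]
    have : ‖dirComp z (H1.grad Ω v)‖ * ‖(hη.memLp.toLp _ : L2 Ω)‖ ≤ ‖H1.grad Ω v‖ * (R * ‖u‖) := by
      gcongr
    linarith [neg_le_of_abs_le (e9.trans this)]
  by_cases h0 : ‖u‖ = 0
  · rw [h0]; positivity
  · exact le_of_mul_le_mul_left e11 (lt_of_le_of_ne (norm_nonneg _) (Ne.symm h0))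

omit [IsFiniteMeasure (volume.restrict Ω)] in
/-- Poincaré's inequality in `H¹₀(Ω)`. -/
theorem exists_poincare_H10 (hd : 1 ≤ d) (hΩ : MeasurableSet Ω) (hb : Bornology.IsBounded Ω) :
    ∃ C : ℝ, ∀ v ∈ H10 Ω, ‖H1.toL2 Ω v‖ ≤ C * ‖H1.grad Ω v‖ := by
  obtain ⟨R, hR0, hR⟩ := hb.exists_pos_norm_le
  refine ⟨2 * R, fun v hv => ?_⟩
  have hcl : IsClosed {v : H1 Ω | ‖H1.toL2 Ω v‖ ≤ 2 * R * ‖H1.grad Ω v‖} :=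
    isClosed_le (by fun_prop) (by fun_prop)
  refine (closure_minimal ?_ hcl) (show v ∈ closure _ from hv)
  intro v hv
  obtain ⟨ψ, hψ, hvψ⟩ : ∃ ψ : EuclideanSpace ℝ (Fin d) → ℝ, IsTestFunction Ω ψ ∧
      H1.toL2 Ω v =ᵐ[volume.restrict Ω] ψ := by
    refine Submodule.span_induction (p := fun v _ => ∃ ψ : EuclideanSpace ℝ (Fin d) → ℝ,
      IsTestFunction Ω ψ ∧ H1.toL2 Ω v =ᵐ[volume.restrict Ω] ψ) (fun v hv => hv) ?_ ?_ ?_ hv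
    · refine ⟨_, isTestFunction_zero, ?_⟩
      rw [map_zero]
      exact Lp.coeFn_zero _ _ _
    · rintro v w - - ⟨ψ, hψ, h1⟩ ⟨η, hη, h2⟩
      refine ⟨_, hψ.add hη, ?_⟩
      rw [map_add]
      filter_upwards [Lp.coeFn_add (H1.toL2 Ω v) (H1.toL2 Ω w), h1, h2] with x h3 h4 h5
      rw [h3, Pi.add_apply, h4, h5, Pi.add_apply]
    · rintro c v - ⟨ψ, hψ, h1⟩
      refine ⟨_, hψ.smul c, ?_⟩
      rw [map_smul]
      filter_upwards [Lp.coeFn_smul c (H1.toL2 Ω v), h1] with x h3 h4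
      rw [h3, Pi.smul_apply, h4, Pi.smul_apply]
  exact norm_le_of_testFunction hR0.le hR hΩ ⟨0, hd⟩ hψ hvψ

end Sobolev

/-! ### Existence of solutions -/

section Existence
variable {d : ℕ} {Ω : Set (EuclideanSpace ℝ (Fin d))}

theorem integral_inner_eq (F G : L2Vec Ω) : ∫ x in Ω, inner ℝ (F x) (G x) = inner ℝ F G :=
  (L2.inner_def F G).symm

theorem integral_add_mul_eq_inner (a b v : L2 Ω) :
    ∫ x in Ω, (a x + b x) * v x = inner ℝ (a + b) v := by
  rw [← integral_mul_eq_inner]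
  refine integral_congr_ae ?_
  filter_upwards [Lp.coeFn_add a b] with x hx
  rw [hx, Pi.add_apply]

theorem integral_nonlinear_mul_eq_inner [IsFiniteMeasure (volume.restrict Ω)] {π : ℝ → ℝ} {K : ℝ≥0}
    (hπ : LipschitzWith K π) (ξ ζ u v : L2 Ω) :
    ∫ x in Ω, (ξ x + π (u x) + ζ x) * v x = inner ℝ (ξ + lipComp hπ u + ζ) v := by
  rw [← integral_add_mul_eq_inner]
  refine integral_congr_ae ?_
  filter_upwards [Lp.coeFn_add ξ (lipComp hπ u), coeFn_lipComp hπ u] with x h1 h2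
  rw [h1, Pi.add_apply, h2]

theorem isFiniteMeasure_of_isBounded (h : Bornology.IsBounded Ω) :
    IsFiniteMeasure (volume.restrict Ω) :=
  ⟨by rw [Measure.restrict_apply_univ]; exact h.measure_lt_top⟩

theorem exists_potentialSolver (hd : 1 ≤ d) (hΩ : IsSmoothBoundedDomain Ω)
    [IsFiniteMeasure (volume.restrict Ω)] (bc : BoundaryCondition) :
    ∃ (N : L2 Ω →L[ℝ] H1 Ω) (P : L2 Ω →L[ℝ] L2 Ω) (Q : L2 Ω →L[ℝ] H1 Ω),
      IsPotentialSolver (H1.toL2 Ω) (H1.grad Ω) (bc.space Ω) N P Q ∧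
      (bc = .dirichlet → P = ContinuousLinearMap.id ℝ _) ∧
      (bc = .neumann → P = removeMean (oneL2 Ω)) := by
  cases bc with
  | neumann =>
    obtain ⟨C, -, hC⟩ := exists_poincare_wirtinger hΩ
    obtain ⟨one, h1, h2⟩ := exists_one_H1 (Ω := Ω)
    obtain ⟨N, Q, h⟩ := exists_potentialSolver_removeMean (D := H1.grad Ω) inner_H1 h2 (C := C)
      fun v hv => hC _ _ (hasWeakGradient_H1 v) (by rw [← inner_oneL2, ← h1]; exact hv)
    rw [h1] at h
    exact ⟨N, _, Q, h, by simp, fun _ => rfl⟩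
  | dirichlet =>
    obtain ⟨C, hC⟩ := exists_poincare_H10 hd hΩ.isOpen.measurableSet hΩ.isBounded
    obtain ⟨N, h⟩ := exists_potentialSolver_of_poincare (D := H1.grad Ω) inner_H1
      (W := H10 Ω) (Submodule.isClosed_topologicalClosure _) hC
    exact ⟨N, _, _, h, fun _ => rfl, by simp⟩

theorem smul_oneL2_mem_lpGraph [IsFiniteMeasure (volume.restrict Ω)] {G : ℝ → Set ℝ} {r s : ℝ}
    (h : s ∈ G r) : s • oneL2 Ω ∈ lpGraph (volume.restrict Ω) G (r • oneL2 Ω) := by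
  filter_upwards [Lp.coeFn_smul s (oneL2 Ω), Lp.coeFn_smul r (oneL2 Ω), coeFn_oneL2 (Ω := Ω)]
    with x h1 h2 h3
  rw [h1, h2, Pi.smul_apply, Pi.smul_apply, h3]
  simpa using h

/-- The energies of the two graphs add up; the cross term reduces to the action of Yosida
approximations on `H¹(Ω)`. Nothing lies outside the range of the projection for Dirichlet, while for
Neumann the constants `m ± ε / 2` around the mean are in the domain of `β`. -/
theorem isEvolutionSystem (hΩ : IsSmoothBoundedDomain Ω) [IsFiniteMeasure (volume.restrict Ω)]
    {P : SystemStructure Ω} (hP : P.Admissible) {bc : BoundaryCondition} {T : ℝ}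
    {D : ProblemData Ω T} (hD : D.Admissible P bc) {K : ℝ≥0} (hK : LipschitzWith K (deriv P.PiHat))
    {N : L2 Ω →L[ℝ] H1 Ω} {R : L2 Ω →L[ℝ] L2 Ω} {Q : L2 Ω →L[ℝ] H1 Ω}
    (h : IsPotentialSolver (H1.toL2 Ω) (H1.grad Ω) (bc.space Ω) N R Q)
    (hdir : bc = .dirichlet → R = ContinuousLinearMap.id ℝ _)
    (hneu : bc = .neumann → R = removeMean (oneL2 Ω)) :
    IsEvolutionSystem P.tau (formGraph (H1.toL2 Ω) (H1.grad Ω))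
      (lpGraph (volume.restrict Ω) (betaGraph P.betaHat)) (sGraph P.SHat) ((H1.toL2 Ω).comp N) R
      (lipComp hK) (H1.toL2 Ω D.phi0) := by
  have hβ := isMaximalMonotone_betaGraph hP.betaHat_convex hP.betaHat_lsc hP.betaHat_zero
  have hA := isMaximalMonotone_formGraph (inner_H1 (Ω := Ω))
  have hB := isMaximalMonotone_lpGraph (μ := volume.restrict Ω) hβ
  refine
    { tau_pos := hP.tau_pos
      maxA := hA
      maxB := hB
      maxS := isMaximalMonotone_subdifferential hP.SHat_convex hP.SHat_lsc
      growthS := hP.S_growth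
      N_symm := h.N_symm
      N_nonneg := h.N_nonneg
      P_symm := h.P_symm
      P_N := h.P_N
      P_P := h.P_P
      lipschitz := ⟨K, lipschitzWith_lipComp hK⟩
      energy := ?_
      cross := ?_
      kernel_bound := ?_ }
  · refine ⟨‖H1.grad Ω D.phi0‖ ^ 2 / 2
      + (∫⁻ x in Ω, P.betaHat (H1.toL2 Ω D.phi0 x)).toReal, fun l hl => ?_⟩
    obtain ⟨e₁, h1, h2, h3⟩ := exists_formGraph_energy (inner_H1 (Ω := Ω)) D.phi0 hl
    obtain ⟨e₂, h4, h5, h6⟩ := exists_lpGraph_energy hβ hP.betaHat_lsc hP.betaHat_zero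
      (H1.toL2 Ω D.phi0) hD.betaHat_phi0 l hl
    refine ⟨fun u => e₁ u + e₂ u, fun u => add_nonneg (h1 u) (h4 u), add_le_add h2 h5,
      fun u v => ?_⟩
    rw [inner_add_left]
    linarith [h3 u v, h6 u v]
  · intro l hl u
    refine inner_yosida_formGraph_nonneg hA hl (fun u v => hB.inner_yosida_sub_nonneg hl u v)
      (fun v => ?_) u
    rw [yosida_lpGraph hβ hl]
    exact exists_yosida_superposition hΩ.isOpen hβ hl
      (resolvent_betaGraph_zero hβ hP.betaHat_zero hl) v
  · cases bc with
    | dirichlet =>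
      rw [hdir rfl]
      exact ⟨0, le_rfl, fun l _ _ u _ => by simp⟩
    | neumann =>
      rw [hneu rfl]
      obtain ⟨ε, hε, hball⟩ := Metric.isOpen_iff.1 isOpen_interior _ (hD.mean_phi0 rfl)
      set m := mean (H1.toL2 Ω D.phi0) with hm
      have hmem : ∀ r, |r - m| < ε → r ∈ betaDomain P.betaHat := fun r hr =>
        interior_subset (hball (by rwa [Metric.mem_ball, Real.dist_eq]))
      obtain ⟨a, ha⟩ := hmem (m + ε / 2) (by
        rw [add_sub_cancel_left, abs_of_pos (by positivity)]; linarith)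
      obtain ⟨b, hb⟩ := hmem (m - ε / 2) (by
        rw [sub_sub_cancel_left, abs_neg, abs_of_pos (by positivity)]; linarith)
      obtain ⟨one, h1, h2⟩ := exists_one_H1 (Ω := Ω)
      refine exists_kernel_bound hA hB (e := oneL2 Ω) ?_ ⟨0, by simp, by simp⟩ ?_
        (fun u => ⟨_, by rw [removeMean_apply, sub_sub_cancel]⟩) (removeMean_symm _)
        (removeMean_self _) (half_pos hε) (smul_oneL2_mem_lpGraph ha) (smul_oneL2_mem_lpGraph hb)
        (by rw [removeMean_apply, sub_sub_cancel, hm, mean_eq])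
      · rintro _ α ⟨v, rfl, hv⟩
        rw [← h1, ← hv, h2, inner_zero_right]
      · simpa using smul_oneL2_mem_lpGraph (Ω := Ω) (zero_mem_betaGraph hP.betaHat_zero)

set_option maxHeartbeats 1000000 in
theorem exists_isSolution (hd : 1 ≤ d) (hΩ : IsSmoothBoundedDomain Ω) {T : ℝ} (hT : 0 < T)
    {P : SystemStructure Ω} (hP : P.Admissible) {bc : BoundaryCondition}
    {D : ProblemData Ω T} (hD : D.Admissible P bc) :
    ∃ (phi mu : L2Time T (H1 Ω)) (xi zeta : L2Time T (L2 Ω)), IsSolution P bc D phi mu xi zeta := by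
  have := isFiniteMeasure_of_isBounded hΩ.isBounded
  obtain ⟨K, hK⟩ := hP.PiHat_deriv_lipschitz
  obtain ⟨N, R, Q, h, hdir, hneu⟩ := exists_potentialSolver hd hΩ bc
  have hsys := isEvolutionSystem hΩ hP hD hK h hdir hneu
  obtain ⟨φ, φ', α, ξ, ζ, hder, hinit, hα, hξ, hζ, heq⟩ := hsys.exists_solution hT D.g D.phiStar
  set J := H1.toL2 Ω
  set p := lipComp (μ := volume.restrict Ω) (p := 2) hK
  have hp : LipschitzWith K p := lipschitzWith_lipComp hK
  let F : L2Time T (L2 Ω) := α + ξ + (lipComp hp φ + ζ - D.g)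
  have hF : ∀ᵐ t ∂timeMeasure T, F t = α t + ξ t + (p (φ t) + ζ t - D.g t) := by
    filter_upwards [Lp.coeFn_add (α + ξ) (lipComp hp φ + ζ - D.g), Lp.coeFn_add α ξ,
      Lp.coeFn_sub (lipComp hp φ + ζ) D.g, Lp.coeFn_add (lipComp hp φ) ζ, coeFn_lipComp hp φ]
      with t h1 h2 h3 h4 h5
    rw [h1, Pi.add_apply, h2, h3, Pi.sub_apply, h4, Pi.add_apply, Pi.add_apply, h5]
  -- The element of `V` lying over `φ t`, obtained linearly from `φ t` and `α t`.
  let phi : L2Time T (H1 Ω) := J.adjoint.compLp (φ + α)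
  have hphi : ∀ᵐ t ∂timeMeasure T, phi t = J.adjoint (φ t + α t) := by
    filter_upwards [J.adjoint.coeFn_compLp (φ + α), Lp.coeFn_add φ α] with t h1 h2
    rw [h1, h2, Pi.add_apply]
  -- `-N φ'` solves the first equation; `Q F` has zero gradient and supplies the component of `F`
  -- lost under `R`, as required by the second equation.
  let mu : L2Time T (H1 Ω) := Q.compLp F - N.compLp φ'
  have hmu : ∀ᵐ t ∂timeMeasure T, mu t = Q (F t) - N (φ' t) := by
    filter_upwards [Lp.coeFn_sub (Q.compLp F) (N.compLp φ'), Q.coeFn_compLp F, N.coeFn_compLp φ']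
      with t h1 h2 h3
    rw [h1, Pi.sub_apply, h2, h3]
  have hJ : ∀ᵐ t ∂timeMeasure T, J (phi t) = φ t ∧
      ∀ w, inner ℝ (H1.grad Ω (phi t)) (H1.grad Ω w) = inner ℝ (α t) (J w) := by
    filter_upwards [hphi, hα] with t h1 h2
    rw [h1]
    exact formGraph_adjoint inner_H1 h2
  have hJphi : J.compLp phi = φ := by
    refine Lp.ext ?_
    filter_upwards [J.coeFn_compLp phi, hJ] with t h1 h2
    rw [h1, h2.1]
  have heq' : ∀ᵐ t ∂timeMeasure T, P.tau • φ' t + J (N (φ' t)) + R (F t) = 0 := by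
    filter_upwards [heq, hF] with t h1 h2
    rw [h2]
    exact h1
  have hR : ∀ᵐ t ∂timeMeasure T, R (φ' t) = φ' t := by
    filter_upwards [heq'] with t h1
    have h2 : P.tau • φ' t = -(J (N (φ' t)) + R (F t)) := by
      rw [eq_neg_iff_add_eq_zero, ← add_assoc]; exact h1
    have h3 : R (P.tau • φ' t) = P.tau • φ' t := by
      rw [h2, map_neg, map_add, h.P_N, h.P_P]
    rw [map_smul] at h3
    exact smul_right_injective _ hP.tau_pos.ne' h3
  refine ⟨phi, mu, ξ, ζ, ?_, ?_, ?_, ⟨φ', ?_, ?_, ?_⟩, ?_⟩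
  · filter_upwards [hmu] with t h1
    rw [h1]
    exact Submodule.sub_mem _ (h.Q_mem _) (h.N_mem _)
  · filter_upwards [hξ, hJ] with t h1 h2
    rw [h2.1]
    exact h1
  · filter_upwards [hζ, hJ] with t h1 h2
    rw [h2.1]
    exact h1
  · rw [hJphi]; exact hder
  · filter_upwards [hmu, hR] with t h1 h2 v hv
    rw [integral_mul_eq_inner, integral_inner_eq, h1, map_sub, h.D_Q, zero_sub, inner_neg_left,
      h.inner_N _ v hv, h2, add_neg_cancel]
  · filter_upwards [hmu, hJ, heq', hF] with t h1 h2 h3 h4 v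
    rw [integral_mul_eq_inner, integral_inner_eq, h2.2, h2.1, integral_nonlinear_mul_eq_inner hK,
      integral_add_mul_eq_inner, h1, map_sub, h.J_Q, ← real_inner_smul_left, ← inner_add_left,
      ← inner_add_left]
    congr 1
    have h5 : P.tau • φ' t = -(J (N (φ' t)) + R (F t)) := by
      rw [eq_neg_iff_add_eq_zero, ← add_assoc]; exact h3
    have h6 : α t + (ξ t + p (φ t) + ζ t) = F t + D.g t := by rw [h4]; abel
    rw [add_assoc, h6, h5]
    abel
  · rw [hJphi]; exact hinit

end Existence

/-! ### Weak time derivatives -/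

section TestFunctions
variable {T : ℝ}

/-- The primitive from `0` vanishes before the support, and after it because the total integral is
zero. -/
theorem exists_testFunction_primitive (hT : 0 < T) {ψ : ℝ → ℝ} (hψ : IsTestFunction (Ioo 0 T) ψ)
    (h0 : ∫ t, ψ t = 0) : ∃ θ : ℝ → ℝ, IsTestFunction (Ioo 0 T) θ ∧ deriv θ = ψ := by
  -- Inserting a point of the interval provides endpoints `a` and `b` even when `ψ = 0`.
  have hne : (insert (T / 2) (tsupport ψ)).Nonempty := insert_nonempty _ _
  have hcomp : IsCompact (insert (T / 2) (tsupport ψ)) := hψ.hasCompactSupport.insert _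
  have hsub : insert (T / 2) (tsupport ψ) ⊆ Ioo 0 T :=
    insert_subset ⟨by linarith, by linarith⟩ hψ.tsupport_subset
  obtain ⟨a, ha, hal⟩ := hcomp.exists_isLeast hne
  obtain ⟨b, hb, hbl⟩ := hcomp.exists_isGreatest hne
  have hsupp : ∀ t, ψ t ≠ 0 → a ≤ t ∧ t ≤ b := fun t ht =>
    have : t ∈ insert (T / 2) (tsupport ψ) := Or.inr (subset_tsupport ψ ht)
    ⟨hal this, hbl this⟩
  have hc := hψ.contDiff.continuous
  have hd : ∀ t, HasDerivAt (fun t => ∫ s in (0 : ℝ)..t, ψ s) (ψ t) t := fun t =>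
    intervalIntegral.integral_hasDerivAt_right (hc.intervalIntegrable _ _)
      hc.aestronglyMeasurable.stronglyMeasurableAtFilter hc.continuousAt
  have hderiv : deriv (fun t => ∫ s in (0 : ℝ)..t, ψ s) = ψ := funext fun t => (hd t).deriv
  have hzero : ∀ t, t ∉ Icc a b → ∫ s in (0 : ℝ)..t, ψ s = 0 := by
    intro t ht
    rcases lt_or_ge t a with h1 | h1
    · rw [intervalIntegral.integral_congr (g := fun _ => 0), intervalIntegral.integral_zero]
      intro s hs
      have h2 : s < a := hs.2.trans_lt (max_lt (hsub ha).1 h1)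
      by_contra h3
      exact absurd (hsupp s h3).1 (not_le.2 h2)
    · have h2 : b < t := by
        by_contra h3
        exact ht ⟨h1, not_lt.1 h3⟩
      rw [intervalIntegral.integral_eq_integral_of_support_subset, h0]
      intro s hs
      have := hsupp s hs
      exact ⟨(hsub ha).1.trans_le this.1, this.2.trans h2.le⟩
  have hts : tsupport (fun t => ∫ s in (0 : ℝ)..t, ψ s) ⊆ Icc a b :=
    closure_minimal (fun t ht => by_contra fun h => ht (hzero t h)) isClosed_Icc
  refine ⟨_, ⟨?_, ?_, ?_⟩, hderiv⟩
  · exact contDiff_infty_iff_deriv.2 ⟨fun t => (hd t).differentiableAt, by rw [hderiv]; exact hψ.contDiff⟩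
  · exact isCompact_Icc.of_isClosed_subset (isClosed_tsupport _) hts
  · exact hts.trans (Icc_subset_Ioo (hsub ha).1 (hsub hb).2)

theorem setIntegral_mul_of_testFunction {ψ : ℝ → ℝ} (hψ : IsTestFunction (Ioo 0 T) ψ) (f : ℝ → ℝ) :
    ∫ t in Ioo 0 T, ψ t * f t = ∫ t, ψ t * f t :=
  setIntegral_eq_integral_of_forall_compl_eq_zero fun t ht => by
    rw [image_eq_zero_of_notMem_tsupport fun h => ht (hψ.tsupport_subset h), zero_mul]

theorem exists_testFunction_integral_one (hT : 0 < T) :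
    ∃ η : ℝ → ℝ, IsTestFunction (Ioo 0 T) η ∧ ∫ t, η t = 1 := by
  let f : ContDiffBump (T / 2) := ⟨T / 8, T / 4, by positivity, by linarith⟩
  refine ⟨f.normed volume, ⟨f.contDiff_normed, f.hasCompactSupport_normed, ?_⟩, f.integral_normed⟩
  rw [f.tsupport_normed_eq, Real.closedBall_eq_Icc]
  refine Icc_subset_Ioo ?_ ?_ <;> simp only [f] <;> linarith

/-- The lemma of du Bois-Reymond. -/
theorem ae_eq_const_of_weak_deriv_eq_zero (hT : 0 < T) {f : ℝ → ℝ} (hf : IntegrableOn f (Ioo 0 T))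
    (h : ∀ ψ, IsTestFunction (Ioo 0 T) ψ → ∫ t in Ioo 0 T, deriv ψ t * f t = 0) :
    ∃ c : ℝ, ∀ᵐ t ∂timeMeasure T, f t = c := by
  obtain ⟨η, hη, hη1⟩ := exists_testFunction_integral_one hT
  have hmul : ∀ ψ, IsTestFunction (Ioo 0 T) ψ →
      Integrable (fun t => ψ t * f t) (timeMeasure T) := fun ψ hψ => by
    obtain ⟨C, hC⟩ := hψ.hasCompactSupport.exists_bound_of_continuous hψ.contDiff.continuous
    exact hf.bdd_mul (c := C) hψ.contDiff.continuous.aestronglyMeasurable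
      (Eventually.of_forall hC)
  refine ⟨∫ t in Ioo 0 T, η t * f t, ?_⟩
  set c := ∫ t in Ioo 0 T, η t * f t
  have key := isOpen_Ioo.ae_eq_zero_of_integral_contDiff_smul_eq_zero (μ := volume)
    (U := Ioo 0 T) (f := fun t => f t - c)
    ((hf.sub (integrableOn_const (by simp))).locallyIntegrableOn) fun ψ h1 h2 h3 => by
      have hψ : IsTestFunction (Ioo 0 T) ψ := ⟨h1, h2, h3⟩
      have hψi : Integrable ψ := hψ.contDiff.continuous.integrable_of_hasCompactSupport h2
      have hηi : Integrable η := hη.contDiff.continuous.integrable_of_hasCompactSupport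
        hη.hasCompactSupport
      -- Subtracting `(∫ ψ) • η` makes the integral vanish, so the result is the derivative of a
      -- test function, on which the hypothesis applies.
      obtain ⟨θ, hθ, hθd⟩ := exists_testFunction_primitive hT
        (hψ.add (hη.smul (-∫ t, ψ t))) (by
          simp only [Pi.add_apply, Pi.smul_apply, smul_eq_mul]
          rw [integral_add hψi (hηi.const_mul _), integral_const_mul, hη1]
          ring)
      have h4 := h θ hθ
      rw [hθd] at h4
      have h5 : ∫ t in Ioo 0 T, (ψ + (-∫ t, ψ t) • η) t * f t
          = (∫ t in Ioo 0 T, ψ t * f t) + (-∫ t, ψ t) * c := by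
        rw [← integral_const_mul, ← integral_add (hmul ψ hψ) ((hmul η hη).const_mul _)]
        refine integral_congr_ae (Eventually.of_forall fun t => ?_)
        simp only [Pi.add_apply, Pi.smul_apply, smul_eq_mul]
        ring
      rw [h5] at h4
      have h6 : ∫ t in Ioo 0 T, ψ t * (f t - c) = (∫ t in Ioo 0 T, ψ t * f t) - (∫ t, ψ t) * c := by
        have h7 : ∫ t in Ioo 0 T, ψ t * c = (∫ t, ψ t) * c := by
          rw [setIntegral_mul_of_testFunction hψ, integral_mul_const]
        rw [← h7, ← integral_sub (hmul ψ hψ) (hψi.integrableOn.mul_const c)]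
        refine integral_congr_ae (Eventually.of_forall fun t => ?_)
        ring
      simp only [smul_eq_mul]
      rw [← setIntegral_mul_of_testFunction hψ, h6]
      linarith
  rw [ae_restrict_iff' measurableSet_Ioo]
  filter_upwards [key] with t ht htT
  linarith [ht htT]

end TestFunctions

section WeakDeriv
variable {T : ℝ} {X : Type} [NormedAddCommGroup X] [InnerProductSpace ℝ X] [CompleteSpace X]

theorem inner_integral_smul {f : ℝ → ℝ} (hf : Continuous f) (w : L2Time T X) (x : X) :
    inner ℝ (∫ t in Ioo 0 T, f t • w t) x = ∫ t in Ioo 0 T, f t * inner ℝ (w t) x := by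
  have hint : Integrable (fun t => f t • w t) (timeMeasure T) :=
    memLp_one_iff_integrable.1 ((Lp.memLp w).smul (memLp_time hf))
  rw [real_inner_comm, ← integral_inner hint]
  refine integral_congr_ae (Eventually.of_forall fun t => ?_)
  simp only [real_inner_smul_right, real_inner_comm]

/-- A function is determined by its weak derivative and its initial value. -/
theorem eqOn_of_hasWeakTimeDeriv (hT : 0 < T) {u v u' : L2Time T X} (hu : HasWeakTimeDeriv u u')
    (hv : HasWeakTimeDeriv v u') {w y : ℝ → X} (hw : ContinuousOn w (Icc 0 T))
    (hy : ContinuousOn y (Icc 0 T)) (huw : u =ᵐ[timeMeasure T] w) (hvy : v =ᵐ[timeMeasure T] y)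
    (h0 : w 0 = y 0) : EqOn w y (Icc 0 T) := by
  intro t ht
  refine ext_inner_right ℝ fun x => ?_
  have hcont : ContinuousOn (fun t => inner ℝ (w t - y t) x) (Icc 0 T) :=
    (hw.sub hy).inner continuousOn_const
  obtain ⟨c, hc⟩ := ae_eq_const_of_weak_deriv_eq_zero hT
    (f := fun t => inner ℝ (w t - y t) x)
    (hcont.integrableOn_Icc.mono_set Ioo_subset_Icc_self) fun ψ hψ => by
      have hc1 := hψ.continuous_deriv
      have e1 : ∫ t in Ioo 0 T, deriv ψ t * inner ℝ (w t - y t) x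
          = ∫ t in Ioo 0 T, deriv ψ t * inner ℝ ((u - v : L2Time T X) t) x := by
        refine integral_congr_ae ?_
        filter_upwards [huw, hvy, Lp.coeFn_sub u v] with t h1 h2 h3
        rw [h3, Pi.sub_apply, h1, h2]
      have e2 : ∫ t in Ioo 0 T, deriv ψ t • (u - v : L2Time T X) t = 0 := by
        have hint : ∀ z : L2Time T X, Integrable (fun t => deriv ψ t • z t) (timeMeasure T) :=
          fun z => memLp_one_iff_integrable.1 ((Lp.memLp z).smul (memLp_time hc1))
        rw [← sub_eq_zero.2 ((hu ψ hψ).trans (hv ψ hψ).symm), ← integral_sub (hint u) (hint v)]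
        refine integral_congr_ae ?_
        filter_upwards [Lp.coeFn_sub u v] with t h3
        rw [h3, Pi.sub_apply, smul_sub]
      rw [e1, ← inner_integral_smul hc1, e2, inner_zero_left]
  have hc2 : (fun t => inner ℝ (w t - y t) x) =ᵐ[volume.restrict (Icc 0 T)] fun _ => c := by
    rw [← restrict_Ioo_eq_restrict_Icc]
    exact hc
  have heq := Measure.eqOn_Icc_of_ae_eq volume hT.ne hc2 hcont continuousOn_const
  have h1 := heq (left_mem_Icc.2 hT.le)
  have h2 := heq ht
  simp only [h0, sub_self, inner_zero_left] at h1
  simp only [inner_sub_left, ← h1] at h2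
  linarith

omit [CompleteSpace X] in
theorem sq_norm_primitive_sub_le (hT : 0 ≤ T) {g f : ℝ → X} (hg : Continuous g) (hf : Continuous f)
    (x : X) {t : ℝ} (ht : t ∈ Icc 0 T) :
    ‖(x + ∫ s in (0 : ℝ)..t, g s) - (x + ∫ s in (0 : ℝ)..t, f s)‖ ^ 2
      ≤ T * ‖ofCont T hg - ofCont T hf‖ ^ 2 := by
  have hgf := hg.sub hf
  have h1 : (x + ∫ s in (0 : ℝ)..t, g s) - (x + ∫ s in (0 : ℝ)..t, f s)
      = ∫ s in (0 : ℝ)..t, (g s - f s) := by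
    rw [intervalIntegral.integral_sub (hg.intervalIntegrable _ _) (hf.intervalIntegrable _ _)]
    abel
  have h2 : ‖∫ s in (0 : ℝ)..t, (g s - f s)‖ ≤ ∫ s in (0 : ℝ)..T, ‖g s - f s‖ := by
    refine (intervalIntegral.norm_integral_le_integral_norm ht.1).trans ?_
    exact intervalIntegral.integral_mono_interval le_rfl ht.1 ht.2
      (Eventually.of_forall fun _ => norm_nonneg _) (hgf.norm.intervalIntegrable _ _)
  have h3 : ∫ s in (0 : ℝ)..T, ‖g s - f s‖ ≤ Real.sqrt T * ‖ofCont T hgf‖ := by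
    have := integral_norm_mul_norm_le (H := ℝ) hT (f := fun _ => (1 : ℝ))
      (g := fun s => ‖g s - f s‖) continuous_const hgf.norm
    have h4 := norm_ofCont_le_of_bound (T := T) (H := ℝ) hT (f := fun _ => (1 : ℝ)) continuous_const
      zero_le_one (by simp)
    have h5 : ‖ofCont T hgf.norm‖ = ‖ofCont T hgf‖ := by
      have := sq_norm_ofCont hT hgf.norm
      simp only [norm_norm] at this
      rw [← sq_norm_ofCont hT hgf] at this
      exact (sq_eq_sq₀ (norm_nonneg _) (norm_nonneg _)).1 this
    rw [mul_one] at h4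
    simp only [norm_one, one_mul, norm_norm] at this
    exact this.trans (mul_le_mul h4 h5.le (norm_nonneg _) (Real.sqrt_nonneg _))
  rw [h1, ofCont_sub]
  calc _ ≤ (Real.sqrt T * ‖ofCont T hgf‖) ^ 2 := by gcongr; exact h2.trans h3
    _ = _ := by rw [mul_pow, Real.sq_sqrt hT]

/-- The representative of a function with a weak derivative, and the chain rule for its
quadratic functionals. -/
theorem exists_representative (hT : 0 < T) {u u' : L2Time T X} {u₀ : X} (hu : HasWeakTimeDeriv u u')
    (hi : HasInitialValue u u₀) : ∃ y : ℝ → X, Continuous y ∧ u =ᵐ[timeMeasure T] y ∧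
      ∀ M : X →L[ℝ] X, (∀ a b, inner ℝ (M a) b = inner ℝ a (M b)) → ∀ t ∈ Icc 0 T,
        inner ℝ (M (y t)) (y t) = inner ℝ (M u₀) u₀
          + 2 * ∫ s in Ioo 0 t, inner ℝ (M (u' s)) (u s) := by
  obtain ⟨w, hw, huw, hw0⟩ := hi
  -- The primitives of continuous approximations of `u'` converge uniformly. Their limit has the
  -- weak derivative and initial value of `u`, hence represents it, and the identity for quadratic
  -- forms passes to the limit.
  obtain ⟨G, hG, hlim⟩ := exists_ofCont_tendsto u'
  let Y : ℕ → ℝ → X := fun n t => u₀ + ∫ s in (0 : ℝ)..t, G n s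
  have hYd : ∀ n t, HasDerivAt (Y n) (G n t) t := fun n t =>
    (intervalIntegral.integral_hasDerivAt_right ((hG n).intervalIntegrable _ _)
      (hG n).aestronglyMeasurable.stronglyMeasurableAtFilter (hG n).continuousAt).const_add _
  have hY : ∀ n, Continuous (Y n) := fun n =>
    continuous_iff_continuousAt.2 fun t => (hYd n t).continuousAt
  have hd : Tendsto (fun p : ℕ × ℕ => T * ‖ofCont T (hG p.1) - ofCont T (hG p.2)‖ ^ 2) atTop (𝓝 0) := by
    have h1 := cauchySeq_iff_tendsto_dist_atTop_0.1 hlim.cauchySeq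
    simp only [dist_eq_norm] at h1
    simpa using (h1.pow 2).const_mul T
  obtain ⟨y, hy, hYy, hYt⟩ := exists_limit_of_uniform_cauchy hT hY hd
    fun n m t ht => sq_norm_primitive_sub_le hT.le (hG n) (hG m) u₀ ht
  have hv : HasWeakTimeDeriv (ofCont T hy) u' := hasWeakTimeDeriv_of_inner fun ψ hψ x =>
    tendsto_nhds_unique (hYy.inner tendsto_const_nhds)
      ((hlim.inner tendsto_const_nhds).neg.congr fun n =>
        (inner_ofCont_deriv hT (hG n) (hYd n) (hY n) hψ x).symm)
  have hy0 : y 0 = u₀ := tendsto_nhds_unique (hYt 0 (left_mem_Icc.2 hT.le)) (by simp [Y])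
  have heq := eqOn_of_hasWeakTimeDeriv hT hu hv hw hy.continuousOn huw (coeFn_ofCont hy)
    (hw0.trans hy0.symm)
  have huy : u =ᵐ[timeMeasure T] y := by
    filter_upwards [huw, ae_restrict_mem measurableSet_Ioo] with t h1 h2
    rw [h1, heq (Ioo_subset_Icc_self h2)]
  have huv : u = ofCont T hy := Lp.ext (huy.trans (coeFn_ofCont hy).symm)
  refine ⟨y, hy, huy, fun M hM t ht => ?_⟩
  have hres : (timeMeasure T).restrict (Ioo 0 t) = timeMeasure t := by
    rw [timeMeasure, Measure.restrict_restrict measurableSet_Ioo,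
      inter_eq_left.2 (Ioo_subset_Ioo_right ht.2)]
  let r := LpToLpRestrictCLM ℝ X ℝ (timeMeasure T) 2 (Ioo 0 t)
  have hr : ∀ a b : L2Time T X, inner ℝ (r (M.compLp a)) (r b)
      = ∫ s in Ioo 0 t, inner ℝ (M (a s)) (b s) := fun a b => by
    rw [L2.inner_def]
    have h1 := ae_restrict_of_ae (s := Ioo 0 t) (M.coeFn_compLp a)
    have h2 := LpToLpRestrictCLM_coeFn (μ := timeMeasure T) ℝ (Ioo 0 t) (M.compLp a)
    have h3 := LpToLpRestrictCLM_coeFn (μ := timeMeasure T) ℝ (Ioo 0 t) b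
    rw [integral_congr_ae (g := fun s => inner ℝ (M (a s)) (b s)), hres]
    filter_upwards [h1, h2, h3] with s h4 h5 h6
    rw [h5, h6, h4]
  have hYn : ∀ n, inner ℝ (M (Y n t)) (Y n t) = inner ℝ (M u₀) u₀
      + 2 * inner ℝ (r (M.compLp (ofCont T (hG n)))) (r (ofCont T (hY n))) := fun n => by
    have h1 : ∀ s, HasDerivAt (fun s => inner ℝ (M (Y n s)) (Y n s))
        (2 * inner ℝ (M (G n s)) (Y n s)) s := fun s => by
      have h2 := (M.hasFDerivAt.comp_hasDerivAt s (hYd n s)).inner ℝ (hYd n s)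
      refine h2.congr_deriv ?_
      change inner ℝ (M (Y n s)) (G n s) + inner ℝ (M (G n s)) (Y n s) = _
      rw [hM (Y n s), real_inner_comm (Y n s)]
      ring
    have hc : Continuous fun s => inner ℝ (M (G n s)) (Y n s) :=
      (M.continuous.comp (hG n)).inner (hY n)
    have h3 := intervalIntegral.integral_eq_sub_of_hasDerivAt (a := 0) (b := t) (fun s _ => h1 s)
      ((hc.const_mul 2).intervalIntegrable _ _)
    have h4 : inner ℝ (r (M.compLp (ofCont T (hG n)))) (r (ofCont T (hY n)))
        = ∫ s in (0 : ℝ)..t, inner ℝ (M (G n s)) (Y n s) := by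
      rw [hr, ← integral_time ht.1]
      refine integral_congr_ae ?_
      have h5 := coeFn_ofCont (T := T) (hG n)
      have h6 := coeFn_ofCont (T := T) (hY n)
      have hle : timeMeasure t ≤ timeMeasure T :=
        Measure.restrict_mono (Ioo_subset_Ioo_right ht.2) le_rfl
      filter_upwards [ae_mono hle h5, ae_mono hle h6] with s h7 h8
      rw [h7, h8]
    rw [h4]
    rw [intervalIntegral.integral_const_mul] at h3
    have h9 : Y n 0 = u₀ := by simp [Y]
    rw [h9] at h3
    linarith
  rw [← hr u' u, huv]
  have l1 : Tendsto (fun n => inner ℝ (M (Y n t)) (Y n t)) atTop (𝓝 (inner ℝ (M (y t)) (y t))) :=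
    ((M.continuous.tendsto _).comp (hYt t ht)).inner (hYt t ht)
  have l2 : Tendsto (fun n => M.compLp (ofCont T (hG n))) atTop (𝓝 (M.compLp u')) :=
    ((M.compLpL 2 (timeMeasure T)).continuous.tendsto u').comp hlim
  have l3 := ((r.continuous.tendsto _).comp l2).inner (𝕜 := ℝ) ((r.continuous.tendsto _).comp hYy)
  exact tendsto_nhds_unique (l1.congr hYn) ((l3.const_mul 2).const_add _)

end WeakDeriv

/-! ### Continuous dependence -/

section Gronwall

/-- Apply the differential Gronwall inequality to the primitive of `z`, whose derivative is `z`
itself. -/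
theorem integral_le_of_le_integral {z : ℝ → ℝ} {T A c : ℝ} (hz : Continuous z) (hA : 0 ≤ A)
    (hc : 0 ≤ c) (hz0 : ∀ t, 0 ≤ z t) (h : ∀ t ∈ Icc 0 T, z t ≤ A + c * ∫ s in (0 : ℝ)..t, z s)
    {t : ℝ} (ht : t ∈ Icc 0 T) : ∫ s in (0 : ℝ)..t, z s ≤ Real.exp (c * T) * (A * T) := by
  have h1 := gronwall_dissipation (y := fun t => ∫ s in (0 : ℝ)..t, z s) (y' := z) (p := fun _ => 0)
    (k := fun _ => A) hc (fun t => intervalIntegral.integral_hasDerivAt_right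
      (hz.intervalIntegrable _ _) hz.aestronglyMeasurable.stronglyMeasurableAtFilter hz.continuousAt)
    (fun t ht => intervalIntegral.integral_nonneg ht.1 fun s _ => hz0 s) continuous_const
    continuous_const (fun _ _ => le_rfl) (fun _ _ => hA) (fun t ht => by linarith [h t ht]) ht
  simp only [intervalIntegral.integral_zero, mul_zero, add_zero, intervalIntegral.integral_same,
    intervalIntegral.integral_const, sub_zero, smul_eq_mul, zero_add] at h1
  rw [Real.exp_neg, inv_mul_le_iff₀ (Real.exp_pos _)] at h1
  refine h1.trans ?_
  rw [mul_comm t A]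
  gcongr
  exact ht.2

end Gronwall

section TimeIntegrals
variable {T : ℝ} {X : Type} [NormedAddCommGroup X] [InnerProductSpace ℝ X]

omit [InnerProductSpace ℝ X] in
theorem integrable_sq_norm (a : L2Time T X) : Integrable (fun t => ‖a t‖ ^ 2) (timeMeasure T) :=
  (Lp.memLp a).norm.integrable_sq

omit [InnerProductSpace ℝ X] in
theorem integrable_norm_mul_norm (a b : L2Time T X) :
    Integrable (fun t => ‖a t‖ * ‖b t‖) (timeMeasure T) :=
  (Lp.memLp a).norm.integrable_mul (Lp.memLp b).norm

omit [InnerProductSpace ℝ X] in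
theorem integral_norm_mul_norm_le_lp (a b : L2Time T X) :
    ∫ t in Ioo 0 T, ‖a t‖ * ‖b t‖ ≤ ‖a‖ * ‖b‖ := by
  have h : ∀ a : L2Time T X, ‖(Lp.memLp a).norm.toLp _‖ = ‖a‖ := fun a => by
    rw [Lp.norm_toLp, eLpNorm_norm, ← Lp.norm_def]
  rw [← h a, ← h b]
  refine le_trans (le_of_eq ?_) (real_inner_le_norm _ _)
  rw [L2.inner_def]
  refine integral_congr_ae ?_
  filter_upwards [MemLp.coeFn_toLp (Lp.memLp a).norm, MemLp.coeFn_toLp (Lp.memLp b).norm]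
    with t h1 h2
  rw [h1, h2]
  simp [mul_comm]

theorem norm_le_of_growth (hT : 0 ≤ T) {a b : L2Time T X} {C : ℝ}
    (h : ∀ᵐ t ∂timeMeasure T, ‖a t‖ ≤ C * (‖b t‖ + 1)) :
    ‖a‖ ≤ Real.sqrt (2 * C ^ 2 * (‖b‖ ^ 2 + T)) := by
  refine Real.le_sqrt_of_sq_le ?_
  rw [sq_norm_lp a, sq_norm_lp b]
  have h1 : ∫ _ in Ioo 0 T, (1 : ℝ) = T := by simp [hT]
  have h2 : Integrable (fun _ : ℝ => (1 : ℝ)) (timeMeasure T) := integrable_const 1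
  calc ∫ t in Ioo 0 T, ‖a t‖ ^ 2 ≤ ∫ t in Ioo 0 T, 2 * C ^ 2 * (‖b t‖ ^ 2 + 1) := by
        refine integral_mono_ae (integrable_sq_norm a)
          (((integrable_sq_norm b).add h2).const_mul _) ?_
        filter_upwards [h] with t ht
        have h3 := pow_le_pow_left₀ (norm_nonneg _) ht 2
        have h4 : (‖b t‖ + 1) ^ 2 ≤ 2 * (‖b t‖ ^ 2 + 1) := by nlinarith [sq_nonneg (‖b t‖ - 1)]
        refine h3.trans ?_
        rw [mul_pow]
        nlinarith [sq_nonneg C]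
    _ = _ := by
        rw [integral_const_mul, integral_add (integrable_sq_norm b) h2, h1]

theorem hasWeakTimeDeriv_sub {u v u' v' : L2Time T X} (hu : HasWeakTimeDeriv u u')
    (hv : HasWeakTimeDeriv v v') : HasWeakTimeDeriv (u - v) (u' - v') := by
  intro ψ hψ
  have hint : ∀ (f : ℝ → ℝ) (_ : Continuous f) (z : L2Time T X),
      Integrable (fun t => f t • z t) (timeMeasure T) :=
    fun f hf z => memLp_one_iff_integrable.1 ((Lp.memLp z).smul (memLp_time hf))
  have hsub : ∀ (f : ℝ → ℝ) (_ : Continuous f) (a b : L2Time T X),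
      ∫ t in Ioo 0 T, f t • (a - b : L2Time T X) t
        = (∫ t in Ioo 0 T, f t • a t) - ∫ t in Ioo 0 T, f t • b t := fun f hf a b => by
    rw [← integral_sub (hint f hf a) (hint f hf b)]
    refine integral_congr_ae ?_
    filter_upwards [Lp.coeFn_sub a b] with t ht
    rw [ht, Pi.sub_apply, smul_sub]
  rw [hsub _ hψ.continuous_deriv, hsub _ hψ.contDiff.continuous, hu ψ hψ, hv ψ hψ]
  abel

omit [InnerProductSpace ℝ X] in
theorem hasInitialValue_sub {u v : L2Time T X} {u₀ v₀ : X} (hu : HasInitialValue u u₀)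
    (hv : HasInitialValue v v₀) : HasInitialValue (u - v) (u₀ - v₀) := by
  obtain ⟨w, h1, h2, h3⟩ := hu
  obtain ⟨y, h4, h5, h6⟩ := hv
  refine ⟨w - y, h1.sub h4, ?_, by rw [Pi.sub_apply, h3, h6]⟩
  filter_upwards [Lp.coeFn_sub u v, h2, h5] with t e1 e2 e3
  rw [e1, Pi.sub_apply, e2, e3, Pi.sub_apply]

theorem hasWeakTimeDeriv_unique [CompleteSpace X] {u u' v' : L2Time T X} (h : HasWeakTimeDeriv u u')
    (h' : HasWeakTimeDeriv u v') : u' = v' := by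
  have key := isOpen_Ioo.ae_eq_zero_of_integral_contDiff_smul_eq_zero (μ := volume)
    (U := Ioo 0 T) (f := (u' - v' : L2Time T X))
    (IntegrableOn.locallyIntegrableOn (s := Ioo 0 T) (μ := volume)
      ((Lp.memLp (u' - v')).integrable (by norm_num)))
    fun ψ h1 h2 h3 => by
      have hψ : IsTestFunction (Ioo 0 T) ψ := ⟨h1, h2, h3⟩
      have h4 := hasWeakTimeDeriv_sub h h' ψ hψ
      have h5 : ∫ t in Ioo 0 T, deriv ψ t • (u - u : L2Time T X) t = 0 := by
        refine integral_eq_zero_of_ae ?_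
        rw [sub_self]
        filter_upwards [Lp.coeFn_zero X 2 (timeMeasure T)] with t ht
        rw [ht]
        simp
      rw [h5, eq_comm, neg_eq_zero] at h4
      rw [← h4, eq_comm]
      refine setIntegral_eq_integral_of_forall_compl_eq_zero fun t ht => ?_
      rw [image_eq_zero_of_notMem_tsupport fun h => ht (h3 h), zero_smul]
  rw [← sub_eq_zero]
  refine Lp.ext ?_
  have h6 : ∀ᵐ t ∂timeMeasure T, (u' - v' : L2Time T X) t = 0 := by
    rw [ae_restrict_iff' measurableSet_Ioo]
    exact key
  filter_upwards [h6, Lp.coeFn_zero X 2 (timeMeasure T)] with t h7 h8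
  rw [h7, h8]
  rfl

end TimeIntegrals

section Difference
variable {H V K : Type*} [NormedAddCommGroup H] [InnerProductSpace ℝ H]
  [NormedAddCommGroup V] [InnerProductSpace ℝ V] [NormedAddCommGroup K] [InnerProductSpace ℝ K]
  {J : V →L[ℝ] H} {D : V →L[ℝ] K} {𝒱 : Submodule ℝ V}
  {N : H →L[ℝ] V} {R : H →L[ℝ] H} {Q : H →L[ℝ] V}

/-- The basic inequality for the difference of two solutions, at a fixed time. -/
theorem IsPotentialSolver.difference_le (h : IsPotentialSolver J D 𝒱 N R Q) {τ k : ℝ}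
    {φ μ : V} {dφ ξ p ζ g s : H} (hμ : μ ∈ 𝒱)
    (e₁ : ∀ v ∈ 𝒱, inner ℝ dφ (J v) + inner ℝ (D μ) (D v) = 0)
    (e₂ : ∀ v, τ * inner ℝ dφ (J v) + inner ℝ (D φ) (D v) + inner ℝ (ξ + p + ζ) (J v)
      = inner ℝ (J μ + g) (J v))
    (hξ : 0 ≤ inner ℝ ξ (J φ)) (hζ : 0 ≤ inner ℝ ζ (J φ - s)) (hp : ‖p‖ ≤ k * ‖J φ‖)
    (hR : R (J φ) = J φ) :
    inner ℝ (τ • dφ + J (N dφ)) (J φ) + ‖D φ‖ ^ 2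
      ≤ (k + 1 / 2) * ‖J φ‖ ^ 2 + (1 / 2 * ‖g‖ ^ 2 + ‖ζ‖ * ‖s‖) := by
  -- The first equation is tested with `N (J φ)` and the second with `φ`. Since `R (J φ) = J φ`,
  -- both contain `⟪J μ, J φ⟫`, which is eliminated between them.
  have h1 := e₁ _ (h.N_mem (J φ))
  rw [real_inner_comm (D (N (J φ))) (D μ), h.inner_N _ _ hμ, hR] at h1
  have h2 := e₂ φ
  rw [inner_add_left, inner_add_left, inner_add_left, real_inner_self_eq_norm_sq] at h2
  have h3 : inner ℝ (J (N dφ)) (J φ) = inner ℝ dφ (J (N (J φ))) := h.N_symm _ _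
  have h4 := neg_le_of_abs_le ((abs_real_inner_le_norm p (J φ)).trans
    (mul_le_mul_of_nonneg_right hp (norm_nonneg _)))
  have h5 := real_inner_le_norm g (J φ)
  have h6 := neg_le_of_abs_le (abs_real_inner_le_norm ζ s)
  rw [inner_sub_right] at hζ
  rw [inner_add_left, real_inner_smul_left, h3]
  rw [real_inner_comm (J φ) (J μ)] at h2
  nlinarith [sq_nonneg (‖g‖ - ‖J φ‖)]

end Difference

section AbstractStability
variable {H V K : Type} [NormedAddCommGroup H] [InnerProductSpace ℝ H] [CompleteSpace H]
  [NormedAddCommGroup V] [InnerProductSpace ℝ V] [NormedAddCommGroup K] [InnerProductSpace ℝ K]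
  {J : V →L[ℝ] H} {D : V →L[ℝ] K} {𝒱 : Submodule ℝ V}
  {N : H →L[ℝ] V} {R : H →L[ℝ] H} {Q : H →L[ℝ] V} {T : ℝ}

omit [CompleteSpace H] in
/-- The difference of two solutions, at a fixed time. -/
theorem exists_difference {τ k : ℝ} {φ₁ φ₂ μ₁ μ₂ : V} {d₁ d₂ ξ₁ ξ₂ p₁ p₂ ζ₁ ζ₂ g₁ g₂ s₁ s₂ : H}
    (hμ₁ : μ₁ ∈ 𝒱) (hμ₂ : μ₂ ∈ 𝒱)
    (e₁ : ∀ v ∈ 𝒱, inner ℝ d₁ (J v) + inner ℝ (D μ₁) (D v) = 0)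
    (e₂ : ∀ v ∈ 𝒱, inner ℝ d₂ (J v) + inner ℝ (D μ₂) (D v) = 0)
    (f₁ : ∀ v, τ * inner ℝ d₁ (J v) + inner ℝ (D φ₁) (D v) + inner ℝ (ξ₁ + p₁ + ζ₁) (J v)
      = inner ℝ (J μ₁ + g₁) (J v))
    (f₂ : ∀ v, τ * inner ℝ d₂ (J v) + inner ℝ (D φ₂) (D v) + inner ℝ (ξ₂ + p₂ + ζ₂) (J v)
      = inner ℝ (J μ₂ + g₂) (J v))
    (hξ : 0 ≤ inner ℝ (ξ₁ - ξ₂) (J φ₁ - J φ₂))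
    (hζ : 0 ≤ inner ℝ (ζ₁ - ζ₂) (J φ₁ - s₁ - (J φ₂ - s₂))) (hp : ‖p₁ - p₂‖ ≤ k * ‖J φ₁ - J φ₂‖) :
    ∃ m ∈ 𝒱, ∃ ξ p : H,
      (∀ v ∈ 𝒱, inner ℝ (d₁ - d₂) (J v) + inner ℝ (D m) (D v) = 0) ∧
      (∀ v, τ * inner ℝ (d₁ - d₂) (J v) + inner ℝ (D (φ₁ - φ₂)) (D v)
        + inner ℝ (ξ + p + (ζ₁ - ζ₂)) (J v) = inner ℝ (J m + (g₁ - g₂)) (J v)) ∧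
      0 ≤ inner ℝ ξ (J (φ₁ - φ₂)) ∧ 0 ≤ inner ℝ (ζ₁ - ζ₂) (J (φ₁ - φ₂) - (s₁ - s₂)) ∧
      ‖p‖ ≤ k * ‖J (φ₁ - φ₂)‖ := by
  refine ⟨μ₁ - μ₂, Submodule.sub_mem _ hμ₁ hμ₂, ξ₁ - ξ₂, p₁ - p₂, fun v hv => ?_, fun v => ?_,
    ?_, ?_, ?_⟩
  · rw [map_sub, inner_sub_left, inner_sub_left]
    linarith [e₁ v hv, e₂ v hv]
  · have h1 := f₁ v
    have h2 := f₂ v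
    simp only [map_sub, inner_sub_left, inner_add_left] at h1 h2 ⊢
    linarith
  · rwa [map_sub]
  · rwa [map_sub, sub_sub_sub_comm]
  · rwa [map_sub]

-- Testing with `Q f`, whose gradient vanishes, shows that `a` is orthogonal to `f - R f` for every
-- `f`.
omit [CompleteSpace H] in
theorem IsPotentialSolver.fixed_of_orthogonal (h : IsPotentialSolver J D 𝒱 N R Q) {a : H} {m : V}
    (e : ∀ v ∈ 𝒱, inner ℝ a (J v) + inner ℝ (D m) (D v) = 0) : R a = a := by
  refine ext_inner_right ℝ fun f => ?_
  have h1 := e _ (h.Q_mem f)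
  rw [h.D_Q, inner_zero_right, add_zero, h.J_Q, inner_sub_right, ← h.P_symm] at h1
  linarith

-- The symmetric projection `1 - R` annihilates `u'`, so its quadratic form is constant along `y`;
-- it vanishes initially, hence always.
omit [CompleteSpace H] in
theorem IsPotentialSolver.fixed_representative (h : IsPotentialSolver J D 𝒱 N R Q)
    {u u' : L2Time T H} {u₀ : H} {y : ℝ → H}
    (hy : ∀ M : H →L[ℝ] H, (∀ a b, inner ℝ (M a) b = inner ℝ a (M b)) → ∀ t ∈ Icc 0 T,
        inner ℝ (M (y t)) (y t) = inner ℝ (M u₀) u₀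
          + 2 * ∫ s in Ioo 0 t, inner ℝ (M (u' s)) (u s))
    (hu' : ∀ᵐ t ∂timeMeasure T, R (u' t) = u' t) (hu₀ : R u₀ = u₀) {t : ℝ} (ht : t ∈ Icc 0 T) :
    R (y t) = y t := by
  let M : H →L[ℝ] H := ContinuousLinearMap.id ℝ H - R
  have hM : ∀ a, M a = a - R a := fun a => rfl
  have h1 := hy M (fun a b => by
    rw [hM, hM, inner_sub_left, inner_sub_right, h.P_symm]) t ht
  have h2 : ∫ s in Ioo 0 t, inner ℝ (M (u' s)) (u s) = 0 := by
    refine integral_eq_zero_of_ae ?_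
    have hle : timeMeasure t ≤ timeMeasure T :=
      Measure.restrict_mono (Ioo_subset_Ioo_right ht.2) le_rfl
    filter_upwards [ae_mono hle hu'] with s hs
    rw [hM, hs, sub_self, inner_zero_left]
    rfl
  rw [h2, hM, hM, hu₀, sub_self, inner_zero_left, mul_zero, add_zero] at h1
  have h3 : inner ℝ (y t - R (y t)) (y t - R (y t)) = 0 := by
    rw [inner_sub_right, h1, zero_sub, neg_eq_zero, inner_sub_left, h.P_symm (y t) (R (y t)), h.P_P, sub_self]
  exact (sub_eq_zero.1 (inner_self_eq_zero.1 h3)).symm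

/-- The stability estimate for differences of solutions. -/
theorem IsPotentialSolver.exists_stability (h : IsPotentialSolver J D 𝒱 N R Q)
    (hV : ∀ v w : V, inner ℝ v w = inner ℝ (J v) (J w) + inner ℝ (D v) (D w)) (hT : 0 < T)
    {τ k : ℝ} (hτ : 0 < τ) (hk : 0 ≤ k) : ∃ C : ℝ, 0 ≤ C ∧
    ∀ (δ : L2Time T V) (w' ζ g s : L2Time T H) (w₀ : H), HasWeakTimeDeriv (J.compLp δ) w' →
      HasInitialValue (J.compLp δ) w₀ → R w₀ = w₀ →
      (∀ᵐ t ∂timeMeasure T, ∃ m ∈ 𝒱, ∃ ξ p : H,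
        (∀ v ∈ 𝒱, inner ℝ (w' t) (J v) + inner ℝ (D m) (D v) = 0) ∧
        (∀ v, τ * inner ℝ (w' t) (J v) + inner ℝ (D (δ t)) (D v) + inner ℝ (ξ + p + ζ t) (J v)
          = inner ℝ (J m + g t) (J v)) ∧
        0 ≤ inner ℝ ξ (J (δ t)) ∧ 0 ≤ inner ℝ (ζ t) (J (δ t) - s t) ∧ ‖p‖ ≤ k * ‖J (δ t)‖) →
      (∀ᵐ t ∂timeMeasure T, ‖J (δ t)‖ ^ 2 ≤ C * (‖w₀‖ ^ 2 + ‖g‖ ^ 2 + ‖ζ‖ * ‖s‖)) ∧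
        ‖δ‖ ^ 2 ≤ C * (‖w₀‖ ^ 2 + ‖g‖ ^ 2 + ‖ζ‖ * ‖s‖) := by
  let M : H →L[ℝ] H := τ • ContinuousLinearMap.id ℝ H + J.comp N
  have hM : ∀ a, M a = τ • a + J (N a) := fun a => rfl
  -- After division by `τ`, `c` is the Gronwall rate; `B` collects the initial value, through `‖M‖`,
  -- and the doubled data terms, through `2`; `E` bounds the integral of `‖y‖ ^ 2`.
  set c : ℝ := (2 * k + 1) / τ with hc
  have hc0 : 0 ≤ c := by positivity
  set B : ℝ := (‖M‖ + 2) / τ with hB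
  have hB0 : 0 ≤ B := by positivity
  set E : ℝ := Real.exp (c * T) * T with hE
  have hE0 : 0 ≤ E := by positivity
  refine ⟨B * (1 + c * E) * (1 + τ) + B * E, by positivity,
    fun δ w' ζ g s w₀ hder hinit hR₀ hae => ?_⟩
  set Θ : ℝ := ‖w₀‖ ^ 2 + ‖g‖ ^ 2 + ‖ζ‖ * ‖s‖ with hΘ
  have hΘ0 : 0 ≤ Θ := by positivity
  obtain ⟨y, hyc, hwy, hy⟩ := exists_representative hT hder hinit
  have hJδ : ∀ᵐ t ∂timeMeasure T, J.compLp δ t = J (δ t) := J.coeFn_compLp δ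
  have hfix : ∀ t ∈ Icc 0 T, R (y t) = y t := fun t => h.fixed_representative hy (hae.mono fun t ⟨m, _, _, _, e, _⟩ =>
    h.fixed_of_orthogonal e) hR₀
  have hpt : ∀ᵐ t ∂timeMeasure T, inner ℝ (M (w' t)) (J.compLp δ t) + ‖D (δ t)‖ ^ 2
      ≤ (k + 1 / 2) * ‖y t‖ ^ 2 + (1 / 2 * ‖g t‖ ^ 2 + ‖ζ t‖ * ‖s t‖) := by
    filter_upwards [hae, hJδ, hwy, ae_restrict_mem measurableSet_Ioo]
      with t ⟨m, hm, ξ, p, e₁, e₂, h1, h2, h3⟩ h4 h5 h6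
    rw [← h5, h4, hM]
    refine h.difference_le hm e₁ e₂ h1 h2 h3 ?_
    rw [← h4, h5, hfix t (Ioo_subset_Icc_self h6)]
  have hDδ : ∀ᵐ t ∂timeMeasure T, D.compLp δ t = D (δ t) := D.coeFn_compLp δ
  have i1 : Integrable (fun t => inner ℝ (M (w' t)) (J.compLp δ t)) (timeMeasure T) := by
    refine (L2.integrable_inner (𝕜 := ℝ) (M.compLp w') (J.compLp δ)).congr ?_
    filter_upwards [M.coeFn_compLp w'] with t h1
    rw [h1]
  have i2 : Integrable (fun t => ‖D (δ t)‖ ^ 2) (timeMeasure T) := by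
    refine (integrable_sq_norm (D.compLp δ)).congr ?_
    filter_upwards [hDδ] with t h1
    rw [h1]
  have i3 : Integrable (fun t => ‖y t‖ ^ 2) (timeMeasure T) :=
    ((memLp_time hyc).norm).integrable_sq
  have i4 : Integrable (fun t => 1 / 2 * ‖g t‖ ^ 2 + ‖ζ t‖ * ‖s t‖) (timeMeasure T) :=
    ((integrable_sq_norm g).const_mul _).add (integrable_norm_mul_norm ζ s)
  have hT4 : ∫ t in Ioo 0 T, (1 / 2 * ‖g t‖ ^ 2 + ‖ζ t‖ * ‖s t‖) ≤ Θ - ‖w₀‖ ^ 2 := by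
    rw [integral_add ((integrable_sq_norm g).const_mul _) (integrable_norm_mul_norm ζ s),
      integral_const_mul, ← sq_norm_lp g]
    have := integral_norm_mul_norm_le_lp ζ s
    rw [hΘ]
    nlinarith [sq_nonneg ‖g‖]
  have main : ∀ t ∈ Icc 0 T, τ * ‖y t‖ ^ 2 + 2 * ∫ r in Ioo 0 t, ‖D (δ r)‖ ^ 2
      ≤ (‖M‖ + 2) * Θ + (2 * k + 1) * ∫ r in (0 : ℝ)..t, ‖y r‖ ^ 2 := by
    intro t ht
    have hsub : Ioo 0 t ⊆ Ioo 0 T := Ioo_subset_Ioo_right ht.2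
    have hle : timeMeasure t ≤ timeMeasure T := Measure.restrict_mono hsub le_rfl
    have e1 := hy M (fun a b => by
      rw [hM, hM, inner_add_left, inner_add_right, real_inner_smul_left, real_inner_smul_right,
        h.N_symm]) t ht
    have e2 : τ * ‖y t‖ ^ 2 ≤ inner ℝ (M (y t)) (y t) := by
      rw [hM, inner_add_left, real_inner_smul_left, real_inner_self_eq_norm_sq]
      linarith [h.N_nonneg (y t)]
    have e3 : inner ℝ (M w₀) w₀ ≤ ‖M‖ * ‖w₀‖ ^ 2 := by
      refine (real_inner_le_norm _ _).trans ?_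
      rw [sq, ← mul_assoc]
      gcongr
      exact M.le_opNorm w₀
    have e4 : (∫ r in Ioo 0 t, inner ℝ (M (w' r)) (J.compLp δ r)) + ∫ r in Ioo 0 t, ‖D (δ r)‖ ^ 2
        ≤ (k + 1 / 2) * (∫ r in Ioo 0 t, ‖y r‖ ^ 2)
          + ∫ r in Ioo 0 t, (1 / 2 * ‖g r‖ ^ 2 + ‖ζ r‖ * ‖s r‖) := by
      rw [← integral_const_mul, ← integral_add (i1.mono_measure hle) (i2.mono_measure hle),
        ← integral_add ((i3.mono_measure hle).const_mul _) (i4.mono_measure hle)]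
      exact integral_mono_ae ((i1.mono_measure hle).add (i2.mono_measure hle))
        (((i3.mono_measure hle).const_mul _).add (i4.mono_measure hle)) (ae_mono hle hpt)
    have e5 : ∫ r in Ioo 0 t, (1 / 2 * ‖g r‖ ^ 2 + ‖ζ r‖ * ‖s r‖) ≤ Θ - ‖w₀‖ ^ 2 :=
      (setIntegral_mono_set i4 (Eventually.of_forall fun r => by positivity)
        (Eventually.of_forall hsub)).trans hT4
    have e6 : ‖M‖ * ‖w₀‖ ^ 2 ≤ ‖M‖ * Θ := by
      gcongr
      rw [hΘ]
      have : 0 ≤ ‖g‖ ^ 2 + ‖ζ‖ * ‖s‖ := by positivity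
      linarith
    rw [integral_time ht.1 fun r => ‖y r‖ ^ 2] at e4
    nlinarith [sq_nonneg ‖w₀‖]
  have hz : ∀ t ∈ Icc 0 T, ‖y t‖ ^ 2 ≤ B * Θ + c * ∫ r in (0 : ℝ)..t, ‖y r‖ ^ 2 := by
    intro t ht
    have h1 := main t ht
    have h2 : 0 ≤ ∫ r in Ioo 0 t, ‖D (δ r)‖ ^ 2 := integral_nonneg fun r => by positivity
    rw [hB, hc, div_mul_eq_mul_div, div_mul_eq_mul_div, ← add_div, le_div_iff₀ hτ]
    linarith
  have hint : ∀ t ∈ Icc 0 T, ∫ r in (0 : ℝ)..t, ‖y r‖ ^ 2 ≤ E * (B * Θ) := fun t ht => by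
    refine (integral_le_of_le_integral (hyc.norm.pow 2) (mul_nonneg hB0 hΘ0) hc0
      (fun t => sq_nonneg ‖y t‖) hz ht).trans_eq ?_
    rw [hE]; ring
  have hsup : ∀ t ∈ Icc 0 T, ‖y t‖ ^ 2 ≤ B * (1 + c * E) * Θ := fun t ht => by
    have := mul_le_mul_of_nonneg_left (hint t ht) hc0
    linarith [hz t ht]
  have hp1 : 0 ≤ B * (1 + c * E) * τ * Θ := by positivity
  have hp2 : 0 ≤ B * E * Θ := by positivity
  have hp3 : 0 ≤ B * (1 + c * E) * Θ := by positivity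
  refine ⟨?_, ?_⟩
  · filter_upwards [hJδ, hwy, ae_restrict_mem measurableSet_Ioo] with t h1 h2 h3
    rw [← h1, h2]
    linarith [hsup t (Ioo_subset_Icc_self h3)]
  · have hTT : T ∈ Icc 0 T := right_mem_Icc.2 hT.le
    -- The `V` norm splits into the integral of `‖y‖ ^ 2`, bounded by Gronwall, and that of the
    -- gradients, bounded by the inequality `main` at the final time.
    have e1 : ‖δ‖ ^ 2 = (∫ t in (0 : ℝ)..T, ‖y t‖ ^ 2) + ∫ t in Ioo 0 T, ‖D (δ t)‖ ^ 2 := by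
      rw [sq_norm_lp, ← integral_time hT.le, ← integral_add i3 i2]
      refine integral_congr_ae ?_
      filter_upwards [hJδ, hwy] with t h1 h2
      rw [sq_norm_form hV, ← h2, h1]
    have e2 := main T hTT
    have e3 := hint T hTT
    have e4 := mul_le_mul_of_nonneg_left e3 hc0
    have e5 : (‖M‖ + 2) * Θ = τ * (B * Θ) := by rw [hB]; field_simp
    have e6 : (2 * k + 1) * ∫ r in (0 : ℝ)..T, ‖y r‖ ^ 2 = τ * (c * ∫ r in (0 : ℝ)..T, ‖y r‖ ^ 2) := by
      rw [hc]; field_simp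
    have e7 := mul_le_mul_of_nonneg_left e4 hτ.le
    have e8 : 0 ≤ τ * ‖y T‖ ^ 2 := by positivity
    have e9 : 0 ≤ ∫ t in Ioo 0 T, ‖D (δ t)‖ ^ 2 := integral_nonneg fun r => by positivity
    rw [e1]
    nlinarith

end AbstractStability

/-! ### Comparison of solutions of the original system -/

section Uniqueness
variable {d : ℕ} {Ω : Set (EuclideanSpace ℝ (Fin d))} {T : ℝ} {P : SystemStructure Ω}
  {bc : BoundaryCondition}

/-- The equations in terms of the inner products of `L²`. -/
theorem IsSolution.exists_hilbert [IsFiniteMeasure (volume.restrict Ω)] {K : ℝ≥0}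
    (hK : LipschitzWith K (deriv P.PiHat)) {D : ProblemData Ω T} {phi mu : L2Time T (H1 Ω)}
    {xi zeta : L2Time T (L2 Ω)} (h : IsSolution P bc D phi mu xi zeta) :
    ∃ dphi : L2Time T (L2 Ω), HasWeakTimeDeriv ((H1.toL2 Ω).compLp phi) dphi ∧
      HasInitialValue ((H1.toL2 Ω).compLp phi) (H1.toL2 Ω D.phi0) ∧
      ∀ᵐ t ∂timeMeasure T, mu t ∈ bc.space Ω ∧
        xi t ∈ lpGraph (volume.restrict Ω) (betaGraph P.betaHat) (H1.toL2 Ω (phi t)) ∧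
        zeta t ∈ sGraph P.SHat (H1.toL2 Ω (phi t) - D.phiStar t) ∧
        (∀ v ∈ bc.space Ω, inner ℝ (dphi t) (H1.toL2 Ω v)
          + inner ℝ (H1.grad Ω (mu t)) (H1.grad Ω v) = 0) ∧
        ∀ v, P.tau * inner ℝ (dphi t) (H1.toL2 Ω v) + inner ℝ (H1.grad Ω (phi t)) (H1.grad Ω v)
          + inner ℝ (xi t + lipComp hK (H1.toL2 Ω (phi t)) + zeta t) (H1.toL2 Ω v)
          = inner ℝ (H1.toL2 Ω (mu t) + D.g t) (H1.toL2 Ω v) := by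
  obtain ⟨h1, h2, h3, ⟨dphi, h4, h5, h6⟩, h7⟩ := h
  refine ⟨dphi, h4, h7, ?_⟩
  filter_upwards [h1, h2, h3, h5, h6] with t e1 e2 e3 e5 e6
  refine ⟨e1, e2, e3, fun v hv => ?_, fun v => ?_⟩
  · rw [← integral_mul_eq_inner, ← integral_inner_eq]
    exact e5 v hv
  · rw [← integral_mul_eq_inner, ← integral_inner_eq, ← integral_nonlinear_mul_eq_inner hK,
      ← integral_add_mul_eq_inner]
    exact e6 v

/-- The linear growth of `S` bounds `ζ` through `φ - φ*`, whose norm is at most `2 M`. No smallness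
of differences of the `ζ` is available. -/
theorem norm_zeta_le (hT : 0 < T) {CS M : ℝ}
    (hCS : ∀ u v : L2 Ω, v ∈ sGraph P.SHat u → ‖v‖ ≤ CS * (‖u‖ + 1)) {D : ProblemData Ω T}
    {phi mu : L2Time T (H1 Ω)} {xi zeta : L2Time T (L2 Ω)} (h : IsSolution P bc D phi mu xi zeta)
    (hphi : ‖(H1.toL2 Ω).compLp phi‖ ≤ M) (hstar : ‖D.phiStar‖ ≤ M) :
    ‖zeta‖ ≤ Real.sqrt (2 * CS ^ 2 * ((2 * M) ^ 2 + T)) := by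
  have h1 := norm_le_of_growth hT.le (a := zeta) (b := (H1.toL2 Ω).compLp phi - D.phiStar)
    (C := CS) (by
      filter_upwards [h.2.2.1, Lp.coeFn_sub ((H1.toL2 Ω).compLp phi) D.phiStar,
        (H1.toL2 Ω).coeFn_compLp phi] with t e1 e2 e3
      rw [e2, Pi.sub_apply, e3]
      exact hCS _ _ e1)
  refine h1.trans (Real.sqrt_le_sqrt ?_)
  have h2 : ‖(H1.toL2 Ω).compLp phi - D.phiStar‖ ≤ 2 * M := (norm_sub_le _ _).trans (by linarith)
  gcongr

/-- Continuous dependence on the data. -/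
theorem exists_stability_estimate (hd : 1 ≤ d) (hΩ : IsSmoothBoundedDomain Ω) (hT : 0 < T)
    (hP : P.Admissible) : ∃ C : ℝ, 0 ≤ C ∧ ∀ D₁ D₂ : ProblemData Ω T,
      (bc = .neumann → mean (H1.toL2 Ω D₁.phi0) = mean (H1.toL2 Ω D₂.phi0)) →
      ∀ (phi₁ mu₁ phi₂ mu₂ : L2Time T (H1 Ω)) (xi₁ zeta₁ xi₂ zeta₂ : L2Time T (L2 Ω)),
        IsSolution P bc D₁ phi₁ mu₁ xi₁ zeta₁ → IsSolution P bc D₂ phi₂ mu₂ xi₂ zeta₂ →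
        (∀ᵐ t ∂timeMeasure T, ‖H1.toL2 Ω (phi₁ t - phi₂ t)‖ ^ 2
          ≤ C * (‖H1.toL2 Ω (D₁.phi0 - D₂.phi0)‖ ^ 2 + ‖D₁.g - D₂.g‖ ^ 2
            + ‖zeta₁ - zeta₂‖ * ‖D₁.phiStar - D₂.phiStar‖)) ∧
        ‖phi₁ - phi₂‖ ^ 2 ≤ C * (‖H1.toL2 Ω (D₁.phi0 - D₂.phi0)‖ ^ 2 + ‖D₁.g - D₂.g‖ ^ 2
            + ‖zeta₁ - zeta₂‖ * ‖D₁.phiStar - D₂.phiStar‖) := by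
  have := isFiniteMeasure_of_isBounded hΩ.isBounded
  obtain ⟨K, hK⟩ := hP.PiHat_deriv_lipschitz
  obtain ⟨N, R, Q, h, hdir, hneu⟩ := exists_potentialSolver hd hΩ bc
  obtain ⟨C, hC0, hC⟩ := h.exists_stability inner_H1 hT hP.tau_pos K.coe_nonneg
  refine ⟨C, hC0, fun D₁ D₂ hmean phi₁ mu₁ phi₂ mu₂ xi₁ zeta₁ xi₂ zeta₂ s₁ s₂ => ?_⟩
  have hB := isMaximalMonotone_lpGraph (μ := volume.restrict Ω)
    (isMaximalMonotone_betaGraph hP.betaHat_convex hP.betaHat_lsc hP.betaHat_zero)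
  have hS : IsMaximalMonotone (sGraph P.SHat) :=
    isMaximalMonotone_subdifferential hP.SHat_convex hP.SHat_lsc
  obtain ⟨d₁, w₁, i₁, a₁⟩ := IsSolution.exists_hilbert hK s₁
  obtain ⟨d₂, w₂, i₂, a₂⟩ := IsSolution.exists_hilbert hK s₂
  have hcomp : (H1.toL2 Ω).compLp (phi₁ - phi₂)
      = (H1.toL2 Ω).compLp phi₁ - (H1.toL2 Ω).compLp phi₂ :=
    map_sub ((H1.toL2 Ω).compLpL 2 (timeMeasure T)) phi₁ phi₂
  have hR₀ : R (H1.toL2 Ω (D₁.phi0 - D₂.phi0)) = H1.toL2 Ω (D₁.phi0 - D₂.phi0) := by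
    cases bc with
    | dirichlet => rw [hdir rfl]; rfl
    | neumann =>
      have h1 := hmean rfl
      rw [hneu rfl, removeMean_apply, ← mean_eq]
      have h2 : mean (H1.toL2 Ω (D₁.phi0 - D₂.phi0)) = 0 := by
        rw [map_sub, mean_eq, inner_sub_right, mul_sub, ← mean_eq, ← mean_eq, h1, sub_self]
      rw [h2, zero_smul, sub_zero]
  have hsub := Lp.coeFn_sub phi₁ phi₂
  obtain ⟨c1, c2⟩ := hC (phi₁ - phi₂) (d₁ - d₂) (zeta₁ - zeta₂) (D₁.g - D₂.g)
    (D₁.phiStar - D₂.phiStar) (H1.toL2 Ω (D₁.phi0 - D₂.phi0))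
    (by rw [hcomp]; exact hasWeakTimeDeriv_sub w₁ w₂)
    (by rw [hcomp, map_sub]; exact hasInitialValue_sub i₁ i₂) hR₀ (by
      filter_upwards [a₁, a₂, hsub, Lp.coeFn_sub d₁ d₂, Lp.coeFn_sub zeta₁ zeta₂,
        Lp.coeFn_sub D₁.g D₂.g, Lp.coeFn_sub D₁.phiStar D₂.phiStar]
        with t ⟨m₁, x₁, z₁, p₁, q₁⟩ ⟨m₂, x₂, z₂, p₂, q₂⟩ h1 h2 h3 h4 h5
      rw [h1, h2, h3, h4, h5]
      simp only [Pi.sub_apply]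
      exact exists_difference m₁ m₂ p₁ p₂ q₁ q₂ (hB.monotone x₁ x₂) (hS.monotone z₁ z₂)
        (norm_lipComp_sub_le hK _ _))
  refine ⟨?_, c2⟩
  filter_upwards [c1, hsub] with t h1 h2
  rw [h2] at h1
  exact h1

/-- In the quadratic estimate, `‖ζ₁ - ζ₂‖` is replaced by a constant, so `‖φ*₁ - φ*₂‖` enters as the
square of its square root `q`. Then the quadratic terms are dominated by the square of the sum. -/
theorem exists_continuous_dependence (hd : 1 ≤ d) (hΩ : IsSmoothBoundedDomain Ω) (hT : 0 < T)
    (hP : P.Admissible) (M : ℝ) : ∃ C : ℝ, ∀ D₁ D₂ : ProblemData Ω T,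
      (bc = .neumann → mean (H1.toL2 Ω D₁.phi0) = mean (H1.toL2 Ω D₂.phi0)) →
      ∀ (phi₁ mu₁ phi₂ mu₂ : L2Time T (H1 Ω)) (xi₁ zeta₁ xi₂ zeta₂ : L2Time T (L2 Ω)),
        IsSolution P bc D₁ phi₁ mu₁ xi₁ zeta₁ → IsSolution P bc D₂ phi₂ mu₂ xi₂ zeta₂ →
        ‖(H1.toL2 Ω).compLp phi₁‖ ≤ M → ‖(H1.toL2 Ω).compLp phi₂‖ ≤ M →
        ‖D₁.phiStar‖ ≤ M → ‖D₂.phiStar‖ ≤ M →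
          eLpNorm (fun t => H1.toL2 Ω (phi₁ t - phi₂ t)) ⊤ (timeMeasure T)
              + ENNReal.ofReal ‖phi₁ - phi₂‖
            ≤ ENNReal.ofReal (C * (‖D₁.g - D₂.g‖ + ‖H1.toL2 Ω (D₁.phi0 - D₂.phi0)‖
                + ‖D₁.phiStar - D₂.phiStar‖ ^ (1 / 2 : ℝ))) := by
  obtain ⟨C, hC0, hC⟩ := exists_stability_estimate (bc := bc) hd hΩ hT hP
  obtain ⟨CS, hCS⟩ := hP.S_growth
  set Z : ℝ := Real.sqrt (2 * CS ^ 2 * ((2 * M) ^ 2 + T))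
  set B : ℝ := Real.sqrt (C * (1 + 2 * Z))
  -- Each of the two norms on the left is at most `B` times the sum of the data terms.
  refine ⟨2 * B, fun D₁ D₂ hmean phi₁ mu₁ phi₂ mu₂ xi₁ zeta₁ xi₂ zeta₂ s₁ s₂ b₁ b₂ b₃ b₄ => ?_⟩
  obtain ⟨c1, c2⟩ := hC D₁ D₂ hmean phi₁ mu₁ phi₂ mu₂ xi₁ zeta₁ xi₂ zeta₂ s₁ s₂
  have hζ : ‖zeta₁ - zeta₂‖ ≤ 2 * Z := (norm_sub_le _ _).trans (by
    linarith [norm_zeta_le hT hCS s₁ b₁ b₃, norm_zeta_le hT hCS s₂ b₂ b₄])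
  set a := ‖D₁.g - D₂.g‖
  set b := ‖H1.toL2 Ω (D₁.phi0 - D₂.phi0)‖
  set q := ‖D₁.phiStar - D₂.phiStar‖ ^ (1 / 2 : ℝ)
  have ha : 0 ≤ a := norm_nonneg _
  have hb : 0 ≤ b := norm_nonneg _
  have hq : 0 ≤ q := Real.rpow_nonneg (norm_nonneg _) _
  have hq2 : ‖D₁.phiStar - D₂.phiStar‖ = q ^ 2 := by
    rw [← Real.rpow_natCast, ← Real.rpow_mul (norm_nonneg _)]
    norm_num
  have hZ : 0 ≤ Z := Real.sqrt_nonneg _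
  have hΘ : C * (b ^ 2 + a ^ 2 + ‖zeta₁ - zeta₂‖ * ‖D₁.phiStar - D₂.phiStar‖)
      ≤ (B * (a + b + q)) ^ 2 := by
    rw [mul_pow, Real.sq_sqrt (by positivity), hq2, mul_assoc]
    refine mul_le_mul_of_nonneg_left ?_ hC0
    have h1 : ‖zeta₁ - zeta₂‖ * q ^ 2 ≤ 2 * Z * q ^ 2 := by gcongr
    have h2 : 0 ≤ 2 * Z * ((a + b + q) ^ 2 - q ^ 2) := by
      have : 0 ≤ (a + b + q) ^ 2 - q ^ 2 := by ring_nf; positivity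
      positivity
    nlinarith [mul_nonneg ha hb, mul_nonneg ha hq, mul_nonneg hb hq, sq_nonneg q]
  have hX : 0 ≤ B * (a + b + q) := by positivity
  rw [mul_assoc, two_mul, ENNReal.ofReal_add hX hX]
  refine add_le_add ?_ (ENNReal.ofReal_le_ofReal (le_of_sq_le_sq (c2.trans hΘ) hX))
  rw [eLpNorm_exponent_top]
  refine eLpNormEssSup_le_of_ae_bound ?_
  filter_upwards [c1] with t ht
  exact le_of_sq_le_sq (ht.trans hΘ) hX

/-- Equal `φ` have equal time derivatives. Testing the difference of the first equations with `μ₁ -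
μ₂` makes its gradient vanish, and Poincaré's inequality in `H¹₀` finishes. -/
theorem potential_unique (hd : 1 ≤ d) (hΩ : IsSmoothBoundedDomain Ω)
    (hP : P.Admissible) {D : ProblemData Ω T} {phi mu₁ mu₂ : L2Time T (H1 Ω)}
    {xi₁ zeta₁ xi₂ zeta₂ : L2Time T (L2 Ω)} (h₁ : IsSolution P .dirichlet D phi mu₁ xi₁ zeta₁)
    (h₂ : IsSolution P .dirichlet D phi mu₂ xi₂ zeta₂) : mu₁ = mu₂ := by
  have := isFiniteMeasure_of_isBounded hΩ.isBounded
  obtain ⟨K, hK⟩ := hP.PiHat_deriv_lipschitz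
  obtain ⟨C, hC⟩ := exists_poincare_H10 hd hΩ.isOpen.measurableSet hΩ.isBounded
  obtain ⟨d₁, w₁, _, a₁⟩ := IsSolution.exists_hilbert hK h₁
  obtain ⟨d₂, w₂, _, a₂⟩ := IsSolution.exists_hilbert hK h₂
  obtain rfl := hasWeakTimeDeriv_unique w₁ w₂
  refine Lp.ext ?_
  filter_upwards [a₁, a₂] with t ⟨m₁, _, _, p₁, _⟩ ⟨m₂, _, _, p₂, _⟩
  have hm : mu₁ t - mu₂ t ∈ H10 Ω := Submodule.sub_mem _ m₁ m₂
  have e1 := p₁ _ hm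
  have e2 := p₂ _ hm
  have e3 : ‖H1.grad Ω (mu₁ t - mu₂ t)‖ ^ 2 = 0 := by
    rw [← real_inner_self_eq_norm_sq]
    nth_rw 1 [map_sub]
    rw [inner_sub_left]
    linarith
  have e4 : ‖H1.grad Ω (mu₁ t - mu₂ t)‖ = 0 := by simpa using e3
  have e5 := hC _ hm
  rw [e4, mul_zero] at e5
  have e6 := sq_norm_form (inner_H1 (Ω := Ω)) (mu₁ t - mu₂ t)
  rw [e4, le_antisymm e5 (norm_nonneg _)] at e6
  have e7 : ‖mu₁ t - mu₂ t‖ = 0 := by simpa using e6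
  exact sub_eq_zero.1 (norm_eq_zero.1 e7)

end Uniqueness

end ViscousCahnHilliard

open ViscousCahnHilliard in
theorem theorem2p1 {d : ℕ} (hd₁ : 1 ≤ d) (hd₃ : d ≤ 3)
    (Ω : Set (EuclideanSpace ℝ (Fin d))) (hΩ : IsSmoothBoundedDomain Ω)
    (T : ℝ) (hT : 0 < T)
    (P : SystemStructure Ω) (hP : P.Admissible) (bc : BoundaryCondition) :
    -- existence
    (∀ D : ProblemData Ω T, D.Admissible P bc →
      ∃ (phi mu : L2Time T (H1 Ω)) (xi zeta : L2Time T (L2 Ω)),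
        IsSolution P bc D phi mu xi zeta) ∧
    -- uniqueness of the first component, and of the second one in the Dirichlet case
    (∀ D : ProblemData Ω T, D.Admissible P bc →
      ∀ (phi₁ mu₁ phi₂ mu₂ : L2Time T (H1 Ω)) (xi₁ zeta₁ xi₂ zeta₂ : L2Time T (L2 Ω)),
        IsSolution P bc D phi₁ mu₁ xi₁ zeta₁ → IsSolution P bc D phi₂ mu₂ xi₂ zeta₂ →
          phi₁ = phi₂ ∧ (bc = .dirichlet → mu₁ = mu₂)) ∧
    -- continuous dependence
    (∀ M : ℝ, ∃ C : ℝ, ∀ D₁ D₂ : ProblemData Ω T, D₁.Admissible P bc → D₂.Admissible P bc →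
      (bc = .neumann → mean (H1.toL2 Ω D₁.phi0) = mean (H1.toL2 Ω D₂.phi0)) →
      ∀ (phi₁ mu₁ phi₂ mu₂ : L2Time T (H1 Ω)) (xi₁ zeta₁ xi₂ zeta₂ : L2Time T (L2 Ω)),
        IsSolution P bc D₁ phi₁ mu₁ xi₁ zeta₁ → IsSolution P bc D₂ phi₂ mu₂ xi₂ zeta₂ →
        ‖(H1.toL2 Ω).compLp phi₁‖ ≤ M → ‖(H1.toL2 Ω).compLp phi₂‖ ≤ M →
        ‖D₁.phiStar‖ ≤ M → ‖D₂.phiStar‖ ≤ M →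
          eLpNorm (fun t => H1.toL2 Ω (phi₁ t - phi₂ t)) ⊤ (timeMeasure T)
              + ENNReal.ofReal ‖phi₁ - phi₂‖
            ≤ ENNReal.ofReal (C * (‖D₁.g - D₂.g‖ + ‖H1.toL2 Ω (D₁.phi0 - D₂.phi0)‖
                + ‖D₁.phiStar - D₂.phiStar‖ ^ (1 / 2 : ℝ)))) := by
  have hdep := exists_continuous_dependence (bc := bc) hd₁ hΩ hT hP
  refine ⟨fun D hD => exists_isSolution hd₁ hΩ hT hP hD, ?_, ?_⟩
  · intro D _ phi₁ mu₁ phi₂ mu₂ xi₁ zeta₁ xi₂ zeta₂ h₁ h₂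
    -- Uniqueness is continuous dependence for equal data, with `M` chosen after the two solutions.
    obtain ⟨C, hC⟩ := hdep (max ‖D.phiStar‖
      (max ‖(H1.toL2 Ω).compLp phi₁‖ ‖(H1.toL2 Ω).compLp phi₂‖))
    have h := hC D D (fun _ => rfl) phi₁ mu₁ phi₂ mu₂ xi₁ zeta₁ xi₂ zeta₂ h₁ h₂
      ((le_max_left _ _).trans (le_max_right _ _)) ((le_max_right _ _).trans (le_max_right _ _))
      (le_max_left _ _) (le_max_left _ _)
    have h0 : C * (‖D.g - D.g‖ + ‖H1.toL2 Ω (D.phi0 - D.phi0)‖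
        + ‖D.phiStar - D.phiStar‖ ^ (1 / 2 : ℝ)) = 0 := by
      simp
    rw [h0, ENNReal.ofReal_zero] at h
    have h3 : ENNReal.ofReal ‖phi₁ - phi₂‖ ≤ 0 := le_add_self.trans h
    obtain rfl : phi₁ = phi₂ := sub_eq_zero.1 (norm_le_zero_iff.1
      (ENNReal.ofReal_eq_zero.1 (le_antisymm h3 bot_le)))
    refine ⟨rfl, ?_⟩
    rintro rfl
    exact potential_unique hd₁ hΩ hP h₁ h₂
  · intro M
    obtain ⟨C, hC⟩ := hdep M
    exact ⟨C, fun D₁ D₂ _ _ => hC D₁ D₂⟩
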